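/- **Setting.** Let $m\ge 1$, $I_m=\{(j,\alpha)\in\mathbb N^2 : j+\alpha\le m,\ j<m\}$, let $\mathcal M\subset\mathbb N\times\mathbb N$ be finite, $N=\#\mathcal M$, and let $a(x)$ and $c_{j,\alpha}(x)$ ($(j,\alpha)\in I_m$) be holomorphic near $0\in\mathbb C$. Put $$C(x;\lambda,\rho)=\lambda^m-\sum_{(j,\alpha)\in I_m}c_{j,\alpha}(x)\,\lambda^j\rho(\rho-1)\cdots(\rho-\alpha+1),$$ and let $G_2(t,x,\boldsymbol z)=\sum_{i+|\boldsymbol\nu|\ge 2}g_{i,\boldsymbol\nu}(x)t^i\boldsymbol z^{\boldsymbol\nu}$, $\boldsymbol z=\{z_{j,\alpha}\}_{(j,\alpha)\in\mathcal M}$, $\boldsymbol\nu\in\mathbb N^N$, be holomorphic near the origin of $\mathbb C_t\times\mathbb C_x\times\mathbb C^N_{\boldsymbol z}$. Consider $$C(x;t\partial_t,x\partial_x)u=a(x)t+G_2\bigl(t,x,\{(t\partial_t)^j\partial_x^\alpha u\}_{(j,\alpha)\in\mathcal M}\bigr).\qquad(*)$$ **Indices.** Let $\Lambda_0=\{(m,0)\}\cup\{(j,\alpha)\in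 I_m: c_{j,\alpha}(0)\ne0\}$, $\Lambda_1=\{(j,\alpha)\in I_m: c_{j,\alpha}(0)=0,\ c_{j,\alpha}\not\equiv0\}$, and let $\mathcal N_0$ be the convex hull of $\bigcup_{(j,\alpha)\in\Lambda_0}\{(x,y)\in\mathbb R^2: x\le j,\ y\le\alpha\}$. For $(j,\alpha)\in\Lambda_1$ let $p_{j,\alpha}\ge1$ be the order of the zero of $c_{j,\alpha}$ at $0$ and $d_{j,\alpha}=\min\{y\in\mathbb R:(j,\alpha-y)\in\mathcal N_0\}$, and put $$\sigma_0=\max\Bigl[1,\max_{(j,\alpha)\in\Lambda_1}\frac{p_{j,\alpha}+d_{j,\alpha}}{p_{j,\alpha}}\Bigr].$$ For $\mu\in\mathbb N$ let $J_\mu=\{(i,\boldsymbol\nu): i+|\boldsymbol\nu|\ge2,\ |\boldsymbol\nu|\ge1,\ (\partial_x^\mu g_{i,\boldsymbol\nu})(0)\ne0\}$, and for $|\boldsymbol\nu|\ge1$ let $m_{\boldsymbol\nu,\mu}=\max\{\,j+\max\{\alpha,\mu+\sigma_0(\alpha-\mu)\} : (j,\alpha)\in\mathcal M,\ \nu_{j,\alpha}>0\}$;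 put $$s_0=1+\max\Bigl[0,\ \sup_{\mu\ge0}\ \sup_{(i,\boldsymbol\nu)\in J_\mu}\frac{m_{\boldsymbol\nu,\mu}-m}{i+|\boldsymbol\nu|-1}\Bigr].$$ Let $M=\max\{\alpha:(j,\alpha)\in\mathcal M\}$ ($M=0$ if $\mathcal M=\emptyset$), let $L_{\mu,j,\alpha}\in\mathbb N\cup\{\infty\}$ be the least total degree in $(t,\boldsymbol z)$ of a monomial with nonzero coefficient in $(\partial_{z_{j,\alpha}}\partial_x^\mu G_2)(t,0,\boldsymbol z)$ ($\infty$ if there is none), and put, with $r/\infty=0$, $$s_1=1+\max\Bigl[0,\ \max_{0\le\mu\le M}\ \max_{(j,\alpha)\in\mathcal M,\ \alpha\ge\mu}\frac{j+\mu+\sigma_0(\alpha-\mu)-m}{L_{\mu,j,\alpha}}\Bigr].$$ For $s,\sigma\ge1$, a series $\sum u_{k,l}t^kx^l\in\mathbb C[[t,x]]$ belongs to $G\{t,x\}_{(s,\sigma)}$ if $\sum \frac{u_{k,l}}{k!^{\,s-1}\,l!^{\,\sigma-1}}t^kx^l$ converges near $(0,0)$. For $f(x)=\sum f_lx^l$,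 $f\gg0$ means that $f_l\ge0$ for all $l$. **Theorem.** Suppose $s_0=s_1$. If $\sigma_0=1$, suppose moreover that $s_0=1$; if $\sigma_0>1$, suppose moreover that $G_2$ really depends on $\boldsymbol z$, i.e. $g_{i,\boldsymbol\nu}\not\equiv0$ for some $(i,\boldsymbol\nu)$ with $|\boldsymbol\nu|\ge1$. Assume * c-1) $(\partial_x^m a)(0)>0$, $(\partial_x^\mu a)(0)>0$ for $0\le\mu\le M$, and $a(x)\gg0$; * c-2) $c_{j,\alpha}(0)\le0$ for all $(j,\alpha)\in I_m$; * c-3) $c_{j,\alpha}(x)-c_{j,\alpha}(0)\gg0$ for all $(j,\alpha)\in I_m$; * c-4) $g_{i,\boldsymbol\nu}(x)\gg0$ for all $(i,\boldsymbol\nu)$ with $i+|\boldsymbol\nu|\ge2$. Then $(*)$ has a unique formal solution $u(t,x)\in\mathbb C[[t,x]]$ with $u(0,x)\equiv0$, and for all $s,\sigma\ge1$, $u\in G\{t,x\}_{(s,\sigma)}$ if and only if $s\ge s_0$ and $\sigma\ge\sigma_0$. -/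

import Mathlib

open scoped PowerSeries ComplexOrder

noncomputable section

namespace TotChar

/-- The index set `I_m = {(j, α) ; j + α ≤ m, j < m}`. -/
def indexI (m : ℕ) : Finset (ℕ × ℕ) :=
  (Finset.range m ×ˢ Finset.range (m + 1)).filter fun p => p.1 + p.2 ≤ m

/-- `f` is a convergent power series in one variable (an element of `ℂ{x}`), i.e. the Taylor
series of a holomorphic germ at `0`. -/
def Convergent (f : ℂ⟦X⟧) : Prop :=
  ∃ r : ℝ, 0 < r ∧ Summable fun l : ℕ => ‖PowerSeries.coeff l f‖ * r ^ l

/-- `f(x) ≫ 0`: all coefficients are (real and) nonnegative. In the order on `ℂ` used here,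
`0 ≤ z` means that `z` is a nonnegative real number. -/
def SeriesNonneg (f : ℂ⟦X⟧) : Prop :=
  ∀ l : ℕ, 0 ≤ PowerSeries.coeff l f

/-- The data of an equation
`C(x; t∂_t, x∂_x) u = a(x) t + G₂(t, x, {(t∂_t)^j ∂_x^α u}_{(j,α) ∈ M})`, where
`C(x; λ, ρ) = λ^m - ∑_{(j,α) ∈ I_m} c_{j,α}(x) λ^j ρ(ρ-1)⋯(ρ-α+1)`.
Holomorphic germs are given by their (convergent) Taylor series:
`G₂(t, x, z) = ∑_{i+|ν| ≥ 2} g_{i,ν}(x) t^i z^ν`. -/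
structure Equation where
  /-- the order `m ≥ 1` of the principal part -/
  m : ℕ
  m_pos : 0 < m
  /-- the finite set of derivatives `(j, α)` that may occur in the nonlinear part -/
  M : Finset (ℕ × ℕ)
  a : ℂ⟦X⟧
  a_conv : Convergent a
  /-- the coefficients `c_{j,α}(x)`; only those with `(j, α) ∈ I_m` are ever used -/
  c : ℕ × ℕ → ℂ⟦X⟧
  c_conv : ∀ p ∈ indexI m, Convergent (c p)
  /-- the coefficients `g_{i,ν}(x)` of the nonlinear part -/
  g : ℕ → (M → ℕ) → ℂ⟦X⟧
  g_low : ∀ i ν, i + ∑ p, ν p < 2 → g i ν = 0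
  /-- `G₂` is holomorphic near the origin: its Taylor series converges in a polydisc. -/
  g_conv : ∃ r : ℝ, 0 < r ∧ Summable fun q : ℕ × (M → ℕ) × ℕ =>
    ‖PowerSeries.coeff q.2.2 (g q.1 q.2.1)‖ * r ^ (q.1 + (∑ p, q.2.1 p) + q.2.2)

/-! ### Formal series in `(t, x)`

`ℂ[[t,x]]` is realised as `ℂ[[x]][[t]]`; the coefficient of `t^k x^l` in `u` is
`coeff l (coeff k u)`. -/

/-- The Euler operator `t ∂_t` on `ℂ[[x]][[t]]`. -/
def tDt (u : ℂ⟦X⟧⟦X⟧) : ℂ⟦X⟧⟦X⟧ :=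
  PowerSeries.mk fun k => (k : ℂ) • PowerSeries.coeff k u

/-- The derivation `∂_x` on `ℂ[[x]][[t]]`. -/
def Dx (u : ℂ⟦X⟧⟦X⟧) : ℂ⟦X⟧⟦X⟧ :=
  PowerSeries.mk fun k => PowerSeries.derivative ℂ (PowerSeries.coeff k u)

/-- The Euler operator `x ∂_x` on `ℂ[[x]][[t]]`. -/
def xDx (u : ℂ⟦X⟧⟦X⟧) : ℂ⟦X⟧⟦X⟧ :=
  PowerSeries.C (PowerSeries.X : ℂ⟦X⟧) * Dx u

/-- The operator `[x∂_x]_α = (x∂_x)(x∂_x - 1)⋯(x∂_x - α + 1)`, with `[x∂_x]_0 = 1`. -/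
def fallingOp : ℕ → ℂ⟦X⟧⟦X⟧ → ℂ⟦X⟧⟦X⟧
  | 0, u => u
  | α + 1, u => xDx (fallingOp α u) - (α : ℂ) • fallingOp α u

/-- The formal Gevrey class `G{t,x}_{(s,σ)}` (for `s ≥ 1`, `σ ≥ 1`):
`∑ u_{k,l} / (k!^{s-1} l!^{σ-1}) t^k x^l` converges near the origin. -/
def IsGevrey (s σ : ℝ) (u : ℂ⟦X⟧⟦X⟧) : Prop :=
  ∃ r : ℝ, 0 < r ∧ Summable fun q : ℕ × ℕ =>
    ‖PowerSeries.coeff q.2 (PowerSeries.coeff q.1 u)‖ /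
      ((q.1.factorial : ℝ) ^ (s - 1) * (q.2.factorial : ℝ) ^ (σ - 1)) * r ^ (q.1 + q.2)

/-- The valuation of a formal series `∑ f_{i,ν} t^i z^ν`: the least `i + |ν|` with
`f_{i,ν} ≠ 0`, and `∞` for the zero series. -/
def val {ι : Type*} [Fintype ι] (f : ℕ → (ι → ℕ) → ℂ) : ℕ∞ :=
  ⨅ (i : ℕ) (ν : ι → ℕ) (_ : f i ν ≠ 0), ((i + ∑ p, ν p : ℕ) : ℕ∞)

namespace Equation

variable (E : Equation)

/-- The left-hand side `C(x; t∂_t, x∂_x) u`. -/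
def opC (u : ℂ⟦X⟧⟦X⟧) : ℂ⟦X⟧⟦X⟧ :=
  tDt^[E.m] u - ∑ p ∈ indexI E.m, PowerSeries.C (E.c p) * tDt^[p.1] (fallingOp p.2 u)

/-- The term `g_{i,ν}(x) t^i ∏_{(j,α) ∈ M} ((t∂_t)^j ∂_x^α u)^{ν_{j,α}}`. -/
def term (u : ℂ⟦X⟧⟦X⟧) (i : ℕ) (ν : E.M → ℕ) : ℂ⟦X⟧⟦X⟧ :=
  PowerSeries.C (E.g i ν) * PowerSeries.X ^ i *
    ∏ p : E.M, (tDt^[p.1.1] (Dx^[p.1.2] u)) ^ ν p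

/-- The series `G₂(t, x, {(t∂_t)^j ∂_x^α u})` for `u` with `u(0,x) = 0`: the coefficient of `t^k`
is the sum of the coefficients of `t^k` of all terms, only finitely many of which are nonzero
(`support_term_finite` below). -/
def nonlin (u : ℂ⟦X⟧⟦X⟧) : ℂ⟦X⟧⟦X⟧ :=
  PowerSeries.mk fun k => ∑ᶠ q : ℕ × (E.M → ℕ), PowerSeries.coeff k (E.term u q.1 q.2)

/-- `u` is a formal solution with `u(0,x) ≡ 0`. -/
def IsFormalSolution (u : ℂ⟦X⟧⟦X⟧) : Prop :=
  PowerSeries.coeff 0 u = 0 ∧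
    E.opC u = PowerSeries.C E.a * PowerSeries.X + E.nonlin u

/-! ### The Newton polygon and the irregularity -/

/-- `Λ₀ = {(m,0)} ∪ {(j,α) ∈ I_m ; c_{j,α}(0) ≠ 0}`. -/
def Lam0 : Set (ℕ × ℕ) :=
  {(E.m, 0)} ∪ {p | p ∈ indexI E.m ∧ PowerSeries.constantCoeff (E.c p) ≠ 0}

/-- `Λ₁ = {(j,α) ∈ I_m ; c_{j,α}(0) = 0, c_{j,α} ≢ 0}`. -/
def Lam1 : Set (ℕ × ℕ) :=
  {p | p ∈ indexI E.m ∧ PowerSeries.constantCoeff (E.c p) = 0 ∧ E.c p ≠ 0}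

/-- The Newton polygon at `x = 0`: the convex hull of the union of the quadrants
`{(x,y) ; x ≤ j, y ≤ α}`, `(j,α) ∈ Λ₀`. -/
def newton : Set (ℝ × ℝ) :=
  convexHull ℝ (⋃ p ∈ E.Lam0, {w : ℝ × ℝ | w.1 ≤ (p.1 : ℝ) ∧ w.2 ≤ (p.2 : ℝ)})

/-- `p_{j,α}`: the order of the zero of `c_{j,α}` at `x = 0` (for `c_{j,α} ≢ 0`). -/
def ordC (p : ℕ × ℕ) : ℕ := (E.c p).order.toNat

/-- `d_{j,α} = min {y ; (j, α - y) ∈ N₀}`; for `j ≤ m` the set is a closed half-line bounded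
below, so the infimum is a minimum. -/
def dist (p : ℕ × ℕ) : ℝ :=
  sInf {y : ℝ | ((p.1 : ℝ), (p.2 : ℝ) - y) ∈ E.newton}

/-- The irregularity `σ₀ = max [1, max_{(j,α) ∈ Λ₁} (p_{j,α} + d_{j,α}) / p_{j,α}]`
(a maximum of finitely many numbers). -/
def sigma0 : ℝ :=
  sSup (insert 1 ((fun p => ((E.ordC p : ℝ) + E.dist p) / (E.ordC p : ℝ)) '' E.Lam1))

/-! ### The indices `s₀` and `s₁` -/

/-- `J_μ = {(i,ν) ; i + |ν| ≥ 2, |ν| ≥ 1, (∂_x^μ g_{i,ν})(0) ≠ 0}`. -/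
def J (μ : ℕ) : Set (ℕ × (E.M → ℕ)) :=
  {q | 2 ≤ q.1 + ∑ p, q.2 p ∧ 1 ≤ ∑ p, q.2 p ∧
    PowerSeries.constantCoeff ((PowerSeries.derivative ℂ)^[μ] (E.g q.1 q.2)) ≠ 0}

/-- `m_{ν,μ} = max_{(j,α) ; ν_{j,α} > 0} (j + max {α, μ + σ₀ (α - μ)})`, for `|ν| ≥ 1`
(a maximum over a nonempty finite set). -/
def mIdx (ν : E.M → ℕ) (μ : ℕ) : ℝ :=
  sSup ((fun p : E.M => (p.1.1 : ℝ) +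
    max (p.1.2 : ℝ) ((μ : ℝ) + E.sigma0 * ((p.1.2 : ℝ) - (μ : ℝ)))) '' {p | 0 < ν p})

/-- `s₀ = 1 + max [0, sup_{μ ≥ 0} sup_{(i,ν) ∈ J_μ} (m_{ν,μ} - m) / (i + |ν| - 1)]`; the set is
bounded above, since `m_{ν,μ} ≤ max_{(j,α) ∈ M} (j + σ₀ α)` and the denominators are `≥ 1`. -/
def s0 : ℝ :=
  1 + sSup (insert 0 {r : ℝ | ∃ μ : ℕ, ∃ q ∈ E.J μ,
    r = (E.mIdx q.2 μ - (E.m : ℝ)) / ((q.1 : ℝ) + ((∑ p, q.2 p : ℕ) : ℝ) - 1)})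

/-- `L_{μ,j,α} = val ((∂_{z_{j,α}} ∂_x^μ G₂)(t, 0, z))`. The coefficient of `t^i z^ν` in that
series is `(ν_{j,α} + 1) (∂_x^μ g_{i,ν+e_{j,α}})(0)`. -/
def L (μ : ℕ) (p : E.M) : ℕ∞ :=
  val fun (i : ℕ) (ν : E.M → ℕ) => ((ν p : ℂ) + 1) *
    PowerSeries.constantCoeff ((PowerSeries.derivative ℂ)^[μ] (E.g i (ν + Pi.single p 1)))

/-- `M = max {α ; (j,α) ∈ M}`. -/
def maxAlpha : ℕ := E.M.sup Prod.snd

open Classical in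
/-- `s₁ = 1 + max [0, max_{0 ≤ μ ≤ maxAlpha} max_{(j,α) ∈ M, α ≥ μ}
(j + μ + σ₀ (α - μ) - m) / L_{μ,j,α}]`, where a quotient by `∞` is `0`
(a maximum of finitely many numbers). -/
def s1 : ℝ :=
  1 + sSup (insert 0 {r : ℝ | ∃ μ : ℕ, μ ≤ E.maxAlpha ∧ ∃ p : E.M, μ ≤ p.1.2 ∧
    r = if E.L μ p = ⊤ then 0 else
      ((p.1.1 : ℝ) + (μ : ℝ) + E.sigma0 * ((p.1.2 : ℝ) - (μ : ℝ)) - (E.m : ℝ)) /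
        ((E.L μ p).toNat : ℝ)})

/-- If `u(0,x) = 0`, then only finitely many terms contribute to each power of `t`. -/
theorem support_term_finite (u : ℂ⟦X⟧⟦X⟧) (hu : PowerSeries.coeff 0 u = 0) (k : ℕ) :
    (Function.support fun q : ℕ × (E.M → ℕ) =>
      PowerSeries.coeff k (E.term u q.1 q.2)).Finite := by
  have hD : ∀ v : ℂ⟦X⟧⟦X⟧, PowerSeries.coeff 0 v = 0 → PowerSeries.coeff 0 (Dx v) = 0 := by
    intro v hv
    rw [Dx, PowerSeries.coeff_mk, hv, map_zero]
  have hT : ∀ v : ℂ⟦X⟧⟦X⟧, PowerSeries.coeff 0 v = 0 → PowerSeries.coeff 0 (tDt v) = 0 := by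
    intro v hv
    rw [tDt, PowerSeries.coeff_mk, hv, smul_zero]
  have hDn : ∀ n, PowerSeries.coeff 0 (Dx^[n] u) = 0 := by
    intro n
    induction n with
    | zero => exact hu
    | succ n ih => rw [Function.iterate_succ_apply']; exact hD _ ih
  have hTn : ∀ j n, PowerSeries.coeff 0 (tDt^[j] (Dx^[n] u)) = 0 := by
    intro j n
    induction j with
    | zero => exact hDn n
    | succ j ih => rw [Function.iterate_succ_apply']; exact hT _ ih
  have hfin : ((Finset.range (k + 1) ×ˢ
      Fintype.piFinset fun _ : E.M => Finset.range (k + 1) : Finset (ℕ × (E.M → ℕ))) :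
        Set (ℕ × (E.M → ℕ))).Finite := Finset.finite_toSet _
  refine hfin.subset ?_
  rintro ⟨i, ν⟩ hq
  have hdvd : (PowerSeries.X : ℂ⟦X⟧⟦X⟧) ^ (i + ∑ p, ν p) ∣ E.term u i ν := by
    rw [term, pow_add, ← Finset.prod_pow_eq_pow_sum]
    refine mul_dvd_mul (Dvd.intro_left _ rfl) (Finset.prod_dvd_prod_of_dvd _ _ ?_)
    intro p _
    refine pow_dvd_pow_of_dvd (PowerSeries.X_dvd_iff.2 ?_) _
    rw [← PowerSeries.coeff_zero_eq_constantCoeff_apply]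
    exact hTn _ _
  have hle : i + ∑ p, ν p ≤ k := by
    by_contra hlt
    exact hq (PowerSeries.X_pow_dvd_iff.1 hdvd k (not_le.1 hlt))
  have hν : ∀ p, ν p ≤ ∑ p, ν p := fun p =>
    Finset.single_le_sum (f := ν) (fun _ _ => Nat.zero_le _) (Finset.mem_univ p)
  simp only [Finset.coe_product, Set.mem_prod, Finset.mem_coe, Finset.mem_range,
    Fintype.mem_piFinset]
  exact ⟨by omega, fun p => by have := hν p; omega⟩

end Equation

end TotChar

end

namespace TotChar

/-! ### Coefficients of the operators -/

/-! Comparing coefficients of t^k x^l gives C(0;k,l) u_{k,l} = (terms in u_{k,l'} with l' < l) +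
(terms in lower powers of t). As c_{j,α}(0) ≤ 0, the factor C(0;k,l) is a sum of nonnegative terms,
one of them k^m. It does not vanish for k ≥ 1, so the formal solution exists and is unique; the
other sign conditions make all its coefficients nonnegative.

Upper bound. The coefficient of t^k is majorized by a multiple of ∑ R^l ((N)_l)^σ₀ / l! x^l with N
linear in k. Under products the indices N add, and x^μ ∂_x^α costs a power of N with exponent max{α,
μ+σ₀(α-μ)}. The symbol C(0;k,l) dominates k^j l^(α-d), and the missing l^d is paid by the growth of
the weights over at least p powers of x, because d ≤ p(σ₀-1). For R large the linear part is
therefore inverted in this scale, uniformly in k and N (`exists_maj_of_recursion`). Since N is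
comparable to k, derivatives now cost powers of k. In a nonlinear monomial only the factor of
highest order in t has to pay, at most k^(m+(s₀-1)r) with r = i+|ν|-1. The symbol returns k^m, and
k!^(s₀-1) returns the rest because the order in t drops by r (`omg_sub_le`, `maj_term`,
`exists_maj`).

Lower bound. By positivity each single contribution to the recursion bounds u_{k,l} from below.
Choose a supporting line of the Newton polygon of slope -θ with θ < 1, and keep k ≈ T^θ while l
grows to T. Repeating the linear step of a pair (j,α) attaining σ₀ then produces values of size
exp((σ₀-1) T log T), up to an arbitrarily small loss in the exponent. As k = o(l), this forces σ ≥
σ₀ (`reach_sigma0`, `Reach.le_sub_one`). Getting to such k in the first place uses that G₂ depends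
on z (`exists_base`). Starting from such a value at l ≈ (α-μ)n, repeating a nonlinear step n times
trades the powers of x for about L n powers of t. Comparison with the Gevrey bound at the end point
gives s ≥ s₁ (`s1_le`), and s₀ = s₁ closes the gap. If σ₀ = 1, then s₀ = 1 by hypothesis and the
necessity is trivial. -/

theorem coeff_tDt_iter (j k : ℕ) (u : ℂ⟦X⟧⟦X⟧) :
    PowerSeries.coeff k (tDt^[j] u) = (k : ℂ) ^ j • PowerSeries.coeff k u := by
  induction j with
  | zero => simp
  | succ j ih =>
    rw [Function.iterate_succ_apply', tDt, PowerSeries.coeff_mk, ih, smul_smul, pow_succ']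

theorem coeff_Dx_iter (α k : ℕ) (u : ℂ⟦X⟧⟦X⟧) :
    PowerSeries.coeff k (Dx^[α] u) =
      (PowerSeries.derivative ℂ)^[α] (PowerSeries.coeff k u) := by
  induction α with
  | zero => simp
  | succ j ih =>
    rw [Function.iterate_succ_apply', Function.iterate_succ_apply', Dx, PowerSeries.coeff_mk, ih]

theorem coeff_iter_deriv (f : ℂ⟦X⟧) (α l : ℕ) :
    PowerSeries.coeff l ((PowerSeries.derivative ℂ)^[α] f) =
      ((l + α).descFactorial α : ℂ) * PowerSeries.coeff (l + α) f := by
  rw [PowerSeries.coeff_iterate_derivative, Nat.add_descFactorial_eq_ascFactorial]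

theorem coeff_deriv_term (j α k l : ℕ) (u : ℂ⟦X⟧⟦X⟧) :
    PowerSeries.coeff l (PowerSeries.coeff k (tDt^[j] (Dx^[α] u))) =
      (k : ℂ) ^ j * (((l + α).descFactorial α : ℂ) *
        PowerSeries.coeff (l + α) (PowerSeries.coeff k u)) := by
  rw [coeff_tDt_iter, coeff_Dx_iter, PowerSeries.coeff_smul, coeff_iter_deriv, smul_eq_mul]

theorem coeff_xDx (k l : ℕ) (u : ℂ⟦X⟧⟦X⟧) :
    PowerSeries.coeff l (PowerSeries.coeff k (xDx u)) =
      (l : ℂ) * PowerSeries.coeff l (PowerSeries.coeff k u) := by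
  rw [xDx, PowerSeries.coeff_C_mul, Dx, PowerSeries.coeff_mk]
  cases l with
  | zero => simp
  | succ l =>
    rw [PowerSeries.coeff_succ_X_mul, PowerSeries.coeff_derivative]
    push_cast; ring

theorem coeff_fallingOp (α k l : ℕ) (u : ℂ⟦X⟧⟦X⟧) :
    PowerSeries.coeff l (PowerSeries.coeff k (fallingOp α u)) =
      (l.descFactorial α : ℂ) * PowerSeries.coeff l (PowerSeries.coeff k u) := by
  induction α with
  | zero => simp [fallingOp]
  | succ α ih =>
    rw [fallingOp, map_sub, map_sub, coeff_xDx, PowerSeries.coeff_smul, PowerSeries.coeff_smul, ih,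
      Nat.descFactorial_succ, smul_eq_mul]
    rcases le_or_gt α l with h | h
    · push_cast [h]; ring
    · rw [Nat.descFactorial_eq_zero_iff_lt.2 h]; simp

/-! ### Nonnegative series -/

/-- All coefficients of the double series are nonnegative. -/
def Nonneg₂ (w : ℂ⟦X⟧⟦X⟧) : Prop :=
  ∀ k l, 0 ≤ PowerSeries.coeff l (PowerSeries.coeff k w)

theorem SeriesNonneg.mul {f g : ℂ⟦X⟧} (hf : SeriesNonneg f) (hg : SeriesNonneg g) :
    SeriesNonneg (f * g) := fun l => by
  rw [PowerSeries.coeff_mul]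
  exact Finset.sum_nonneg fun x _ => mul_nonneg (hf _) (hg _)

theorem SeriesNonneg.zero : SeriesNonneg 0 := fun l => by simp

theorem Nonneg₂.mul {f g : ℂ⟦X⟧⟦X⟧} (hf : Nonneg₂ f) (hg : Nonneg₂ g) :
    Nonneg₂ (f * g) := fun k l => by
  rw [PowerSeries.coeff_mul, map_sum]
  exact Finset.sum_nonneg fun x _ => SeriesNonneg.mul (hf _) (hg _) l

theorem Nonneg₂.C {f : ℂ⟦X⟧} (hf : SeriesNonneg f) : Nonneg₂ (PowerSeries.C f) := fun k l => by
  rw [PowerSeries.coeff_C]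
  split_ifs
  · exact hf l
  · simp

theorem SeriesNonneg.one : SeriesNonneg 1 := fun l => by
  rw [PowerSeries.coeff_one]; split_ifs <;> simp

theorem Nonneg₂.one : Nonneg₂ 1 := by
  rw [← map_one PowerSeries.C]; exact Nonneg₂.C SeriesNonneg.one

theorem Nonneg₂.X_pow (i : ℕ) : Nonneg₂ (PowerSeries.X ^ i) := fun k l => by
  rw [PowerSeries.coeff_X_pow]; split_ifs
  · exact SeriesNonneg.one l
  · simp

theorem Nonneg₂.pow {f : ℂ⟦X⟧⟦X⟧} (hf : Nonneg₂ f) (n : ℕ) : Nonneg₂ (f ^ n) := by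
  induction n with
  | zero => rw [pow_zero]; exact Nonneg₂.one
  | succ n ih => rw [pow_succ]; exact ih.mul hf

theorem Nonneg₂.prod {ι : Type*} (s : Finset ι) (f : ι → ℂ⟦X⟧⟦X⟧) (hf : ∀ i ∈ s, Nonneg₂ (f i)) :
    Nonneg₂ (∏ i ∈ s, f i) :=
  Finset.prod_induction f Nonneg₂ (fun _ _ => Nonneg₂.mul) Nonneg₂.one hf

theorem Nonneg₂.derivTerm {u : ℂ⟦X⟧⟦X⟧} (hu : Nonneg₂ u) (j α : ℕ) :
    Nonneg₂ (tDt^[j] (Dx^[α] u)) := fun k l => by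
  rw [coeff_deriv_term]
  exact mul_nonneg (pow_nonneg (Nat.cast_nonneg _) _) (mul_nonneg (Nat.cast_nonneg _) (hu _ _))

/-- A single product of coefficients is a lower bound for a coefficient of a product. -/
theorem Nonneg₂.le_coeff_mul {f g : ℂ⟦X⟧⟦X⟧} (hf : Nonneg₂ f) (hg : Nonneg₂ g) (k₁ k₂ l₁ l₂ : ℕ) :
    PowerSeries.coeff l₁ (PowerSeries.coeff k₁ f) * PowerSeries.coeff l₂ (PowerSeries.coeff k₂ g) ≤
      PowerSeries.coeff (l₁ + l₂) (PowerSeries.coeff (k₁ + k₂) (f * g)) := by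
  rw [PowerSeries.coeff_mul, map_sum]
  refine le_trans ?_ (Finset.single_le_sum (f := fun x : ℕ × ℕ =>
    PowerSeries.coeff (l₁ + l₂) (PowerSeries.coeff x.1 f * PowerSeries.coeff x.2 g))
    (fun x _ => SeriesNonneg.mul (hf _) (hg _) _) (a := (k₁, k₂)) (by simp))
  dsimp only
  rw [PowerSeries.coeff_mul]
  exact Finset.single_le_sum (f := fun x : ℕ × ℕ =>
    PowerSeries.coeff x.1 (PowerSeries.coeff k₁ f) * PowerSeries.coeff x.2 (PowerSeries.coeff k₂ g))
    (fun x _ => mul_nonneg (hf _ _) (hg _ _)) (a := (l₁, l₂)) (by simp)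

theorem Nonneg₂.le_coeff_pow {f : ℂ⟦X⟧⟦X⟧} (hf : Nonneg₂ f) (n : ℕ) :
    (PowerSeries.coeff 0 (PowerSeries.coeff 1 f)) ^ n ≤
      PowerSeries.coeff 0 (PowerSeries.coeff n (f ^ n)) := by
  induction n with
  | zero => simp
  | succ n ih =>
    rw [pow_succ, pow_succ]
    exact (mul_le_mul_of_nonneg_right ih (hf 1 0)).trans ((hf.pow n).le_coeff_mul hf n 1 0 0)

theorem Nonneg₂.le_coeff_prod {ι : Type*} (s : Finset ι) (f : ι → ℂ⟦X⟧⟦X⟧)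
    (hf : ∀ i, Nonneg₂ (f i)) (ν : ι → ℕ) :
    ∏ i ∈ s, (PowerSeries.coeff 0 (PowerSeries.coeff 1 (f i))) ^ ν i ≤
      PowerSeries.coeff 0 (PowerSeries.coeff (∑ i ∈ s, ν i) (∏ i ∈ s, f i ^ ν i)) := by
  classical
  induction s using Finset.induction_on with
  | empty => simp
  | insert a s ha ih =>
    rw [Finset.prod_insert ha, Finset.prod_insert ha, Finset.sum_insert ha]
    refine le_trans ?_ (((hf a).pow (ν a)).le_coeff_mul
      (Nonneg₂.prod s _ fun i _ => (hf i).pow (ν i)) (ν a) (∑ i ∈ s, ν i) 0 0)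
    exact mul_le_mul ((hf a).le_coeff_pow _) ih
      (Finset.prod_nonneg fun i _ => pow_nonneg (hf i 1 0) _) (((hf a).pow _) _ _)

/-! ### Coefficient recursion, formal solution and positivity. -/

namespace Equation

variable (E : Equation)

/-- The indicial polynomial `C(0; k, l)`. -/
noncomputable def symb (k l : ℕ) : ℂ :=
  (k : ℂ) ^ E.m - ∑ p ∈ indexI E.m,
    PowerSeries.constantCoeff (E.c p) * ((k : ℂ) ^ p.1 * (l.descFactorial p.2 : ℂ))

/-- The coefficient of `u_{k,l'}` in the equation for `t^k x^l`, moved to the right-hand side. -/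
noncomputable def tail (k l l' : ℕ) : ℂ :=
  ∑ p ∈ indexI E.m, PowerSeries.coeff (l - l') (E.c p) *
    ((k : ℂ) ^ p.1 * (l'.descFactorial p.2 : ℂ))

theorem coeff_opC (u : ℂ⟦X⟧⟦X⟧) (k l : ℕ) :
    PowerSeries.coeff l (PowerSeries.coeff k (E.opC u)) =
      E.symb k l * PowerSeries.coeff l (PowerSeries.coeff k u) -
        ∑ l' ∈ Finset.range l, E.tail k l l' * PowerSeries.coeff l' (PowerSeries.coeff k u) := by
  have hp : ∀ p : ℕ × ℕ, PowerSeries.coeff l (PowerSeries.coeff k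
      (PowerSeries.C (E.c p) * tDt^[p.1] (fallingOp p.2 u))) =
      PowerSeries.constantCoeff (E.c p) * ((k : ℂ) ^ p.1 * (l.descFactorial p.2 : ℂ)) *
        PowerSeries.coeff l (PowerSeries.coeff k u) +
      ∑ l' ∈ Finset.range l, PowerSeries.coeff (l - l') (E.c p) *
        ((k : ℂ) ^ p.1 * (l'.descFactorial p.2 : ℂ)) *
          PowerSeries.coeff l' (PowerSeries.coeff k u) := by
    intro p
    rw [PowerSeries.coeff_C_mul, mul_comm, PowerSeries.coeff_mul,
      Finset.Nat.sum_antidiagonal_eq_sum_range_succ_mk, Finset.sum_range_succ, add_comm]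
    congr 1
    · rw [coeff_tDt_iter, PowerSeries.coeff_smul, coeff_fallingOp, smul_eq_mul, Nat.sub_self,
        PowerSeries.coeff_zero_eq_constantCoeff_apply]
      ring
    · refine Finset.sum_congr rfl fun l' _ => ?_
      rw [coeff_tDt_iter, PowerSeries.coeff_smul, coeff_fallingOp, smul_eq_mul]
      ring
  rw [opC, map_sub, map_sub, map_sum, map_sum, coeff_tDt_iter, PowerSeries.coeff_smul, smul_eq_mul,
    Finset.sum_congr rfl fun p _ => hp p, Finset.sum_add_distrib,
    Finset.sum_comm, symb]
  simp_rw [tail, sub_mul, Finset.sum_mul]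
  ring

/-- The quotient of a series by `t` (forgetting the constant term). -/
noncomputable def shift (v : ℂ⟦X⟧⟦X⟧) : ℂ⟦X⟧⟦X⟧ :=
  PowerSeries.mk fun κ => PowerSeries.coeff (κ + 1) v

theorem X_mul_shift {v : ℂ⟦X⟧⟦X⟧} (hv : PowerSeries.coeff 0 v = 0) :
    PowerSeries.X * shift v = v := by
  ext k : 1
  cases k with
  | zero => rw [hv, PowerSeries.coeff_zero_X_mul]
  | succ k => rw [PowerSeries.coeff_succ_X_mul, shift, PowerSeries.coeff_mk]

theorem coeff_zero_derivTerm {u : ℂ⟦X⟧⟦X⟧} (hu : PowerSeries.coeff 0 u = 0) (j α : ℕ) :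
    PowerSeries.coeff 0 (tDt^[j] (Dx^[α] u)) = 0 := by
  ext l
  rw [coeff_deriv_term, hu]; simp

/-- The product of derivatives in a nonlinear term, with all factors divided by `t`. -/
noncomputable def shiftProd (u : ℂ⟦X⟧⟦X⟧) (ν : E.M → ℕ) : ℂ⟦X⟧⟦X⟧ :=
  ∏ p : E.M, shift (tDt^[p.1.1] (Dx^[p.1.2] u)) ^ ν p

theorem term_eq {u : ℂ⟦X⟧⟦X⟧} (hu : PowerSeries.coeff 0 u = 0) (i : ℕ) (ν : E.M → ℕ) :
    E.term u i ν =
      PowerSeries.X ^ (i + ∑ p, ν p) * (PowerSeries.C (E.g i ν) * E.shiftProd u ν) := by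
  have h : ∏ p : E.M, (tDt^[p.1.1] (Dx^[p.1.2] u)) ^ ν p =
      PowerSeries.X ^ (∑ p, ν p) * E.shiftProd u ν := by
    rw [shiftProd, ← Finset.prod_pow_eq_pow_sum, ← Finset.prod_mul_distrib]
    refine Finset.prod_congr rfl fun p _ => ?_
    rw [← mul_pow, X_mul_shift (coeff_zero_derivTerm hu _ _)]
  rw [term, h, pow_add]; ring

theorem coeff_term {u : ℂ⟦X⟧⟦X⟧} (hu : PowerSeries.coeff 0 u = 0) (i : ℕ) (ν : E.M → ℕ) (k : ℕ) :
    PowerSeries.coeff k (E.term u i ν) = if i + ∑ p, ν p ≤ k then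
      E.g i ν * PowerSeries.coeff (k - (i + ∑ p, ν p)) (E.shiftProd u ν) else 0 := by
  rw [E.term_eq hu, PowerSeries.coeff_X_pow_mul', PowerSeries.coeff_C_mul]

/-- Reduction modulo t^(K+1) is a ring homomorphism, so the products may be compared factor by
factor. The bound K + 1 on the coefficients of u reflects the division by t in `shift`. -/
theorem coeff_shiftProd_congr {u w : ℂ⟦X⟧⟦X⟧} {K : ℕ}
    (h : ∀ k ≤ K + 1, PowerSeries.coeff k u = PowerSeries.coeff k w) (ν : E.M → ℕ) :
    PowerSeries.coeff K (E.shiftProd u ν) = PowerSeries.coeff K (E.shiftProd w ν) := by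
  have hmk : Ideal.Quotient.mk (Ideal.span {(PowerSeries.X : ℂ⟦X⟧⟦X⟧) ^ (K + 1)})
      (E.shiftProd u ν) = Ideal.Quotient.mk _ (E.shiftProd w ν) := by
    rw [shiftProd, shiftProd, map_prod, map_prod]
    refine Finset.prod_congr rfl fun p _ => ?_
    rw [map_pow, map_pow]
    congr 1
    rw [Ideal.Quotient.eq, Ideal.mem_span_singleton, PowerSeries.X_pow_dvd_iff]
    intro n hn
    rw [map_sub, sub_eq_zero, shift, shift, PowerSeries.coeff_mk, PowerSeries.coeff_mk]
    ext l
    rw [coeff_deriv_term, coeff_deriv_term, h (n + 1) (by omega)]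
  rw [Ideal.Quotient.eq, Ideal.mem_span_singleton, PowerSeries.X_pow_dvd_iff] at hmk
  exact sub_eq_zero.1 (by rw [← map_sub]; exact hmk K (by omega))

/-- A nonzero monomial has i+|ν| ≥ 2, so only `shiftProd` up to order k-2 enters, and hence u up to
order k-1. This strict triangularity in k drives both the Picard iteration and uniqueness. -/
theorem coeff_nonlin_congr {u w : ℂ⟦X⟧⟦X⟧} (hu : PowerSeries.coeff 0 u = 0)
    (hw : PowerSeries.coeff 0 w = 0) {k : ℕ}
    (h : ∀ k' < k, PowerSeries.coeff k' u = PowerSeries.coeff k' w) :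
    PowerSeries.coeff k (E.nonlin u) = PowerSeries.coeff k (E.nonlin w) := by
  rw [nonlin, nonlin, PowerSeries.coeff_mk, PowerSeries.coeff_mk]
  refine finsum_congr fun q => ?_
  rw [E.coeff_term hu, E.coeff_term hw]
  split_ifs with hk
  · by_cases h2 : q.1 + ∑ p, q.2 p < 2
    · rw [E.g_low _ _ h2, zero_mul, zero_mul]
    · rw [E.coeff_shiftProd_congr fun k' hk' => h k' (by omega)]
  · rfl

theorem coeff_zero_nonlin {u : ℂ⟦X⟧⟦X⟧} (hu : PowerSeries.coeff 0 u = 0) :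
    PowerSeries.coeff 0 (E.nonlin u) = 0 := by
  rw [nonlin, PowerSeries.coeff_mk]
  refine finsum_eq_zero_of_forall_eq_zero fun q => ?_
  rw [E.coeff_term hu]
  split_ifs with h
  · rw [E.g_low _ _ (by omega), zero_mul]
  · rfl

/-- The right-hand side of the equation. -/
noncomputable def rhs (u : ℂ⟦X⟧⟦X⟧) : ℂ⟦X⟧⟦X⟧ :=
  PowerSeries.C E.a * PowerSeries.X + E.nonlin u

theorem coeff_zero_rhs {u : ℂ⟦X⟧⟦X⟧} (hu : PowerSeries.coeff 0 u = 0) :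
    PowerSeries.coeff 0 (E.rhs u) = 0 := by
  rw [rhs, map_add, E.coeff_zero_nonlin hu, mul_comm, PowerSeries.coeff_zero_X_mul, add_zero]

theorem isFormalSolution_iff (u : ℂ⟦X⟧⟦X⟧) :
    E.IsFormalSolution u ↔ PowerSeries.coeff 0 u = 0 ∧ ∀ k, 1 ≤ k → ∀ l,
      E.symb k l * PowerSeries.coeff l (PowerSeries.coeff k u) =
        ∑ l' ∈ Finset.range l, E.tail k l l' * PowerSeries.coeff l' (PowerSeries.coeff k u) +
          PowerSeries.coeff l (PowerSeries.coeff k (E.rhs u)) := by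
  refine and_congr_right fun hu => ?_
  change E.opC u = E.rhs u ↔ _
  constructor
  · intro h k _ l
    rw [← h, coeff_opC]; ring
  · intro h
    ext k l
    rcases Nat.eq_zero_or_pos k with rfl | hk
    · rw [coeff_opC, E.coeff_zero_rhs hu, hu]; simp
    · rw [coeff_opC, h k hk]; ring

/-- The solution of the linear recursion in `l` for a fixed power of `t`. -/
noncomputable def solveRow (k : ℕ) (f : ℂ⟦X⟧) : ℕ → ℂ
  | l => ((∑ l' : Fin l, E.tail k l l' * solveRow k f l') + PowerSeries.coeff l f) / E.symb k l

/-- The inverse of `C(x; t∂_t, x∂_x)` on series without constant term in `t`. -/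
noncomputable def solve (f : ℂ⟦X⟧⟦X⟧) : ℂ⟦X⟧⟦X⟧ :=
  PowerSeries.mk fun k => if k = 0 then 0 else PowerSeries.mk (E.solveRow k (PowerSeries.coeff k f))

/-- Picard iterates for the formal solution. -/
noncomputable def picard (n : ℕ) : ℂ⟦X⟧⟦X⟧ := (fun u => E.solve (E.rhs u))^[n] 0

theorem coeff_solve (f : ℂ⟦X⟧⟦X⟧) (k : ℕ) : PowerSeries.coeff k (E.solve f) =
    if k = 0 then 0 else PowerSeries.mk (E.solveRow k (PowerSeries.coeff k f)) := by
  rw [solve, PowerSeries.coeff_mk]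

theorem coeff_zero_solve (f : ℂ⟦X⟧⟦X⟧) : PowerSeries.coeff 0 (E.solve f) = 0 := by
  rw [solve, PowerSeries.coeff_mk, if_pos rfl]

theorem picard_succ (n : ℕ) : E.picard (n + 1) = E.solve (E.rhs (E.picard n)) := by
  rw [picard, Function.iterate_succ_apply', ← picard]

theorem coeff_zero_picard (n : ℕ) : PowerSeries.coeff 0 (E.picard n) = 0 := by
  cases n with
  | zero => simp [picard]
  | succ n => rw [picard_succ, coeff_zero_solve]

/-- Each iteration fixes one more power of t, so the diagonal choice in `formalSol` is a limit. -/
theorem coeff_picard_succ (n k : ℕ) (hk : k ≤ n) :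
    PowerSeries.coeff k (E.picard (n + 1)) = PowerSeries.coeff k (E.picard n) := by
  induction n generalizing k with
  | zero =>
    obtain rfl : k = 0 := by omega
    rw [coeff_zero_picard, coeff_zero_picard]
  | succ n ih =>
    rw [E.picard_succ (n + 1)]
    nth_rewrite 2 [E.picard_succ n]
    rw [coeff_solve, coeff_solve]
    split_ifs with h0
    · rfl
    · have : PowerSeries.coeff k (E.rhs (E.picard (n + 1))) =
          PowerSeries.coeff k (E.rhs (E.picard n)) := by
        rw [rhs, rhs, map_add, map_add, E.coeff_nonlin_congr (E.coeff_zero_picard _)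
          (E.coeff_zero_picard _) fun k' hk' => ih k' (by omega)]
      rw [this]

theorem coeff_picard_of_le {n k : ℕ} (hk : k ≤ n) :
    PowerSeries.coeff k (E.picard n) = PowerSeries.coeff k (E.picard k) := by
  induction n, hk using Nat.le_induction with
  | base => rfl
  | succ n hn ih => rw [E.coeff_picard_succ n k hn, ih]

/-- The formal solution. -/
noncomputable def formalSol : ℂ⟦X⟧⟦X⟧ :=
  PowerSeries.mk fun k => PowerSeries.coeff k (E.picard k)

theorem isFormalSolution_formalSol (hs : ∀ k, 1 ≤ k → ∀ l, E.symb k l ≠ 0) :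
    E.IsFormalSolution E.formalSol := by
  have h0 : PowerSeries.coeff 0 E.formalSol = 0 := by
    rw [formalSol, PowerSeries.coeff_mk, coeff_zero_picard]
  rw [isFormalSolution_iff]
  refine ⟨h0, fun k hk l => ?_⟩
  have hr : PowerSeries.coeff k (E.rhs E.formalSol) = PowerSeries.coeff k (E.rhs (E.picard k)) := by
    rw [rhs, rhs, map_add, map_add, E.coeff_nonlin_congr h0 (E.coeff_zero_picard _) fun k' hk' => ?_]
    rw [formalSol, PowerSeries.coeff_mk, E.coeff_picard_of_le hk'.le]
  have hc : ∀ l, PowerSeries.coeff l (PowerSeries.coeff k E.formalSol) =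
      E.solveRow k (PowerSeries.coeff k (E.rhs (E.picard k))) l := by
    intro l
    rw [formalSol, PowerSeries.coeff_mk, ← E.coeff_picard_succ k k le_rfl, picard_succ, solve,
      PowerSeries.coeff_mk, if_neg (by omega), PowerSeries.coeff_mk]
  simp_rw [hc, hr]
  rw [solveRow, mul_div_cancel₀ _ (hs k hk l), Finset.sum_range]

theorem IsFormalSolution.unique (hs : ∀ k, 1 ≤ k → ∀ l, E.symb k l ≠ 0) {u w : ℂ⟦X⟧⟦X⟧}
    (hu : E.IsFormalSolution u) (hw : E.IsFormalSolution w) : u = w := by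
  rw [isFormalSolution_iff] at hu hw
  ext k : 1
  induction k using Nat.strong_induction_on with
  | _ k ih =>
    rcases Nat.eq_zero_or_pos k with rfl | hk
    · rw [hu.1, hw.1]
    · ext l
      induction l using Nat.strong_induction_on with
      | _ l ihl =>
        apply mul_left_cancel₀ (hs k hk l)
        rw [hu.2 k hk, hw.2 k hk, rhs, rhs, map_add, map_add,
          E.coeff_nonlin_congr hu.1 hw.1 ih]
        congr 1
        exact Finset.sum_congr rfl fun l' hmem => by rw [ihl l' (Finset.mem_range.1 hmem)]

/-! ### Positivity -/

/-- The sign conditions on the coefficients of the equation. -/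
structure SignCond : Prop where
  a_nonneg : SeriesNonneg E.a
  c_zero : ∀ p ∈ indexI E.m, PowerSeries.constantCoeff (E.c p) ≤ 0
  c_nonneg : ∀ p ∈ indexI E.m,
    SeriesNonneg (E.c p - PowerSeries.C (PowerSeries.constantCoeff (E.c p)))
  g_nonneg : ∀ (i : ℕ) (ν : E.M → ℕ), 2 ≤ i + ∑ p, ν p → SeriesNonneg (E.g i ν)

/-- The absolute value of the indicial polynomial `C(0; k, l)`. -/
noncomputable def asymb (k l : ℕ) : ℝ :=
  (k : ℝ) ^ E.m + ∑ p ∈ indexI E.m,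
    ‖PowerSeries.constantCoeff (E.c p)‖ * ((k : ℝ) ^ p.1 * (l.descFactorial p.2 : ℝ))

/-- Division by the symbol thus returns m powers of k, which is the origin of the term -m in s₀. -/
theorem pow_le_asymb (k l : ℕ) : (k : ℝ) ^ E.m ≤ E.asymb k l :=
  le_add_of_nonneg_right (Finset.sum_nonneg fun _ _ => by positivity)

theorem asymb_pos {k : ℕ} (hk : 1 ≤ k) (l : ℕ) : 0 < E.asymb k l :=
  lt_of_lt_of_le (by positivity) (E.pow_le_asymb k l)

variable {E}

theorem norm_eq_of_nonneg {z : ℂ} (hz : 0 ≤ z) : ((‖z‖ : ℝ) : ℂ) = z := by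
  rw [Complex.norm_of_nonneg' hz]

namespace SignCond

variable (h : E.SignCond)
include h

/-- The condition c_{j,α}(0) ≤ 0 excludes any cancellation in the symbol, so there are no small
divisors. -/
theorem symb_eq (k l : ℕ) : E.symb k l = (E.asymb k l : ℂ) := by
  rw [symb, asymb]
  push_cast
  rw [sub_eq_add_neg, ← Finset.sum_neg_distrib]
  congr 1
  refine Finset.sum_congr rfl fun p hp => ?_
  rw [← norm_neg, norm_eq_of_nonneg (neg_nonneg.2 (h.c_zero p hp))]
  ring

theorem coeff_c_nonneg {p : ℕ × ℕ} (hp : p ∈ indexI E.m) {n : ℕ} (hn : n ≠ 0) :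
    0 ≤ PowerSeries.coeff n (E.c p) := by
  have := h.c_nonneg p hp n
  rwa [map_sub, PowerSeries.coeff_C, if_neg hn, sub_zero] at this

theorem tail_nonneg {k l l' : ℕ} (hl : l' < l) : 0 ≤ E.tail k l l' :=
  Finset.sum_nonneg fun p hp => mul_nonneg (h.coeff_c_nonneg hp (by omega))
    (mul_nonneg (pow_nonneg (Nat.cast_nonneg _) _) (Nat.cast_nonneg _))

theorem symb_ne_zero (k : ℕ) (hk : 1 ≤ k) (l : ℕ) : E.symb k l ≠ 0 := by
  rw [h.symb_eq]
  exact_mod_cast (E.asymb_pos hk l).ne'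

theorem g_nonneg' (i : ℕ) (ν : E.M → ℕ) : SeriesNonneg (E.g i ν) := by
  by_cases h2 : i + ∑ p, ν p < 2
  · rw [E.g_low i ν h2]; exact SeriesNonneg.zero
  · exact h.g_nonneg i ν (by omega)

theorem term_nonneg {u : ℂ⟦X⟧⟦X⟧} (hu : Nonneg₂ u) (i : ℕ) (ν : E.M → ℕ) :
    Nonneg₂ (E.term u i ν) :=
  ((Nonneg₂.C (h.g_nonneg' i ν)).mul (Nonneg₂.X_pow i)).mul
    (Nonneg₂.prod _ _ fun _ _ => (hu.derivTerm _ _).pow _)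

theorem rhs_nonneg {u : ℂ⟦X⟧⟦X⟧} (hu0 : PowerSeries.coeff 0 u = 0) (hu : Nonneg₂ u) :
    Nonneg₂ (E.rhs u) := fun k l => by
  rw [rhs, map_add, map_add]
  refine add_nonneg ?_ ?_
  · have := (Nonneg₂.C h.a_nonneg).mul (Nonneg₂.X_pow 1) k l
    rwa [pow_one] at this
  · rw [nonlin, PowerSeries.coeff_mk, finsum_eq_sum _ (E.support_term_finite u hu0 k), map_sum]
    exact Finset.sum_nonneg fun q _ => h.term_nonneg hu _ _ _ _

theorem solve_nonneg {f : ℂ⟦X⟧⟦X⟧} (hf : Nonneg₂ f) : Nonneg₂ (E.solve f) := fun k l => by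
  rw [solve, PowerSeries.coeff_mk]
  split_ifs with hk
  · simp
  · rw [PowerSeries.coeff_mk]
    induction l using Nat.strong_induction_on with
    | _ l ih =>
      rw [solveRow]
      refine div_nonneg (add_nonneg (Finset.sum_nonneg fun l' _ =>
        mul_nonneg (h.tail_nonneg l'.2) (ih l' l'.2)) (hf k l)) ?_
      rw [h.symb_eq]
      exact_mod_cast (E.asymb_pos (by omega) l).le

theorem picard_nonneg (n : ℕ) : Nonneg₂ (E.picard n) := by
  induction n with
  | zero => intro k l; simp [picard]
  | succ n ih => rw [picard_succ]; exact h.solve_nonneg (h.rhs_nonneg (E.coeff_zero_picard n) ih)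

theorem existsUnique : ∃! u : ℂ⟦X⟧⟦X⟧, E.IsFormalSolution u :=
  ⟨E.formalSol, E.isFormalSolution_formalSol h.symb_ne_zero, fun _ hu =>
    IsFormalSolution.unique E h.symb_ne_zero hu (E.isFormalSolution_formalSol h.symb_ne_zero)⟩

/-- Positivity holds for the Picard iterates and passes to any solution by uniqueness. -/
theorem nonneg_of_isFormalSolution {u : ℂ⟦X⟧⟦X⟧} (hu : E.IsFormalSolution u) : Nonneg₂ u := by
  rw [IsFormalSolution.unique E h.symb_ne_zero hu (E.isFormalSolution_formalSol h.symb_ne_zero)]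
  intro k l
  rw [formalSol, PowerSeries.coeff_mk]
  exact h.picard_nonneg k k l

end SignCond
end Equation
theorem mem_indexI {m : ℕ} {p : ℕ × ℕ} : p ∈ indexI m ↔ p.1 < m ∧ p.1 + p.2 ≤ m := by
  simp only [indexI, Finset.mem_filter, Finset.mem_product, Finset.mem_range]
  omega

/-- The summand 1 covers l < α, where the falling factorial vanishes. -/
theorem pow_le_descFactorial_add_one (l α : ℕ) :
    (l : ℝ) ^ α ≤ ((α : ℝ) + 1) ^ α * ((l.descFactorial α : ℝ) + 1) := by
  rcases lt_or_ge l α with h | h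
  · have h1 : (l : ℝ) ^ α ≤ ((α : ℝ) + 1) ^ α := by
      gcongr
      have : (l : ℝ) < α := by exact_mod_cast h
      linarith
    refine h1.trans (le_mul_of_one_le_right (by positivity) ?_)
    have : (0 : ℝ) ≤ l.descFactorial α := by positivity
    linarith
  · have h1 : l ≤ (α + 1) * (l + 1 - α) := by
      obtain ⟨n, rfl⟩ := Nat.exists_eq_add_of_le h
      rw [show α + n + 1 - α = n + 1 by omega]
      nlinarith
    have h2 : l ^ α ≤ (α + 1) ^ α * l.descFactorial α := by
      refine (Nat.pow_le_pow_left h1 α).trans ?_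
      rw [mul_pow]
      exact Nat.mul_le_mul_left _ (Nat.pow_sub_le_descFactorial l α)
    have h3 : (l : ℝ) ^ α ≤ ((α : ℝ) + 1) ^ α * (l.descFactorial α : ℝ) := by exact_mod_cast h2
    refine h3.trans ?_
    gcongr
    linarith

namespace Equation

variable (E : Equation)

/-! ### The Newton polygon -/

theorem top_mem_Lam0 : (E.m, 0) ∈ E.Lam0 := Or.inl rfl

theorem le_of_mem_Lam0 {q : ℕ × ℕ} (hq : q ∈ E.Lam0) : q.1 + q.2 ≤ E.m := by
  rcases hq with hq | hq
  · rw [Set.mem_singleton_iff] at hq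
    simp [hq]
  · exact (mem_indexI.1 hq.1).2

theorem mem_newton_of_le {q : ℕ × ℕ} (hq : q ∈ E.Lam0) {w : ℝ × ℝ} (h1 : w.1 ≤ q.1)
    (h2 : w.2 ≤ q.2) : w ∈ E.newton :=
  subset_convexHull _ _ (Set.mem_iUnion₂.2 ⟨q, hq, h1, h2⟩)

/-- A half-plane whose normal has nonnegative entries contains a quadrant as soon as it contains its
corner, and being convex it then contains the hull. -/
theorem newton_subset_halfspace {a b S : ℝ} (ha : 0 ≤ a) (hb : 0 ≤ b)
    (h : ∀ q ∈ E.Lam0, (q.1 : ℝ) * a + q.2 * b ≤ S) {w : ℝ × ℝ} (hw : w ∈ E.newton) :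
    w.1 * a + w.2 * b ≤ S := by
  have hc : Convex ℝ {w : ℝ × ℝ | w.1 * a + w.2 * b ≤ S} := by
    intro x hx y hy s t hs ht hst
    simp only [Set.mem_ofPred_eq, Prod.fst_add, Prod.smul_fst, smul_eq_mul, Prod.snd_add,
      Prod.smul_snd] at hx hy ⊢
    calc _ = s * (x.1 * a + x.2 * b) + t * (y.1 * a + y.2 * b) := by ring
      _ ≤ s * S + t * S := by gcongr
      _ = S := by rw [← add_mul, hst, one_mul]
  refine convexHull_min ?_ hc hw
  intro x hx
  obtain ⟨q, hq, h1, h2⟩ := Set.mem_iUnion₂.1 hx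
  exact le_trans (add_le_add (mul_le_mul_of_nonneg_right h1 ha)
    (mul_le_mul_of_nonneg_right h2 hb)) (h q hq)

theorem le_of_mem_newton {w : ℝ × ℝ} (hw : w ∈ E.newton) : w.1 + w.2 ≤ E.m := by
  have := E.newton_subset_halfspace (a := 1) (b := 1) (S := E.m) zero_le_one zero_le_one
    (fun q hq => by have := E.le_of_mem_Lam0 hq; rw [mul_one, mul_one]; exact_mod_cast this) hw
  simpa using this

theorem bddBelow_dist (p : ℕ × ℕ) :
    BddBelow {y : ℝ | ((p.1 : ℝ), (p.2 : ℝ) - y) ∈ E.newton} := by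
  refine ⟨(p.1 : ℝ) + p.2 - E.m, fun y hy => ?_⟩
  have := E.le_of_mem_newton hy
  simp only at this
  linarith

theorem le_dist {p : ℕ × ℕ} (hp : p.1 ≤ E.m) {y : ℝ}
    (h : ∀ z, ((p.1 : ℝ), (p.2 : ℝ) - z) ∈ E.newton → y ≤ z) : y ≤ E.dist p := by
  refine le_csInf ⟨p.2, E.mem_newton_of_le E.top_mem_Lam0 ?_ ?_⟩ fun z hz => h z hz
  · change (p.1 : ℝ) ≤ (E.m : ℝ)
    exact_mod_cast hp
  · simp

/-- A linear inequality on Λ₀ extends to the boundary point (j, α-d). Attainment of the infimum is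
not needed: for b = 0 any point of the polygon on the vertical line suffices, and for b > 0 the
inequality is a lower bound for every admissible y. -/
theorem dist_ineq {p : ℕ × ℕ} (hp : p.1 ≤ E.m) {a b S : ℝ} (ha : 0 ≤ a) (hb : 0 ≤ b)
    (h : ∀ q ∈ E.Lam0, (q.1 : ℝ) * a + q.2 * b ≤ S) :
    (p.1 : ℝ) * a + (p.2 - E.dist p) * b ≤ S := by
  have key : ∀ z, ((p.1 : ℝ), (p.2 : ℝ) - z) ∈ E.newton → (p.1 : ℝ) * a + (p.2 - z) * b ≤ S :=
    fun z hz => E.newton_subset_halfspace ha hb h hz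
  rcases hb.eq_or_lt with rfl | hb
  · have := key p.2 (E.mem_newton_of_le E.top_mem_Lam0 (Nat.cast_le.2 hp) (by simp))
    simpa using this
  · have : p.2 - (S - p.1 * a) / b ≤ E.dist p := by
      refine E.le_dist hp fun z hz => ?_
      have := key z hz
      rw [sub_le_comm, le_div_iff₀ hb]
      linarith
    rw [sub_le_comm, le_div_iff₀ hb] at this
    linarith

/-- Existence of a supporting line of slope `-θ` of the Newton polygon below a given point. -/
theorem exists_slope {p : ℕ × ℕ} (hp : p ∈ indexI E.m) {y : ℝ} (hy0 : 0 < y) (hy : y < E.dist p) :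
    ∃ θ : ℝ, 0 ≤ θ ∧ θ < 1 ∧ ∀ q ∈ E.Lam0, θ * q.1 + q.2 ≤ θ * p.1 + p.2 - y := by
  obtain ⟨hp1, hp2⟩ := mem_indexI.1 hp
  have hp1' : (p.1 : ℝ) < E.m := by exact_mod_cast hp1
  have hp2' : (p.1 : ℝ) + p.2 ≤ E.m := by exact_mod_cast hp2
  set P : ℝ × ℝ := ((p.1 : ℝ), (p.2 : ℝ) - y) with hP
  have hnot : P ∉ E.newton := fun hmem =>
    absurd (csInf_le (E.bddBelow_dist p) hmem) (not_le.2 hy)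
  -- Open quadrants allow strict separation of an open convex set from a point; the corners
  -- themselves are recovered by a limit in `hle`.
  set U : Set (ℝ × ℝ) := ⋃ q ∈ E.Lam0, {w : ℝ × ℝ | w.1 < (q.1 : ℝ) ∧ w.2 < (q.2 : ℝ)} with hU
  have hUopen : IsOpen U := isOpen_biUnion fun q _ =>
    (isOpen_lt continuous_fst continuous_const).inter (isOpen_lt continuous_snd continuous_const)
  have hsub : convexHull ℝ U ⊆ E.newton := convexHull_mono <| Set.iUnion₂_mono fun q _ w hw =>
    ⟨hw.1.le, hw.2.le⟩
  obtain ⟨f, hf⟩ := geometric_hahn_banach_open_point (convex_convexHull ℝ U)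
    hUopen.convexHull fun h => hnot (hsub h)
  have hfw : ∀ w : ℝ × ℝ, f w = w.1 * f (1, 0) + w.2 * f (0, 1) := by
    intro w
    have : w = w.1 • ((1 : ℝ), (0 : ℝ)) + w.2 • ((0 : ℝ), (1 : ℝ)) := by ext <;> simp
    conv_lhs => rw [this]
    rw [map_add, map_smul, map_smul, smul_eq_mul, smul_eq_mul]
  set a := f (1, 0)
  set b := f (0, 1)
  have hlt : ∀ q ∈ E.Lam0, ∀ s t : ℝ, 0 < s → 0 < t →
      (q.1 - s) * a + (q.2 - t) * b < p.1 * a + (p.2 - y) * b := by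
    intro q hq s t hs ht
    have := hf (q.1 - s, q.2 - t) (subset_convexHull _ _ (Set.mem_iUnion₂.2 ⟨q, hq, by
      constructor <;> simp [hs, ht]⟩))
    rw [hfw, hfw P] at this
    exact this
  have hle : ∀ q ∈ E.Lam0, q.1 * a + q.2 * b ≤ p.1 * a + (p.2 - y) * b := by
    intro q hq
    refine le_of_forall_pos_lt_add fun ε hε => ?_
    have hpos : 0 < |a| + |b| + 1 := by positivity
    have h1 := hlt q hq (ε / (|a| + |b| + 1)) (ε / (|a| + |b| + 1)) (by positivity) (by positivity)
    have h2 : ε / (|a| + |b| + 1) * a + ε / (|a| + |b| + 1) * b < ε := by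
      rw [← mul_add, div_mul_eq_mul_div, div_lt_iff₀ hpos]
      have := le_abs_self a
      have := le_abs_self b
      nlinarith
    linarith
  have htop := hlt _ E.top_mem_Lam0
  simp only [Nat.cast_zero, zero_sub] at htop
  -- The quadrants are unbounded in both negative directions, which forces both entries of the
  -- normal to be nonnegative.
  have hbig : ∀ x c : ℝ, (∀ s : ℝ, 0 < s → -(s * x) ≤ c) → 0 ≤ x := by
    intro x c h
    by_contra hx
    push Not at hx
    have h1 := h ((|c| + 1) / (-x)) (div_pos (by positivity) (by linarith))
    have h2 : -((|c| + 1) / (-x) * x) = |c| + 1 := by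
      rw [div_neg, neg_mul, neg_neg, div_mul_cancel₀ _ hx.ne]
    have := le_abs_self c
    linarith
  have ha : 0 ≤ a := hbig a (p.1 * a + (p.2 - y) * b - E.m * a + b) fun s hs => by
    have := htop s 1 hs one_pos
    linarith
  have hb : 0 ≤ b := hbig b (p.1 * a + (p.2 - y) * b - E.m * a + a) fun s hs => by
    have := htop 1 s one_pos hs
    linarith
  -- A vertical separating line is impossible: the corner (m,0) lies strictly to the right of the
  -- given point, since j < m.
  have hb' : 0 < b := by
    rcases hb.eq_or_lt with h0 | h0
    · exfalso
      have h3 := hle _ E.top_mem_Lam0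
      have h4 := htop 1 1 one_pos one_pos
      rw [← h0] at h3 h4
      simp only [mul_zero, add_zero] at h3 h4
      have : a = 0 := by nlinarith
      rw [this] at h4
      simp at h4
    · exact h0
  have hfin : ∀ q ∈ E.Lam0, a / b * q.1 + q.2 ≤ a / b * p.1 + p.2 - y := by
    intro q hq
    have h := hle q hq
    have e1 : a / b * q.1 + q.2 = (q.1 * a + q.2 * b) / b := by field_simp
    have e2 : a / b * p.1 + p.2 - y = (p.1 * a + (p.2 - y) * b) / b := by field_simp; ring
    rw [e1, e2]
    gcongr
  refine ⟨a / b, div_nonneg ha hb, ?_, hfin⟩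
  -- The corner (m,0) gives θ(m-j) ≤ α-y < m-j, hence θ < 1.
  have := hfin _ E.top_mem_Lam0
  simp only [Nat.cast_zero, add_zero] at this
  by_contra hge
  push Not at hge
  nlinarith

/-! ### Bounds for the indicial polynomial -/

/-- `∑ |c_{j,α}(0)|`, increased by one. -/
noncomputable def symbConst : ℝ := 1 + ∑ p ∈ indexI E.m, ‖PowerSeries.constantCoeff (E.c p)‖

theorem one_le_symbConst : 1 ≤ E.symbConst :=
  le_add_of_nonneg_right (Finset.sum_nonneg fun _ _ => norm_nonneg _)

theorem asymb_le_of_forall {k l : ℕ} {S : ℝ}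
    (h : ∀ q ∈ E.Lam0, (k : ℝ) ^ q.1 * (l : ℝ) ^ q.2 ≤ S) : E.asymb k l ≤ E.symbConst * S := by
  rw [asymb, symbConst, add_mul, one_mul, Finset.sum_mul]
  refine add_le_add (by simpa using h _ E.top_mem_Lam0) (Finset.sum_le_sum fun p hp => ?_)
  by_cases hc : PowerSeries.constantCoeff (E.c p) = 0
  · rw [hc]; simp
  · refine mul_le_mul_of_nonneg_left (le_trans ?_ (h p (Or.inr ⟨hp, hc⟩))) (norm_nonneg _)
    gcongr
    exact_mod_cast Nat.descFactorial_le_pow l p.2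

theorem asymb_le_pow {k l : ℕ} (hk : 1 ≤ k) :
    E.asymb k l ≤ E.symbConst * ((k : ℝ) + l) ^ E.m := by
  have h1 : (1 : ℝ) ≤ k := by exact_mod_cast hk
  refine E.asymb_le_of_forall fun q hq => ?_
  calc (k : ℝ) ^ q.1 * (l : ℝ) ^ q.2 ≤ ((k : ℝ) + l) ^ q.1 * ((k : ℝ) + l) ^ q.2 := by
        gcongr <;> linarith
    _ = ((k : ℝ) + l) ^ (q.1 + q.2) := by rw [pow_add]
    _ ≤ _ := pow_le_pow_right₀ (by linarith) (E.le_of_mem_Lam0 hq)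

theorem asymb_le_rpow {k l : ℕ} {c T θ e : ℝ} (hc : 1 ≤ c) (hT : 1 ≤ T)
    (he : ∀ q ∈ E.Lam0, θ * q.1 + q.2 ≤ e) (hk : (k : ℝ) ≤ c * T ^ θ) (hl : (l : ℝ) ≤ c * T) :
    E.asymb k l ≤ E.symbConst * (c ^ E.m * T ^ e) := by
  have hT0 : 0 < T := by linarith
  refine E.asymb_le_of_forall fun q hq => ?_
  calc (k : ℝ) ^ q.1 * (l : ℝ) ^ q.2 ≤ (c * T ^ θ) ^ q.1 * (c * T) ^ q.2 := by gcongr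
    _ = c ^ (q.1 + q.2) * T ^ (θ * q.1 + q.2) := by
        rw [mul_pow, mul_pow, pow_add, Real.rpow_add hT0, Real.rpow_mul hT0.le, Real.rpow_natCast,
          Real.rpow_natCast]
        ring
    _ ≤ _ := mul_le_mul (pow_le_pow_right₀ hc (E.le_of_mem_Lam0 hq))
        (Real.rpow_le_rpow_of_exponent_le hT (he q hq)) (by positivity) (by positivity)

/-- Apart from (m,0), the points of Λ₀ have c_{j,α}(0) ≠ 0, so their monomial occurs in the symbol.
The defect of the falling factorial for small l is covered by k^j ≤ k^m. -/
theorem exists_pow_le_asymb : ∃ C : ℝ, 1 ≤ C ∧ ∀ q ∈ E.Lam0, ∀ k l : ℕ, 1 ≤ k →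
    (k : ℝ) ^ q.1 * (l : ℝ) ^ q.2 ≤ C * E.asymb k l := by
  set D : ℕ × ℕ → ℝ := fun p =>
    ((p.2 : ℝ) + 1) ^ p.2 * (‖PowerSeries.constantCoeff (E.c p)‖⁻¹ + 1) with hD
  have hD0 : ∀ p, 0 ≤ D p := fun p => by positivity
  refine ⟨1 + ∑ p ∈ indexI E.m, D p,
    le_add_of_nonneg_right (Finset.sum_nonneg fun _ _ => hD0 _), fun q hq k l hk => ?_⟩
  have hA := E.asymb_pos hk l
  have hkm := E.pow_le_asymb k l
  rw [add_mul, one_mul]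
  rcases hq with hq | ⟨hq, hc⟩
  · rw [Set.mem_singleton_iff] at hq
    subst hq
    have : 0 ≤ (∑ p ∈ indexI E.m, D p) * E.asymb k l :=
      mul_nonneg (Finset.sum_nonneg fun _ _ => hD0 _) hA.le
    simp only [pow_zero, mul_one]
    linarith
  · have hc' : 0 < ‖PowerSeries.constantCoeff (E.c q)‖ := norm_pos_iff.2 hc
    have h1 : ‖PowerSeries.constantCoeff (E.c q)‖ * ((k : ℝ) ^ q.1 * (l.descFactorial q.2 : ℝ)) ≤
        E.asymb k l := by
      rw [asymb]
      refine le_trans ?_ (le_add_of_nonneg_left (by positivity))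
      exact Finset.single_le_sum (f := fun p : ℕ × ℕ => ‖PowerSeries.constantCoeff (E.c p)‖ *
        ((k : ℝ) ^ p.1 * (l.descFactorial p.2 : ℝ))) (fun _ _ => by positivity) hq
    have h2 : (k : ℝ) ^ q.1 * (l.descFactorial q.2 : ℝ) ≤
        ‖PowerSeries.constantCoeff (E.c q)‖⁻¹ * E.asymb k l := by
      rw [inv_mul_eq_div, le_div_iff₀ hc', mul_comm]
      exact h1
    have h3 : (k : ℝ) ^ q.1 ≤ E.asymb k l := by
      refine le_trans (pow_le_pow_right₀ (by exact_mod_cast hk) ?_) hkm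
      exact (mem_indexI.1 hq).1.le
    have h4 : D q * E.asymb k l ≤ (∑ p ∈ indexI E.m, D p) * E.asymb k l :=
      mul_le_mul_of_nonneg_right (Finset.single_le_sum (f := D) (fun _ _ => hD0 _) hq) hA.le
    have h5 : (k : ℝ) ^ q.1 * (l : ℝ) ^ q.2 ≤ D q * E.asymb k l := by
      calc (k : ℝ) ^ q.1 * (l : ℝ) ^ q.2
          ≤ (k : ℝ) ^ q.1 * (((q.2 : ℝ) + 1) ^ q.2 * ((l.descFactorial q.2 : ℝ) + 1)) := by
            gcongr; exact pow_le_descFactorial_add_one l q.2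
        _ = ((q.2 : ℝ) + 1) ^ q.2 * ((k : ℝ) ^ q.1 * (l.descFactorial q.2 : ℝ) + (k : ℝ) ^ q.1) := by
            ring
        _ ≤ ((q.2 : ℝ) + 1) ^ q.2 * (‖PowerSeries.constantCoeff (E.c q)‖⁻¹ * E.asymb k l +
              E.asymb k l) := by gcongr
        _ = D q * E.asymb k l := by rw [hD]; ring
    linarith

/-- The indicial polynomial dominates all monomials in the Newton polygon. -/
theorem exists_rpow_le_asymb : ∃ C : ℝ, 1 ≤ C ∧ ∀ p : ℕ × ℕ, p.1 ≤ E.m → ∀ k l : ℕ, 1 ≤ k → 1 ≤ l →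
    (k : ℝ) ^ p.1 * (l : ℝ) ^ ((p.2 : ℝ) - E.dist p) ≤ C * E.asymb k l := by
  obtain ⟨C, hC, h⟩ := E.exists_pow_le_asymb
  refine ⟨C, hC, fun p hp k l hk hl => ?_⟩
  have hk' : (1 : ℝ) ≤ k := by exact_mod_cast hk
  have hl' : (1 : ℝ) ≤ l := by exact_mod_cast hl
  have hk0 : (0 : ℝ) < k := by linarith
  have hl0 : (0 : ℝ) < l := by linarith
  have hS : 0 < C * E.asymb k l := mul_pos (by linarith) (E.asymb_pos hk l)
  -- In logarithms the bounds on Λ₀ become a linear inequality with normal (log k, log l), whose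
  -- entries are nonnegative.
  have := E.dist_ineq hp (Real.log_nonneg hk') (Real.log_nonneg hl')
    (S := Real.log (C * E.asymb k l)) fun q hq => by
      rw [← Real.log_pow, ← Real.log_pow, ← Real.log_mul (by positivity) (by positivity)]
      exact Real.log_le_log (by positivity) (h q hq k l hk)
  rw [← Real.log_pow, ← Real.log_rpow hl0, ← Real.log_mul (by positivity) (by positivity)] at this
  exact (Real.log_le_log_iff (by positivity) hS).1 this

/-! ### The irregularity -/

theorem finite_Lam1 : E.Lam1.Finite := (Finset.finite_toSet (indexI E.m)).subset fun _ hp => hp.1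

theorem bddAbove_sigma0 : BddAbove
    (insert 1 ((fun p => ((E.ordC p : ℝ) + E.dist p) / (E.ordC p : ℝ)) '' E.Lam1)) :=
  ((E.finite_Lam1.image _).insert 1).bddAbove

theorem one_le_sigma0 : 1 ≤ E.sigma0 := le_csSup E.bddAbove_sigma0 (Set.mem_insert _ _)

theorem le_sigma0 {p : ℕ × ℕ} (hp : p ∈ E.Lam1) :
    ((E.ordC p : ℝ) + E.dist p) / (E.ordC p : ℝ) ≤ E.sigma0 :=
  le_csSup E.bddAbove_sigma0 (Set.mem_insert_of_mem _ ⟨p, hp, rfl⟩)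

theorem coeff_ordC_ne_zero {p : ℕ × ℕ} (hp : p ∈ E.Lam1) :
    PowerSeries.coeff (E.ordC p) (E.c p) ≠ 0 :=
  PowerSeries.coeff_order hp.2.2

theorem coeff_eq_zero_of_lt_ordC {p : ℕ × ℕ} {n : ℕ} (h : n < E.ordC p) :
    PowerSeries.coeff n (E.c p) = 0 := by
  exact PowerSeries.coeff_of_lt_order n
    (lt_of_lt_of_le (Nat.cast_lt.2 h) (ENat.natCast_toNat_le_self _))

theorem one_le_ordC {p : ℕ × ℕ} (hp : p ∈ E.Lam1) : 1 ≤ E.ordC p := by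
  by_contra h
  have h0 : E.ordC p = 0 := by omega
  have := E.coeff_ordC_ne_zero hp
  rw [h0, PowerSeries.coeff_zero_eq_constantCoeff_apply] at this
  exact this hp.2.1

theorem dist_le {p : ℕ × ℕ} (hp : p ∈ E.Lam1) : E.dist p ≤ E.ordC p * (E.sigma0 - 1) := by
  have h1 : (1 : ℝ) ≤ E.ordC p := by exact_mod_cast E.one_le_ordC hp
  have := E.le_sigma0 hp
  rw [div_le_iff₀ (by linarith)] at this
  linarith

end Equation

/-! ### Weights in `x` -/

/-- The weight `((N)_l)^σ / l!`, with `(N)_l` the rising factorial. -/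
noncomputable def wt (σ : ℝ) (N l : ℕ) : ℝ := (N.ascFactorial l : ℝ) ^ σ / l.factorial

theorem sum_rpow_le_rpow_sum {ι : Type*} (s : Finset ι) {f : ι → ℝ} (hf : ∀ i ∈ s, 0 ≤ f i)
    {σ : ℝ} (hσ : 1 ≤ σ) : ∑ i ∈ s, f i ^ σ ≤ (∑ i ∈ s, f i) ^ σ := by
  classical
  induction s using Finset.induction_on with
  | empty => simp [Real.zero_rpow (by linarith : σ ≠ 0)]
  | insert a s ha ih =>
    rw [Finset.sum_insert ha, Finset.sum_insert ha]
    refine le_trans (add_le_add_right (ih fun i hi => hf i (Finset.mem_insert_of_mem hi)) _) ?_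
    exact Real.add_rpow_le_rpow_add (hf a (Finset.mem_insert_self a s))
      (Finset.sum_nonneg fun i hi => hf i (Finset.mem_insert_of_mem hi)) hσ

/-- Vandermonde's identity for rising factorials; it is the reason why the indices N add under
multiplication. -/
theorem sum_choose_mul_ascFactorial (N₁ N₂ l : ℕ) :
    ∑ x ∈ Finset.HasAntidiagonal.antidiagonal l, (l.choose x.1 : ℝ) *
      ((N₁.ascFactorial x.1 : ℝ) * (N₂.ascFactorial x.2 : ℝ)) =
      ((N₁ + N₂).ascFactorial l : ℝ) := by
  induction l with
  | zero => simp
  | succ l ih =>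
    rw [Finset.sum_antidiagonal_choose_succ_mul
      (fun i j => (N₁.ascFactorial i : ℝ) * (N₂.ascFactorial j : ℝ)), ← Finset.sum_add_distrib,
      Nat.ascFactorial_succ, Nat.cast_mul, ← ih, Finset.mul_sum]
    refine Finset.sum_congr rfl fun x hx => ?_
    have hx' : x.1 + x.2 = l := Finset.HasAntidiagonal.mem_antidiagonal.1 hx
    have hc : l.choose x.2 = l.choose x.1 := by
      rw [← hx', Nat.choose_symm_add]
    rw [hc, Nat.ascFactorial_succ, Nat.ascFactorial_succ, ← hx']
    push_cast
    ring

section Weights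

variable {σ : ℝ} (hσ : 1 ≤ σ)

theorem wt_nonneg (σ : ℝ) (N l : ℕ) : 0 ≤ wt σ N l := by
  rw [wt]; positivity

theorem cast_ascFactorial_pos {N : ℕ} (hN : 1 ≤ N) (l : ℕ) : (0 : ℝ) < N.ascFactorial l := by
  obtain ⟨n, rfl⟩ := Nat.exists_eq_add_of_le' hN
  exact_mod_cast Nat.ascFactorial_pos n l

include hσ

theorem wt_mono_left {N N' : ℕ} (h : N ≤ N') (l : ℕ) : wt σ N l ≤ wt σ N' l := by
  rw [wt, wt]
  gcongr

/-- Since a binomial coefficient is at most its σ-th power, it can be moved inside the power.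
Superadditivity of y ↦ y^σ then reduces the claim to Vandermonde's identity. -/
theorem wt_conv (N₁ N₂ l : ℕ) :
    ∑ x ∈ Finset.HasAntidiagonal.antidiagonal l, wt σ N₁ x.1 * wt σ N₂ x.2 ≤ wt σ (N₁ + N₂) l := by
  have hl : (0 : ℝ) < l.factorial := by exact_mod_cast l.factorial_pos
  rw [wt, le_div_iff₀ hl, Finset.sum_mul, ← sum_choose_mul_ascFactorial]
  refine le_trans (Finset.sum_le_sum fun x hx => ?_) (sum_rpow_le_rpow_sum _ (f := fun x : ℕ × ℕ => (l.choose x.1 : ℝ) *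
      ((N₁.ascFactorial x.1 : ℝ) * (N₂.ascFactorial x.2 : ℝ))) ?_ hσ)
  · have hx' : x.1 + x.2 = l := Finset.HasAntidiagonal.mem_antidiagonal.1 hx
    have h1 : 1 ≤ l.choose x.1 := Nat.choose_pos (by omega)
    have hc : (l.factorial : ℝ) = l.choose x.1 * (x.1.factorial * x.2.factorial) := by
      rw [← hx', ← mul_assoc, Nat.choose_symm_add]
      exact_mod_cast (Nat.add_choose_mul_factorial_mul_factorial x.1 x.2).symm
    have hf1 : (x.1.factorial : ℝ) ≠ 0 := by exact_mod_cast x.1.factorial_ne_zero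
    have hf2 : (x.2.factorial : ℝ) ≠ 0 := by exact_mod_cast x.2.factorial_ne_zero
    rw [Real.mul_rpow (by positivity) (by positivity), Real.mul_rpow (by positivity) (by positivity),
      hc, wt, wt]
    have : (l.choose x.1 : ℝ) ≤ (l.choose x.1 : ℝ) ^ σ := by
      conv_lhs => rw [← Real.rpow_one (l.choose x.1 : ℝ)]
      exact Real.rpow_le_rpow_of_exponent_le (by exact_mod_cast h1) hσ
    calc _ = (l.choose x.1 : ℝ) * ((N₁.ascFactorial x.1 : ℝ) ^ σ * (N₂.ascFactorial x.2 : ℝ) ^ σ) := by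
          field_simp
      _ ≤ _ := by gcongr
  · intro x _; positivity

/-- Passing from l to l+h multiplies the weight by (N+l)_h^σ / [l+h]_h, and (N+l)_h ≥ [l+h]_h for N
≥ 1. This gain, absent for σ = 1, pays for the distance to the Newton polygon. -/
theorem wt_mul_descFactorial_le {N : ℕ} (hN : 1 ≤ N) (l h : ℕ) :
    wt σ N l * ((l + h).descFactorial h : ℝ) ^ (σ - 1) ≤ wt σ N (l + h) := by
  have hd : (0 : ℝ) < (l + h).descFactorial h := by
    exact_mod_cast Nat.descFactorial_pos.2 (by omega)
  have h1 : (N.ascFactorial (l + h) : ℝ) = N.ascFactorial l * (N + l).ascFactorial h := by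
    exact_mod_cast (Nat.ascFactorial_mul_ascFactorial N l h).symm
  have h2 : ((l + h).factorial : ℝ) = l.factorial * (l + h).descFactorial h := by
    have := Nat.factorial_mul_descFactorial (n := l + h) (k := h) (by omega)
    rw [Nat.add_sub_cancel] at this
    exact_mod_cast this.symm
  have h3 : ((l + h).descFactorial h : ℝ) ≤ (N + l).ascFactorial h := by
    rw [Nat.add_descFactorial_eq_ascFactorial]
    exact_mod_cast Nat.ascFactorial_le h (by omega)
  have hf : (0 : ℝ) < l.factorial := by exact_mod_cast l.factorial_pos
  rw [wt, wt, h1, h2, Real.mul_rpow (by positivity) (by positivity), Real.rpow_sub_one hd.ne']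
  rw [div_mul_div_comm]
  gcongr

theorem wt_mono_right {N : ℕ} (hN : 1 ≤ N) {l l' : ℕ} (h : l ≤ l') : wt σ N l ≤ wt σ N l' := by
  obtain ⟨n, rfl⟩ := Nat.exists_eq_add_of_le h
  refine le_trans (le_mul_of_one_le_right (wt_nonneg _ _ _) ?_) (wt_mul_descFactorial_le hσ hN l n)
  refine Real.one_le_rpow ?_ (by linarith)
  exact_mod_cast Nat.descFactorial_pos.2 (by omega : n ≤ l + n)

theorem one_le_wt {N : ℕ} (hN : 1 ≤ N) (l : ℕ) : 1 ≤ wt σ N l := by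
  have := wt_mono_right hσ hN (Nat.zero_le l)
  simpa [wt] using this

/-- From (N)_l (N+l)_μ = (N)_μ (N+μ)_l: a factor of size l^μ is exchanged for one of size N^μ by
raising the index from N to N+μ. -/
theorem descFactorial_mul_wt_le {N : ℕ} (hN : 1 ≤ N) (l μ : ℕ) :
    (l.descFactorial μ : ℝ) * wt σ N l ≤ ((N : ℝ) + μ) ^ μ * wt σ (N + μ) l := by
  have h1 : l.descFactorial μ * N.ascFactorial l ≤ (N + μ) ^ μ * (N + μ).ascFactorial l := by
    calc l.descFactorial μ * N.ascFactorial l ≤ (N + l).ascFactorial μ * N.ascFactorial l := by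
          gcongr
          calc l.descFactorial μ ≤ l ^ μ := Nat.descFactorial_le_pow l μ
            _ ≤ (N + l) ^ μ := Nat.pow_le_pow_left (by omega) μ
            _ ≤ _ := Nat.pow_succ_le_ascFactorial _ _
      _ = N.ascFactorial μ * (N + μ).ascFactorial l := by
          rw [mul_comm, Nat.ascFactorial_mul_ascFactorial, Nat.ascFactorial_mul_ascFactorial,
            add_comm]
      _ ≤ _ := by
          gcongr
          obtain ⟨n, rfl⟩ := Nat.exists_eq_add_of_le' hN
          exact (Nat.ascFactorial_le_pow_add n μ).trans (Nat.pow_le_pow_left (by omega) μ)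
  have h1' : (l.descFactorial μ : ℝ) * N.ascFactorial l ≤
      ((N : ℝ) + μ) ^ μ * (N + μ).ascFactorial l := by exact_mod_cast h1
  have hp := cast_ascFactorial_pos hN l
  have hp' := cast_ascFactorial_pos (by omega : 1 ≤ N + μ) l
  have h2 : ((N.ascFactorial l : ℝ)) ^ (σ - 1) ≤ ((N + μ).ascFactorial l : ℝ) ^ (σ - 1) := by
    refine Real.rpow_le_rpow hp.le ?_ (by linarith)
    exact_mod_cast Nat.ascFactorial_le l (by omega : N ≤ N + μ)
  rw [wt, wt, mul_div_assoc', mul_div_assoc']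
  refine div_le_div_of_nonneg_right ?_ (by positivity)
  rw [show σ = 1 + (σ - 1) by ring, Real.rpow_add hp, Real.rpow_add hp', Real.rpow_one,
    Real.rpow_one, ← mul_assoc, ← mul_assoc]
  exact mul_le_mul h1' h2 (by positivity) (by positivity)

/-- Effect of `x^μ ∂_x^α` on the weights. -/
theorem descFactorial_mul_wt_le_rpow {N : ℕ} (hN : 1 ≤ N) (l μ α : ℕ) :
    ((l + α).descFactorial α : ℝ) * wt σ N (l + α) ≤
      ((N : ℝ) + α) ^ (max (α : ℝ) (μ + σ * ((α : ℝ) - μ))) * wt σ (N + α) (l + μ) := by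
  have hN' : (1 : ℝ) ≤ (N : ℝ) + α := by
    have : (1 : ℝ) ≤ N := by exact_mod_cast hN
    have : (0 : ℝ) ≤ α := by positivity
    linarith
  rcases le_total α μ with h | h
  -- If α ≤ μ the power of x is not lowered, and each derivative costs one factor N.
  · refine (descFactorial_mul_wt_le hσ hN _ α).trans ?_
    refine mul_le_mul ?_ (wt_mono_right hσ (by omega) (by omega)) (wt_nonneg _ _ _) (by positivity)
    rw [← Real.rpow_natCast]
    exact Real.rpow_le_rpow_of_exponent_le hN' (le_max_left _ _)
  -- If α = μ + δ, then μ derivatives are compensated by x^μ and cost N each, while the remaining δ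
  -- lower the degree and cost N^σ each.
  · obtain ⟨δ, rfl⟩ := Nat.exists_eq_add_of_le h
    have e1 : ((l + (μ + δ)).descFactorial (μ + δ) : ℝ) * wt σ N (l + (μ + δ)) =
        ((N.ascFactorial δ : ℝ) ^ σ) * (((l + μ).descFactorial μ : ℝ) * wt σ (N + δ) (l + μ)) := by
      have h1 : (N.ascFactorial (l + (μ + δ)) : ℝ) =
          N.ascFactorial δ * (N + δ).ascFactorial (l + μ) := by
        rw [show l + (μ + δ) = δ + (l + μ) by ring]
        exact_mod_cast (Nat.ascFactorial_mul_ascFactorial N δ (l + μ)).symm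
      have h2 : ∀ n : ℕ, ((l + n).factorial : ℝ) = l.factorial * (l + n).descFactorial n := by
        intro n
        have := Nat.factorial_mul_descFactorial (n := l + n) (k := n) (by omega)
        rw [Nat.add_sub_cancel] at this
        exact_mod_cast this.symm
      have h3 : ∀ n : ℕ, ((l + n).descFactorial n : ℝ) ≠ 0 := by
        intro n
        exact_mod_cast (Nat.descFactorial_pos.2 (by omega : n ≤ l + n)).ne'
      have hf : (l.factorial : ℝ) ≠ 0 := by exact_mod_cast l.factorial_ne_zero
      have := h3 μ
      have := h3 (μ + δ)
      rw [wt, wt, h1, h2, h2, Real.mul_rpow (by positivity) (by positivity)]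
      field_simp
    rw [e1]
    have e2 : (N.ascFactorial δ : ℝ) ^ σ ≤ ((N : ℝ) + (μ + δ : ℕ)) ^ (σ * δ) := by
      rw [mul_comm, Real.rpow_mul (by positivity), Real.rpow_natCast]
      refine Real.rpow_le_rpow (by positivity) ?_ (by linarith)
      obtain ⟨n, rfl⟩ := Nat.exists_eq_add_of_le' hN
      exact_mod_cast (Nat.ascFactorial_le_pow_add n δ).trans (Nat.pow_le_pow_left (by omega) δ)
    have e3 := descFactorial_mul_wt_le hσ (by omega : 1 ≤ N + δ) (l + μ) μ
    have e4 : ((N + δ : ℕ) : ℝ) + μ = (N : ℝ) + (μ + δ : ℕ) := by push_cast; ring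
    rw [e4, show N + δ + μ = N + (μ + δ) by ring, ← Real.rpow_natCast] at e3
    calc _ ≤ ((N : ℝ) + (μ + δ : ℕ)) ^ (σ * δ) *
          (((N : ℝ) + (μ + δ : ℕ)) ^ (μ : ℝ) * wt σ (N + (μ + δ)) (l + μ)) :=
          mul_le_mul e2 e3 (mul_nonneg (by positivity) (wt_nonneg _ _ _)) (by positivity)
      _ = ((N : ℝ) + (μ + δ : ℕ)) ^ (σ * δ + μ) * wt σ (N + (μ + δ)) (l + μ) := by
          rw [Real.rpow_add (by linarith)]; ring
      _ ≤ _ := by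
          refine mul_le_mul_of_nonneg_right ?_ (wt_nonneg _ _ _)
          refine Real.rpow_le_rpow_of_exponent_le hN' (le_trans (le_of_eq ?_) (le_max_right _ _))
          push_cast; ring

end Weights

/-! ### Majorants in `x` -/

/-- `f` is majorized by `b ∑ R^l ((N)_l)^σ / l! x^l`. -/
def Maj (σ R : ℝ) (N : ℕ) (b : ℝ) (f : ℂ⟦X⟧) : Prop :=
  ∀ l, ‖PowerSeries.coeff l f‖ ≤ b * (R ^ l * wt σ N l)

section Maj

variable {σ R : ℝ} (hσ : 1 ≤ σ) (hR : 0 < R)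
include hR

theorem Maj.mono_const {N : ℕ} {b b' : ℝ} {f : ℂ⟦X⟧} (h : Maj σ R N b f) (hb : b ≤ b') :
    Maj σ R N b' f := fun l =>
  (h l).trans (mul_le_mul_of_nonneg_right hb (mul_nonneg (by positivity) (wt_nonneg _ _ _)))

theorem Maj.zero (N : ℕ) {b : ℝ} (hb : 0 ≤ b) : Maj σ R N b 0 := fun l => by
  rw [map_zero, norm_zero]
  exact mul_nonneg hb (mul_nonneg (by positivity) (wt_nonneg _ _ _))

include hσ

theorem Maj.mono_index {N N' : ℕ} (hN : N ≤ N') {b : ℝ} (hb : 0 ≤ b) {f : ℂ⟦X⟧}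
    (h : Maj σ R N b f) : Maj σ R N' b f := fun l => by
  have := wt_mono_left hσ hN l
  exact (h l).trans (by gcongr)

theorem Maj.mul {N₁ N₂ : ℕ} {b₁ b₂ : ℝ} (hb₁ : 0 ≤ b₁) {f g : ℂ⟦X⟧} (hb₂ : 0 ≤ b₂)
    (hf : Maj σ R N₁ b₁ f) (hg : Maj σ R N₂ b₂ g) : Maj σ R (N₁ + N₂) (b₁ * b₂) (f * g) := by
  intro l
  rw [PowerSeries.coeff_mul]
  refine (norm_sum_le _ _).trans ?_
  calc ∑ x ∈ Finset.HasAntidiagonal.antidiagonal l, ‖PowerSeries.coeff x.1 f * PowerSeries.coeff x.2 g‖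
      ≤ ∑ x ∈ Finset.HasAntidiagonal.antidiagonal l, b₁ * b₂ * R ^ l * (wt σ N₁ x.1 * wt σ N₂ x.2) := by
        refine Finset.sum_le_sum fun x hx => ?_
        rw [norm_mul]
        refine (mul_le_mul (hf _) (hg _) (norm_nonneg _) (mul_nonneg hb₁
          (mul_nonneg (by positivity) (wt_nonneg _ _ _)))).trans (le_of_eq ?_)
        rw [← Finset.HasAntidiagonal.mem_antidiagonal.1 hx, pow_add]; ring
    _ ≤ b₁ * b₂ * R ^ l * wt σ (N₁ + N₂) l := by
        rw [← Finset.mul_sum]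
        exact mul_le_mul_of_nonneg_left (wt_conv hσ N₁ N₂ l) (by positivity)
    _ = _ := by ring

theorem Maj.X_pow_mul_deriv {N : ℕ} (hN : 1 ≤ N) {b : ℝ} (hb : 0 ≤ b) {f : ℂ⟦X⟧}
    (h : Maj σ R N b f) (μ α : ℕ) : Maj σ R (N + α)
      (b * R ^ α * ((N : ℝ) + α) ^ (max (α : ℝ) (μ + σ * ((α : ℝ) - μ))) * (R ^ μ)⁻¹)
      (PowerSeries.X ^ μ * (PowerSeries.derivative ℂ)^[α] f) := by
  intro l
  rw [PowerSeries.coeff_X_pow_mul']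
  split_ifs with hl
  · obtain ⟨n, rfl⟩ := Nat.exists_eq_add_of_le' hl
    rw [Nat.add_sub_cancel, coeff_iter_deriv, norm_mul, Complex.norm_natCast]
    calc ((n + α).descFactorial α : ℝ) * ‖PowerSeries.coeff (n + α) f‖
        ≤ ((n + α).descFactorial α : ℝ) * (b * (R ^ (n + α) * wt σ N (n + α))) := by
          gcongr; exact h _
      _ = b * R ^ (n + α) * (((n + α).descFactorial α : ℝ) * wt σ N (n + α)) := by ring
      _ ≤ b * R ^ (n + α) * (((N : ℝ) + α) ^ (max (α : ℝ) (μ + σ * ((α : ℝ) - μ))) *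
            wt σ (N + α) (n + μ)) := by
          exact mul_le_mul_of_nonneg_left (descFactorial_mul_wt_le_rpow hσ hN n μ α) (by positivity)
      _ = _ := by
          rw [pow_add, pow_add]
          field_simp
  · rw [norm_zero]
    exact mul_nonneg (by positivity) (mul_nonneg (by positivity) (wt_nonneg _ _ _))

end Maj

/-! ### The linear part -/

/-- Without the constant term every summand carries at least one factor 1/R. This smallness lets the
variable part of the c_{j,α} be absorbed. -/
theorem Convergent.exists_sum_le {f : ℂ⟦X⟧} (hf : Convergent f) :
    ∃ C R₀ : ℝ, 0 ≤ C ∧ 1 ≤ R₀ ∧ ∀ R, R₀ ≤ R → ∀ n : ℕ,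
      ∑ h ∈ Finset.range n, ‖PowerSeries.coeff (h + 1) f‖ * (R ^ (h + 1))⁻¹ ≤ C / R := by
  obtain ⟨ρ, hρ, hs⟩ := hf
  set S := ∑' l : ℕ, ‖PowerSeries.coeff l f‖ * ρ ^ l
  have hS : 0 ≤ S := tsum_nonneg fun _ => by positivity
  refine ⟨S / ρ, max 1 ρ⁻¹, by positivity, le_max_left _ _, fun R hR n => ?_⟩
  have hR1 : 1 ≤ R := (le_max_left _ _).trans hR
  have hR0 : 0 < R := by linarith
  have hRρ : 1 ≤ R * ρ := by
    have := (le_max_right _ _).trans hR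
    rwa [inv_le_iff_one_le_mul₀ hρ] at this
  have hs' : Summable fun h : ℕ => ‖PowerSeries.coeff (h + 1) f‖ * ρ ^ (h + 1) :=
    (summable_nat_add_iff 1).2 hs
  calc ∑ h ∈ Finset.range n, ‖PowerSeries.coeff (h + 1) f‖ * (R ^ (h + 1))⁻¹
      ≤ ∑ h ∈ Finset.range n, ‖PowerSeries.coeff (h + 1) f‖ * ρ ^ (h + 1) * (R * ρ)⁻¹ := by
        refine Finset.sum_le_sum fun h _ => ?_
        rw [mul_assoc]
        refine mul_le_mul_of_nonneg_left ?_ (norm_nonneg _)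
        rw [← div_eq_mul_inv, le_div_iff₀ (by positivity), inv_mul_le_iff₀ (by positivity),
          ← mul_pow]
        exact le_self_pow₀ hRρ (by omega)
    _ = (∑ h ∈ Finset.range n, ‖PowerSeries.coeff (h + 1) f‖ * ρ ^ (h + 1)) * (R * ρ)⁻¹ := by
        rw [Finset.sum_mul]
    _ ≤ S * (R * ρ)⁻¹ := by
        refine mul_le_mul_of_nonneg_right ?_ (by positivity)
        refine (hs'.sum_le_tsum _ fun _ _ => by positivity).trans ?_
        rw [show S = _ from (hs.tsum_eq_zero_add)]
        exact le_add_of_nonneg_left (by positivity)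
    _ = _ := by field_simp

theorem Convergent.exists_maj {f : ℂ⟦X⟧} (hf : Convergent f) {σ : ℝ} (hσ : 1 ≤ σ) :
    ∃ C R₀ : ℝ, 0 ≤ C ∧ 1 ≤ R₀ ∧ ∀ R, R₀ ≤ R → Maj σ R 1 C f := by
  obtain ⟨ρ, hρ, hs⟩ := hf
  set S := ∑' l : ℕ, ‖PowerSeries.coeff l f‖ * ρ ^ l
  have hS : 0 ≤ S := tsum_nonneg fun _ => by positivity
  refine ⟨S, max 1 ρ⁻¹, hS, le_max_left _ _, fun R hR l => ?_⟩
  have hR1 : 1 ≤ R := (le_max_left _ _).trans hR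
  have hRρ : 1 ≤ ρ * R := by
    have := (le_max_right _ _).trans hR
    rwa [inv_le_iff_one_le_mul₀' hρ] at this
  have h1 : ‖PowerSeries.coeff l f‖ * ρ ^ l ≤ S :=
    hs.le_tsum l fun _ _ => by positivity
  calc ‖PowerSeries.coeff l f‖ ≤ ‖PowerSeries.coeff l f‖ * ((ρ * R) ^ l * wt σ 1 l) :=
        le_mul_of_one_le_right (norm_nonneg _)
          (one_le_mul_of_one_le_of_one_le (one_le_pow₀ hRρ) (one_le_wt hσ le_rfl l))
    _ = ‖PowerSeries.coeff l f‖ * ρ ^ l * (R ^ l * wt σ 1 l) := by rw [mul_pow]; ring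
    _ ≤ _ := mul_le_mul_of_nonneg_right h1 (mul_nonneg (by positivity) (wt_nonneg _ _ _))

theorem pow_le_mul_descFactorial {l α : ℕ} (h : α ≤ l) :
    (l : ℝ) ^ α ≤ ((α : ℝ) + 1) ^ α * (l.descFactorial α : ℝ) := by
  have h1 : l ≤ (α + 1) * (l + 1 - α) := by
    obtain ⟨n, rfl⟩ := Nat.exists_eq_add_of_le h
    rw [show α + n + 1 - α = n + 1 by omega]
    nlinarith
  have h2 : l ^ α ≤ (α + 1) ^ α * l.descFactorial α := by
    refine (Nat.pow_le_pow_left h1 α).trans ?_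
    rw [mul_pow]
    exact Nat.mul_le_mul_left _ (Nat.pow_sub_le_descFactorial l α)
  exact_mod_cast h2

theorem descFactorial_mono_right {l P h : ℕ} (hP : P ≤ h) (hl : h ≤ l) :
    l.descFactorial P ≤ l.descFactorial h := by
  rw [← Nat.descFactorial_mul_descFactorial hP]
  exact Nat.le_mul_of_pos_left _ (Nat.descFactorial_pos.2 (by omega))

namespace Equation

variable (E : Equation)

/-- If c_{j,α}(0) ≠ 0, the monomial is already dominated by the symbol. Otherwise the symbol
controls only k^j l^(α-d). As h is at least the order p of the zero, the weights gain [l]_h^(σ₀-1),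
which is at least of size l^(p(σ₀-1)) ≥ l^d. The constant is independent of N, so N may later grow
with k. -/
theorem exists_tail_term_le : ∃ K : ℝ, 1 ≤ K ∧ ∀ p ∈ indexI E.m, ∀ k N l' h : ℕ, 1 ≤ k → 1 ≤ N →
    1 ≤ h → ‖PowerSeries.coeff h (E.c p)‖ * ((k : ℝ) ^ p.1 * (l'.descFactorial p.2 : ℝ)) *
      wt E.sigma0 N l' ≤
      K * ‖PowerSeries.coeff h (E.c p)‖ * (E.asymb k (l' + h) * wt E.sigma0 N (l' + h)) := by
  obtain ⟨C₀, hC₀, h0⟩ := E.exists_pow_le_asymb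
  obtain ⟨C₁, hC₁, h1⟩ := E.exists_rpow_le_asymb
  have hσ := E.one_le_sigma0
  set D : ℕ × ℕ → ℝ := fun p => (((E.ordC p : ℝ) + 1) ^ E.ordC p) ^ (E.sigma0 - 1) with hD
  have hD0 : ∀ p, 0 ≤ D p := fun p => by positivity
  set T := ∑ p ∈ indexI E.m, D p
  have hT0 : 0 ≤ T := Finset.sum_nonneg fun _ _ => hD0 _
  refine ⟨C₀ + C₁ * T, ?_, fun p hp k N l' h hk hN hh => ?_⟩
  · have : 0 ≤ C₁ * T := mul_nonneg (by linarith) hT0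
    linarith
  have hA := E.asymb_pos hk (l' + h)
  have hW := wt_nonneg E.sigma0 N l'
  have hWW := wt_mono_right hσ hN (Nat.le_add_right l' h)
  by_cases hc : PowerSeries.coeff h (E.c p) = 0
  · rw [hc]; simp
  suffices hmain : ((k : ℝ) ^ p.1 * (l'.descFactorial p.2 : ℝ)) * wt E.sigma0 N l' ≤
      (C₀ + C₁ * T) * (E.asymb k (l' + h) * wt E.sigma0 N (l' + h)) by
    calc _ = ‖PowerSeries.coeff h (E.c p)‖ *
          (((k : ℝ) ^ p.1 * (l'.descFactorial p.2 : ℝ)) * wt E.sigma0 N l') := by ring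
      _ ≤ ‖PowerSeries.coeff h (E.c p)‖ *
          ((C₀ + C₁ * T) * (E.asymb k (l' + h) * wt E.sigma0 N (l' + h))) := by gcongr
      _ = _ := by ring
  have hl'l : (l'.descFactorial p.2 : ℝ) ≤ ((l' + h : ℕ) : ℝ) ^ p.2 := by
    exact_mod_cast (Nat.descFactorial_le_pow l' p.2).trans (Nat.pow_le_pow_left (by omega) _)
  have hAW : 0 ≤ E.asymb k (l' + h) * wt E.sigma0 N (l' + h) := mul_nonneg hA.le (hW.trans hWW)
  by_cases hc0 : PowerSeries.constantCoeff (E.c p) = 0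
  · have hp1 : p ∈ E.Lam1 := ⟨hp, hc0, fun h' => hc (by rw [h', map_zero])⟩
    have hP : E.ordC p ≤ h := by
      by_contra hlt
      exact hc (E.coeff_eq_zero_of_lt_ordC (not_le.1 hlt))
    set P := E.ordC p with hPdef
    set d := E.dist p
    have hl1 : (1 : ℝ) ≤ ((l' + h : ℕ) : ℝ) := by exact_mod_cast (by omega : 1 ≤ l' + h)
    have hl0 : (0 : ℝ) < ((l' + h : ℕ) : ℝ) := by linarith
    have e1 : (k : ℝ) ^ p.1 * (l'.descFactorial p.2 : ℝ) ≤
        C₁ * E.asymb k (l' + h) * (((l' + h : ℕ) : ℝ) ^ P) ^ (E.sigma0 - 1) := by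
      calc (k : ℝ) ^ p.1 * (l'.descFactorial p.2 : ℝ)
          ≤ (k : ℝ) ^ p.1 * ((l' + h : ℕ) : ℝ) ^ p.2 := by gcongr
        _ = (k : ℝ) ^ p.1 * ((l' + h : ℕ) : ℝ) ^ ((p.2 : ℝ) - d) * ((l' + h : ℕ) : ℝ) ^ d := by
            rw [mul_assoc, ← Real.rpow_add hl0, sub_add_cancel, Real.rpow_natCast]
        _ ≤ C₁ * E.asymb k (l' + h) * ((l' + h : ℕ) : ℝ) ^ d := by
            refine mul_le_mul_of_nonneg_right ?_ (by positivity)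
            exact h1 p (mem_indexI.1 hp).1.le k (l' + h) hk (by omega)
        _ ≤ _ := by
            refine mul_le_mul_of_nonneg_left ?_ (mul_nonneg (by linarith) hA.le)
            rw [← Real.rpow_natCast, ← Real.rpow_mul hl0.le]
            exact Real.rpow_le_rpow_of_exponent_le hl1 (E.dist_le hp1)
    have e2 : (((l' + h : ℕ) : ℝ) ^ P) ^ (E.sigma0 - 1) ≤
        D p * (((l' + h).descFactorial h : ℕ) : ℝ) ^ (E.sigma0 - 1) := by
      rw [hD, ← Real.mul_rpow (by positivity) (by positivity)]
      refine Real.rpow_le_rpow (by positivity) ?_ (by linarith)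
      refine (pow_le_mul_descFactorial (by omega : P ≤ l' + h)).trans ?_
      gcongr
      exact descFactorial_mono_right hP (by omega)
    have e3 := wt_mul_descFactorial_le hσ hN l' h
    have hDT : D p ≤ T := Finset.single_le_sum (f := D) (fun _ _ => hD0 _) hp
    calc (k : ℝ) ^ p.1 * (l'.descFactorial p.2 : ℝ) * wt E.sigma0 N l'
        ≤ C₁ * E.asymb k (l' + h) *
          (D p * (((l' + h).descFactorial h : ℕ) : ℝ) ^ (E.sigma0 - 1)) * wt E.sigma0 N l' := by
          refine mul_le_mul_of_nonneg_right (e1.trans ?_) hW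
          exact mul_le_mul_of_nonneg_left e2 (mul_nonneg (by linarith) hA.le)
      _ = C₁ * D p * (E.asymb k (l' + h) * (wt E.sigma0 N l' *
          (((l' + h).descFactorial h : ℕ) : ℝ) ^ (E.sigma0 - 1))) := by ring
      _ ≤ (C₀ + C₁ * T) * (E.asymb k (l' + h) * wt E.sigma0 N (l' + h)) := by
          have h5 : C₁ * D p ≤ C₀ + C₁ * T := by
            have : C₁ * D p ≤ C₁ * T := mul_le_mul_of_nonneg_left hDT (by linarith)
            linarith
          have h6 : 0 ≤ C₁ * D p := mul_nonneg (by linarith) (hD0 p)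
          gcongr
  · have h2 := h0 p (Or.inr ⟨hp, hc0⟩) k (l' + h) hk
    calc (k : ℝ) ^ p.1 * (l'.descFactorial p.2 : ℝ) * wt E.sigma0 N l'
        ≤ C₀ * E.asymb k (l' + h) * wt E.sigma0 N (l' + h) := by
          refine mul_le_mul (le_trans ?_ h2) hWW hW (mul_nonneg (by linarith) hA.le)
          gcongr
      _ = C₀ * (E.asymb k (l' + h) * wt E.sigma0 N (l' + h)) := by ring
      _ ≤ _ := mul_le_mul_of_nonneg_right
          (le_add_of_nonneg_right (mul_nonneg (by linarith) hT0)) hAW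

/-- Summing the single-term estimates leaves a total constant of order 1/R, and R is taken large
enough to make it at most 1/2, uniformly in k, N and l. -/
theorem exists_sum_tail_le : ∃ R₀ : ℝ, 1 ≤ R₀ ∧ ∀ R, R₀ ≤ R → ∀ k N l : ℕ, 1 ≤ k → 1 ≤ N →
    ∑ l' ∈ Finset.range l, ‖E.tail k l l'‖ * (R ^ l' * wt E.sigma0 N l') ≤
      E.asymb k l / 2 * (R ^ l * wt E.sigma0 N l) := by
  obtain ⟨K, hK, hterm⟩ := E.exists_tail_term_le
  choose! C R₁ hC hR₁ hsum using fun p (hp : p ∈ indexI E.m) => (E.c_conv p hp).exists_sum_le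
  have hC0 : 0 ≤ ∑ p ∈ indexI E.m, C p := Finset.sum_nonneg hC
  have hR₁0 : 0 ≤ ∑ p ∈ indexI E.m, R₁ p :=
    Finset.sum_nonneg fun p hp => zero_le_one.trans (hR₁ p hp)
  refine ⟨1 + ∑ p ∈ indexI E.m, R₁ p + 2 * K * ∑ p ∈ indexI E.m, C p, ?_, ?_⟩
  · have : 0 ≤ 2 * K * ∑ p ∈ indexI E.m, C p := by positivity
    linarith
  intro R hR k N l hk hN
  have hKC : 0 ≤ 2 * K * ∑ p ∈ indexI E.m, C p := by positivity
  have hRpos : 0 < R := by linarith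
  have hA := E.asymb_pos hk l
  have hW := wt_nonneg E.sigma0 N l
  have hX : 0 ≤ R ^ l * (E.asymb k l * wt E.sigma0 N l) := by positivity
  have h1 : ∀ l' ∈ Finset.range l, ‖E.tail k l l'‖ * (R ^ l' * wt E.sigma0 N l') ≤
      ∑ p ∈ indexI E.m, K * (R ^ l * (E.asymb k l * wt E.sigma0 N l)) *
        (‖PowerSeries.coeff (l - l') (E.c p)‖ * (R ^ (l - l'))⁻¹) := by
    intro l' hl'
    have hl' : l' < l := Finset.mem_range.1 hl'
    obtain ⟨h, rfl⟩ := Nat.exists_eq_add_of_le hl'.le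
    rw [Nat.add_sub_cancel_left]
    calc ‖E.tail k (l' + h) l'‖ * (R ^ l' * wt E.sigma0 N l')
        ≤ (∑ p ∈ indexI E.m, ‖PowerSeries.coeff h (E.c p)‖ *
          ((k : ℝ) ^ p.1 * (l'.descFactorial p.2 : ℝ))) * (R ^ l' * wt E.sigma0 N l') := by
          refine mul_le_mul_of_nonneg_right ?_ (mul_nonneg (by positivity) (wt_nonneg _ _ _))
          rw [tail, Nat.add_sub_cancel_left]
          refine (norm_sum_le _ _).trans (le_of_eq (Finset.sum_congr rfl fun p _ => ?_))
          rw [norm_mul, norm_mul, norm_pow, Complex.norm_natCast, Complex.norm_natCast]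
      _ = ∑ p ∈ indexI E.m, R ^ l' * (‖PowerSeries.coeff h (E.c p)‖ *
          ((k : ℝ) ^ p.1 * (l'.descFactorial p.2 : ℝ)) * wt E.sigma0 N l') := by
          rw [Finset.sum_mul]
          exact Finset.sum_congr rfl fun p _ => by ring
      _ ≤ _ := by
          refine Finset.sum_le_sum fun p hp => ?_
          refine (mul_le_mul_of_nonneg_left (hterm p hp k N l' h hk hN (by omega))
            (by positivity)).trans (le_of_eq ?_)
          rw [pow_add]
          field_simp
  refine (Finset.sum_le_sum h1).trans ?_
  rw [Finset.sum_comm]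
  have h2 : ∀ p ∈ indexI E.m, ∑ l' ∈ Finset.range l,
      K * (R ^ l * (E.asymb k l * wt E.sigma0 N l)) *
        (‖PowerSeries.coeff (l - l') (E.c p)‖ * (R ^ (l - l'))⁻¹) ≤
      K * (R ^ l * (E.asymb k l * wt E.sigma0 N l)) * (C p / R) := by
    intro p hp
    rw [← Finset.mul_sum]
    refine mul_le_mul_of_nonneg_left ?_ (by positivity)
    have hRp : R₁ p ≤ R := by
      have := Finset.single_le_sum (f := R₁) (fun q hq => zero_le_one.trans (hR₁ q hq)) hp
      linarith
    refine le_trans (le_of_eq ?_) (hsum p hp R hRp l)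
    rw [← Finset.sum_range_reflect]
    refine Finset.sum_congr rfl fun j hj => ?_
    have := Finset.mem_range.1 hj
    rw [show l - (l - 1 - j) = j + 1 by omega]
  refine (Finset.sum_le_sum h2).trans ?_
  rw [← Finset.mul_sum, ← Finset.sum_div]
  have h3 : K * ((∑ p ∈ indexI E.m, C p) / R) ≤ 1 / 2 := by
    rw [mul_div_assoc', div_le_div_iff₀ hRpos two_pos]
    linarith
  calc _ = R ^ l * (E.asymb k l * wt E.sigma0 N l) * (K * ((∑ p ∈ indexI E.m, C p) / R)) := by ring
    _ ≤ R ^ l * (E.asymb k l * wt E.sigma0 N l) * (1 / 2) := by gcongr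
    _ = _ := by ring

/-- Inversion of the linear part in the scale of majorants. -/
theorem SignCond.exists_maj_of_recursion {E : Equation} (hE : E.SignCond) :
    ∃ R₀ : ℝ, 1 ≤ R₀ ∧ ∀ R, R₀ ≤ R →
    ∀ k N : ℕ, 1 ≤ k → 1 ≤ N → ∀ F : ℝ, 0 ≤ F → ∀ w f : ℂ⟦X⟧,
    (∀ l, E.symb k l * PowerSeries.coeff l w =
      ∑ l' ∈ Finset.range l, E.tail k l l' * PowerSeries.coeff l' w + PowerSeries.coeff l f) →
    Maj E.sigma0 R N (F * (k : ℝ) ^ E.m) f → Maj E.sigma0 R N (2 * F) w := by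
  obtain ⟨R₀, hR₀, hsum⟩ := E.exists_sum_tail_le
  refine ⟨R₀, hR₀, fun R hR k N hk hN F hF w f hw hf l => ?_⟩
  induction l using Nat.strong_induction_on with
  | _ l ih =>
    have hA := E.asymb_pos hk l
    have hX : 0 ≤ R ^ l * wt E.sigma0 N l :=
      mul_nonneg (pow_nonneg (by linarith) _) (wt_nonneg _ _ _)
    have h1 : E.asymb k l * ‖PowerSeries.coeff l w‖ ≤
        E.asymb k l * (2 * F * (R ^ l * wt E.sigma0 N l)) := by
      calc E.asymb k l * ‖PowerSeries.coeff l w‖ = ‖E.symb k l * PowerSeries.coeff l w‖ := by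
            rw [norm_mul, hE.symb_eq, Complex.norm_real, Real.norm_of_nonneg hA.le]
        _ ≤ ∑ l' ∈ Finset.range l, ‖E.tail k l l'‖ * (2 * F * (R ^ l' * wt E.sigma0 N l')) +
            F * (k : ℝ) ^ E.m * (R ^ l * wt E.sigma0 N l) := by
            rw [hw]
            refine (norm_add_le _ _).trans (add_le_add ((norm_sum_le _ _).trans ?_) (hf l))
            refine Finset.sum_le_sum fun l' hl' => ?_
            rw [norm_mul]
            exact mul_le_mul_of_nonneg_left (ih l' (Finset.mem_range.1 hl')) (norm_nonneg _)
        _ = 2 * F * (∑ l' ∈ Finset.range l, ‖E.tail k l l'‖ * (R ^ l' * wt E.sigma0 N l')) +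
            F * (k : ℝ) ^ E.m * (R ^ l * wt E.sigma0 N l) := by
            rw [Finset.mul_sum]
            congr 1
            exact Finset.sum_congr rfl fun _ _ => by ring
        -- The tail uses up one half of the constant 2F and the source the other half, the latter
        -- through k^m ≤ `asymb`.
        _ ≤ 2 * F * (E.asymb k l / 2 * (R ^ l * wt E.sigma0 N l)) +
            F * E.asymb k l * (R ^ l * wt E.sigma0 N l) := by
            have := hsum R hR k N l hk hN
            have := E.pow_le_asymb k l
            gcongr
        _ = _ := by ring
    exact le_of_mul_le_mul_left h1 hA

end Equation

/-! ### Weights in `t` -/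

/-- The weight `A^κ (κ+1)!^τ (κ+1)^e`. -/
noncomputable def omg (A τ e : ℝ) (κ : ℕ) : ℝ :=
  A ^ κ * ((κ + 1).factorial : ℝ) ^ τ * ((κ : ℝ) + 1) ^ e

theorem omg_nonneg {A : ℝ} (hA : 0 ≤ A) (τ e : ℝ) (κ : ℕ) : 0 ≤ omg A τ e κ := by
  rw [omg]; positivity

/-- The product keeps a single shift by one. This fits the indexing κ = k-1, every factor having
been divided by t. -/
theorem factorial_succ_mul_le (a b : ℕ) :
    (a + 1).factorial * (b + 1).factorial ≤ (a + b + 1).factorial := by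
  have h1 : (a + 1).factorial * (a + 1 + 1).ascFactorial b = (a + 1 + b).factorial :=
    Nat.factorial_mul_ascFactorial (a + 1) b
  have h2 : (b + 1).factorial = (1 + 1).ascFactorial b := by
    have := Nat.factorial_mul_ascFactorial 1 b
    rw [Nat.factorial_one, one_mul] at this
    rw [this, add_comm]
  rw [show a + b + 1 = a + 1 + b by ring, ← h1, h2]
  exact Nat.mul_le_mul_left _ (Nat.ascFactorial_le b (by omega))

/-- The constant of the convolution estimate for the weights `omg`. -/
noncomputable def convConst (B : ℝ) : ℝ := 2 ^ B * (2 * ∑' n : ℕ, ((n : ℝ) + 1) ^ (-2 : ℝ))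

theorem summable_inv_sq : Summable fun n : ℕ => ((n : ℝ) + 1) ^ (-2 : ℝ) := by
  have h := (summable_nat_add_iff 1).2 (Real.summable_nat_rpow.2 (by norm_num : (-2 : ℝ) < -1))
  simpa using h

theorem one_le_convConst {B : ℝ} (hB : 0 ≤ B) : 1 ≤ convConst B := by
  have h1 : (1 : ℝ) ≤ ∑' n : ℕ, ((n : ℝ) + 1) ^ (-2 : ℝ) := by
    have := summable_inv_sq.le_tsum 0 fun _ _ => by positivity
    simpa using this
  have h2 : (1 : ℝ) ≤ 2 ^ B := Real.one_le_rpow (by norm_num) hB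
  rw [convConst]
  nlinarith

/-- For κ₂ ≤ κ₁ the numbers κ₁+1 and κ₁+κ₂+1 differ by a factor at most 2, so even a negative power
e ≥ -B changes by at most 2^B. The smaller index keeps the summable factor (κ₂+1)^(-2). -/
theorem omg_mul_le {A τ e B : ℝ} (hA : 0 ≤ A) (hτ : 0 ≤ τ) (hB : 0 ≤ B) (he : -B ≤ e)
    {κ₁ κ₂ : ℕ} (h : κ₂ ≤ κ₁) :
    omg A τ e κ₁ * omg A τ (-2) κ₂ ≤ 2 ^ B * omg A τ e (κ₁ + κ₂) * ((κ₂ : ℝ) + 1) ^ (-2 : ℝ) := by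
  have h0 : (0 : ℝ) < (κ₁ : ℝ) + 1 := by positivity
  have h1 : ((κ₁ : ℝ) + 1) ^ e ≤ 2 ^ B * (((κ₁ + κ₂ : ℕ) : ℝ) + 1) ^ e := by
    rcases le_total 0 e with he0 | he0
    · refine le_trans (Real.rpow_le_rpow h0.le ?_ he0)
        (le_mul_of_one_le_left (by positivity) (Real.one_le_rpow (by norm_num) hB))
      push_cast
      have : (0 : ℝ) ≤ κ₂ := by positivity
      linarith
    · have h2 : ((κ₁ + κ₂ : ℕ) : ℝ) + 1 ≤ 2 * ((κ₁ : ℝ) + 1) := by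
        have : (κ₂ : ℝ) ≤ κ₁ := by exact_mod_cast h
        push_cast
        linarith
      have h3 : (2 * ((κ₁ : ℝ) + 1)) ^ e ≤ (((κ₁ + κ₂ : ℕ) : ℝ) + 1) ^ e :=
        Real.rpow_le_rpow_of_nonpos (by positivity) h2 he0
      rw [Real.mul_rpow (by norm_num) h0.le] at h3
      have h4 : (2 : ℝ) ^ (-B) ≤ 2 ^ e := Real.rpow_le_rpow_of_exponent_le (by norm_num) he
      have h5 : (2 : ℝ) ^ B * 2 ^ (-B) = 1 := by
        rw [← Real.rpow_add (by norm_num), add_neg_cancel, Real.rpow_zero]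
      calc ((κ₁ : ℝ) + 1) ^ e = 2 ^ B * (2 ^ (-B) * ((κ₁ : ℝ) + 1) ^ e) := by
            rw [← mul_assoc, h5, one_mul]
        _ ≤ 2 ^ B * (2 ^ e * ((κ₁ : ℝ) + 1) ^ e) := by gcongr
        _ ≤ _ := by gcongr
  have h2 : ((κ₁ + 1).factorial : ℝ) ^ τ * ((κ₂ + 1).factorial : ℝ) ^ τ ≤
      ((κ₁ + κ₂ + 1).factorial : ℝ) ^ τ := by
    rw [← Real.mul_rpow (by positivity) (by positivity)]
    refine Real.rpow_le_rpow (by positivity) ?_ hτ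
    exact_mod_cast factorial_succ_mul_le κ₁ κ₂
  rw [omg, omg, omg]
  calc _ = A ^ (κ₁ + κ₂) * (((κ₁ + 1).factorial : ℝ) ^ τ * ((κ₂ + 1).factorial : ℝ) ^ τ) *
        ((κ₁ : ℝ) + 1) ^ e * ((κ₂ : ℝ) + 1) ^ (-2 : ℝ) := by rw [pow_add]; ring
    _ ≤ A ^ (κ₁ + κ₂) * ((κ₁ + κ₂ + 1).factorial : ℝ) ^ τ *
        (2 ^ B * (((κ₁ + κ₂ : ℕ) : ℝ) + 1) ^ e) * ((κ₂ : ℝ) + 1) ^ (-2 : ℝ) := by gcongr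
    _ = _ := by ring

theorem sum_omg_le {A τ e B : ℝ} (hA : 0 ≤ A) (hτ : 0 ≤ τ) (hB : 0 ≤ B) (he : -B ≤ e) (κ : ℕ) :
    ∑ x ∈ Finset.HasAntidiagonal.antidiagonal κ,
      (if x.2 ≤ x.1 then omg A τ e x.1 * omg A τ (-2) x.2
        else omg A τ (-2) x.1 * omg A τ e x.2) ≤ convConst B * omg A τ e κ := by
  have hS := summable_inv_sq
  set f : ℕ → ℝ := fun n => ((n : ℝ) + 1) ^ (-2 : ℝ) with hf
  have hf0 : ∀ n, 0 ≤ f n := fun n => by positivity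
  have hω := omg_nonneg hA τ e κ
  calc _ ≤ ∑ x ∈ Finset.HasAntidiagonal.antidiagonal κ,
        2 ^ B * omg A τ e κ * (f x.1 + f x.2) := by
        refine Finset.sum_le_sum fun x hx => ?_
        have hx' : x.1 + x.2 = κ := Finset.HasAntidiagonal.mem_antidiagonal.1 hx
        have hc : 0 ≤ 2 ^ B * omg A τ e κ := by positivity
        split_ifs with h
        · have := omg_mul_le hA hτ hB he h
          rw [hx'] at this
          refine this.trans (mul_le_mul_of_nonneg_left ?_ hc)
          exact le_add_of_nonneg_left (hf0 _)
        · have := omg_mul_le hA hτ hB he (not_le.1 h).le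
          rw [add_comm, hx'] at this
          rw [mul_comm (omg A τ (-2) x.1)]
          refine this.trans (mul_le_mul_of_nonneg_left ?_ hc)
          exact le_add_of_nonneg_right (hf0 _)
    _ = 2 ^ B * omg A τ e κ * (∑ n ∈ Finset.range (κ + 1), f n +
          ∑ n ∈ Finset.range (κ + 1), f (κ - n)) := by
        rw [← Finset.mul_sum, Finset.sum_add_distrib,
          Finset.Nat.sum_antidiagonal_eq_sum_range_succ_mk,
          Finset.Nat.sum_antidiagonal_eq_sum_range_succ_mk]
    _ = 2 ^ B * omg A τ e κ * (2 * ∑ n ∈ Finset.range (κ + 1), f n) := by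
        have := Finset.sum_range_reflect f (κ + 1)
        rw [two_mul, ← this]
        simp only [Nat.add_sub_cancel]
    _ ≤ 2 ^ B * omg A τ e κ * (2 * ∑' n, f n) := by
        have := hS.sum_le_tsum (Finset.range (κ + 1)) fun n _ => hf0 n
        gcongr
    _ = _ := by rw [convConst]; ring

/-! ### Majorants in `(t, x)` -/

theorem Maj.sum {σ R : ℝ} {N : ℕ} {ι : Type*} (s : Finset ι) {b : ι → ℝ} {f : ι → ℂ⟦X⟧}
    (h : ∀ i ∈ s, Maj σ R N (b i) (f i)) : Maj σ R N (∑ i ∈ s, b i) (∑ i ∈ s, f i) := fun l => by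
  rw [map_sum, Finset.sum_mul]
  exact (norm_sum_le _ _).trans (Finset.sum_le_sum fun i hi => h i hi l)

/-- The coefficients of `x^μ v` up to order `K` in `t` are majorized, with growth exponent `e`. -/
def Good (σ R A τ : ℝ) (L K N : ℕ) (b : ℝ) (μ : ℕ) (e : ℝ) (v : ℂ⟦X⟧⟦X⟧) : Prop :=
  ∀ κ < K, Maj σ R (L * κ + N) (b * (R ^ μ)⁻¹ * omg A τ e κ)
    (PowerSeries.X ^ μ * PowerSeries.coeff κ v)

section Good

variable {σ R A τ B : ℝ} {L K : ℕ} (hσ : 1 ≤ σ) (hR : 0 < R) (hA : 0 ≤ A) (hτ : 0 ≤ τ)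
  (hB : 0 ≤ B)
include hσ hR hA hτ hB

/-- In each product of coefficients the factor of higher order in t takes both x^μ and the exponent
e; the other one is used with exponent -2. The loss of derivatives is thus counted once, which is
why m_{ν,μ} is a maximum over the factors and not a sum. -/
theorem Good.mul {N₁ N₂ : ℕ} {b₁ b₂ e : ℝ} {μ : ℕ} {v₁ v₂ : ℂ⟦X⟧⟦X⟧} (he : -B ≤ e)
    (hb₁ : 0 ≤ b₁) (hb₂ : 0 ≤ b₂)
    (h₁ : Good σ R A τ L K N₁ b₁ μ e v₁) (h₁' : Good σ R A τ L K N₁ b₁ 0 (-2) v₁)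
    (h₂ : Good σ R A τ L K N₂ b₂ μ e v₂) (h₂' : Good σ R A τ L K N₂ b₂ 0 (-2) v₂) :
    Good σ R A τ L K (N₁ + N₂) (convConst B * b₁ * b₂) μ e (v₁ * v₂) := by
  intro κ hκ
  have hsum := Maj.sum (σ := σ) (R := R) (N := L * κ + (N₁ + N₂))
    (Finset.HasAntidiagonal.antidiagonal κ)
    (b := fun x => b₁ * b₂ * (R ^ μ)⁻¹ * (if x.2 ≤ x.1 then omg A τ e x.1 * omg A τ (-2) x.2
        else omg A τ (-2) x.1 * omg A τ e x.2))
    (f := fun x => PowerSeries.X ^ μ * (PowerSeries.coeff x.1 v₁ * PowerSeries.coeff x.2 v₂))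
    fun x hx => ?_
  · rw [PowerSeries.coeff_mul, Finset.mul_sum]
    refine hsum.mono_const hR ?_
    rw [← Finset.mul_sum]
    refine (mul_le_mul_of_nonneg_left (sum_omg_le hA hτ hB he κ) (by positivity)).trans
      (le_of_eq (by ring))
  · have hx' : x.1 + x.2 = κ := Finset.HasAntidiagonal.mem_antidiagonal.1 hx
    have hN : L * κ + (N₁ + N₂) = (L * x.1 + N₁) + (L * x.2 + N₂) := by rw [← hx']; ring
    have hw : ∀ e κ, 0 ≤ omg A τ e κ := omg_nonneg hA τ
    have hw1 := hw e x.1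
    have hw2 := hw e x.2
    have hw3 := hw (-2) x.1
    have hw4 := hw (-2) x.2
    have g₁ := h₁ x.1 (by omega)
    have g₁' := h₁' x.1 (by omega)
    have g₂ := h₂ x.2 (by omega)
    have g₂' := h₂' x.2 (by omega)
    rw [pow_zero, pow_zero, inv_one, one_mul, mul_one] at g₁' g₂'
    rw [hN]
    split_ifs with h
    · have := Maj.mul hσ hR (by positivity) (by positivity) g₁ g₂'
      rw [← mul_assoc (PowerSeries.X ^ μ)]
      exact this.mono_const hR (le_of_eq (by ring))
    · have := Maj.mul hσ hR (by positivity) (by positivity) g₁' g₂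
      rw [mul_left_comm (PowerSeries.X ^ μ)]
      exact this.mono_const hR (le_of_eq (by ring))

/-- The multiplicative invariant used for products of `n` factors. -/
theorem Good.prod_pow {ι : Type*} (s : Finset ι) (v : ι → ℂ⟦X⟧⟦X⟧) (ν : ι → ℕ) {N : ℕ} {b e : ℝ}
    {μ : ℕ} (he : -B ≤ e) (hB2 : 2 ≤ B) (hb : 0 ≤ b)
    (h : ∀ i ∈ s, 0 < ν i → Good σ R A τ L K N b μ e (v i) ∧ Good σ R A τ L K N b 0 (-2) (v i))
    (hn : 0 < ∑ i ∈ s, ν i) :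
    Good σ R A τ L K ((∑ i ∈ s, ν i) * N) ((convConst B * b) ^ (∑ i ∈ s, ν i)) μ e
      (∏ i ∈ s, v i ^ ν i) := by
  classical
  have hC := one_le_convConst hB
  have hC0 : 0 < convConst B := by linarith
  set c := convConst B with hc
  -- Dividing by c makes the constants multiplicative, c (X/c)(Y/c) = XY/c. The empty product is
  -- kept apart because it need not satisfy the bound with constant 1/c.
  let Q : ℕ → ℂ⟦X⟧⟦X⟧ → Prop := fun n w => (n = 0 → w = 1) ∧ (0 < n →
    Good σ R A τ L K (n * N) ((c * b) ^ n / c) μ e w ∧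
      Good σ R A τ L K (n * N) ((c * b) ^ n / c) 0 (-2) w)
  have hQmul : ∀ n₁ n₂ w₁ w₂, Q n₁ w₁ → Q n₂ w₂ → Q (n₁ + n₂) (w₁ * w₂) := by
    intro n₁ n₂ w₁ w₂ q₁ q₂
    rcases Nat.eq_zero_or_pos n₁ with rfl | hn₁
    · rwa [q₁.1 rfl, one_mul, zero_add]
    rcases Nat.eq_zero_or_pos n₂ with rfl | hn₂
    · rwa [q₂.1 rfl, mul_one, add_zero]
    refine ⟨fun h0 => by omega, fun _ => ?_⟩
    have e1 : c * ((c * b) ^ n₁ / c) * ((c * b) ^ n₂ / c) = (c * b) ^ (n₁ + n₂) / c := by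
      rw [pow_add]; field_simp
    rw [add_mul, ← e1]
    obtain ⟨a1, a2⟩ := q₁.2 hn₁
    obtain ⟨b1, b2⟩ := q₂.2 hn₂
    exact ⟨Good.mul hσ hR hA hτ hB he (by positivity) (by positivity) a1 a2 b1 b2,
      Good.mul hσ hR hA hτ hB (by linarith) (by positivity) (by positivity) a2 a2 b2 b2⟩
  have hQone : ∀ w, Good σ R A τ L K N b μ e w ∧ Good σ R A τ L K N b 0 (-2) w → Q 1 w := by
    intro w hw
    refine ⟨fun h0 => by omega, fun _ => ?_⟩
    rw [one_mul, pow_one, mul_div_cancel_left₀ _ hC0.ne']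
    exact hw
  have hQpow : ∀ w, Q 1 w → ∀ n, Q n (w ^ n) := by
    intro w hw n
    induction n with
    | zero => exact ⟨fun _ => pow_zero w, fun h0 => by omega⟩
    | succ n ih => rw [pow_succ]; exact hQmul _ _ _ _ ih hw
  have hQ : Q (∑ i ∈ s, ν i) (∏ i ∈ s, v i ^ ν i) := by
    clear hn
    induction s using Finset.induction_on with
    | empty => exact ⟨fun _ => rfl, fun h0 => by simp at h0⟩
    | insert a s ha ih =>
      rw [Finset.sum_insert ha, Finset.prod_insert ha]
      refine hQmul _ _ _ _ ?_ (ih fun i hi => h i (Finset.mem_insert_of_mem hi))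
      rcases Nat.eq_zero_or_pos (ν a) with h0 | h0
      · rw [h0, pow_zero]
        exact ⟨fun _ => rfl, fun h0 => by omega⟩
      · exact hQpow _ (hQone _ (h a (Finset.mem_insert_self a s) h0)) _
  intro κ hκ
  refine ((hQ.2 hn).1 κ hκ).mono_const hR ?_
  have := omg_nonneg hA τ e κ
  gcongr
  exact div_le_self (by positivity) hC

end Good

/-- For n ≥ r the quotient n^r / [n]_r is largest at n = r, where it equals r^r / r! ≤ e^r. -/
theorem pow_mul_factorial_le {n r : ℕ} (h : r ≤ n) :
    (n : ℝ) ^ r * ((n - r).factorial : ℝ) ≤ Real.exp 1 ^ r * (n.factorial : ℝ) := by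
  have h1 : n ^ r * r.factorial ≤ n.descFactorial r * r ^ r := by
    rw [← Nat.descFactorial_self r, Nat.descFactorial_eq_prod_range,
      Nat.descFactorial_eq_prod_range]
    have e1 : ∀ a : ℕ, a ^ r = ∏ _i ∈ Finset.range r, a := by intro a; simp
    rw [e1 n, e1 r, ← Finset.prod_mul_distrib, ← Finset.prod_mul_distrib]
    refine Finset.prod_le_prod' fun i hi => ?_
    have hi' := Finset.mem_range.1 hi
    obtain ⟨a, rfl⟩ := Nat.exists_eq_add_of_le hi'.le
    obtain ⟨b, rfl⟩ := Nat.exists_eq_add_of_le h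
    rw [Nat.add_sub_cancel_left, show i + a + b - i = a + b by omega]
    nlinarith [Nat.zero_le (i * b)]
  have h2 : (r : ℝ) ^ r ≤ Real.exp 1 ^ r * r.factorial := by
    have := Real.pow_div_factorial_le_exp (r : ℝ) (by positivity) r
    rw [div_le_iff₀ (by positivity)] at this
    rwa [← Real.exp_nat_mul, mul_one]
  have h3 : ((n - r).factorial : ℝ) * n.descFactorial r = n.factorial := by
    exact_mod_cast Nat.factorial_mul_descFactorial h
  have h4 : (n : ℝ) ^ r * r.factorial ≤ n.descFactorial r * (r : ℝ) ^ r := by exact_mod_cast h1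
  have hr : (0 : ℝ) < r.factorial := by exact_mod_cast r.factorial_pos
  have h5 : (n : ℝ) ^ r ≤ n.descFactorial r * Real.exp 1 ^ r := by
    refine le_of_mul_le_mul_right ?_ hr
    calc _ ≤ n.descFactorial r * (r : ℝ) ^ r := h4
      _ ≤ n.descFactorial r * (Real.exp 1 ^ r * r.factorial) := by gcongr
      _ = _ := by ring
  calc _ ≤ n.descFactorial r * Real.exp 1 ^ r * ((n - r).factorial : ℝ) := by gcongr
    _ = _ := by rw [← h3]; ring

/-- Lowering the order in t by r lowers the factorial weight enough to absorb (κ+1)^(τr), up to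
e^(τr). What remains is (κ+1)^m, returned by the symbol, and A^(-r), which makes the term small. -/
theorem omg_sub_le {A τ B : ℝ} (hA : 0 < A) (hτ : 0 ≤ τ) (hB : 0 ≤ B) (m : ℕ) {r κ : ℕ}
    (h : r ≤ κ) : omg A τ (m + τ * r - B) (κ - r) ≤
      (2 ^ B * Real.exp 1 ^ τ / A) ^ r * (((κ : ℝ) + 1) ^ m * omg A τ (-B) κ) := by
  obtain ⟨a, rfl⟩ := Nat.exists_eq_add_of_le' h
  rw [Nat.add_sub_cancel]
  have ha : (0 : ℝ) < (a : ℝ) + 1 := by positivity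
  have hk : (0 : ℝ) < ((a + r : ℕ) : ℝ) + 1 := by positivity
  have hak : (a : ℝ) + 1 ≤ ((a + r : ℕ) : ℝ) + 1 := by
    push_cast
    have : (0 : ℝ) ≤ r := by positivity
    linarith
  have h1 : ((a : ℝ) + 1) ^ (-B) ≤ (2 ^ B) ^ r * (((a + r : ℕ) : ℝ) + 1) ^ (-B) := by
    have h2 : ((a + r : ℕ) : ℝ) + 1 ≤ 2 ^ r * ((a : ℝ) + 1) := by
      have h3 : ((r : ℝ) + 1) ≤ 2 ^ r := by
        have := one_add_mul_le_pow (show (-2 : ℝ) ≤ 1 by norm_num) r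
        norm_num at this
        linarith
      push_cast
      have : (0 : ℝ) ≤ r := by positivity
      have : (0 : ℝ) ≤ a := by positivity
      nlinarith
    have h4 := Real.rpow_le_rpow_of_nonpos hk h2 (by linarith : -B ≤ 0)
    rw [Real.mul_rpow (by positivity) ha.le] at h4
    have h5 : ((2 : ℝ) ^ B) ^ r * ((2 : ℝ) ^ r) ^ (-B) = 1 := by
      rw [← Real.rpow_natCast, ← Real.rpow_natCast, ← Real.rpow_mul (by norm_num),
        ← Real.rpow_mul (by norm_num), ← Real.rpow_add (by norm_num)]
      rw [show B * r + r * -B = 0 by ring, Real.rpow_zero]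
    calc ((a : ℝ) + 1) ^ (-B) = (2 ^ B) ^ r * ((2 ^ r) ^ (-B) * ((a : ℝ) + 1) ^ (-B)) := by
          rw [← mul_assoc, h5, one_mul]
      _ ≤ _ := by gcongr
  have h2 : ((a + 1).factorial : ℝ) ^ τ * ((((a + r : ℕ) : ℝ) + 1) ^ r) ^ τ ≤
      (Real.exp 1 ^ τ) ^ r * ((a + r + 1).factorial : ℝ) ^ τ := by
    have h3 := pow_mul_factorial_le (show r ≤ a + r + 1 by omega)
    rw [show a + r + 1 - r = a + 1 by omega] at h3
    have e1 : (Real.exp 1 ^ τ) ^ r = (Real.exp 1 ^ r) ^ τ := by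
      rw [← Real.rpow_natCast, ← Real.rpow_natCast, ← Real.rpow_mul (by positivity),
        ← Real.rpow_mul (by positivity), mul_comm]
    rw [e1, ← Real.mul_rpow (by positivity) (by positivity),
      ← Real.mul_rpow (by positivity) (by positivity)]
    refine Real.rpow_le_rpow (by positivity) ?_ hτ
    push_cast at h3 ⊢
    linarith
  have h3 : ((a : ℝ) + 1) ^ ((m : ℝ) + τ * r - B) ≤ (((a + r : ℕ) : ℝ) + 1) ^ m *
      ((((a + r : ℕ) : ℝ) + 1) ^ r) ^ τ * ((2 ^ B) ^ r * (((a + r : ℕ) : ℝ) + 1) ^ (-B)) := by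
    rw [sub_eq_add_neg, Real.rpow_add ha, Real.rpow_add ha, Real.rpow_natCast, mul_comm τ,
      Real.rpow_mul ha.le, Real.rpow_natCast]
    gcongr
  rw [omg, omg]
  have eA : A ^ a = A ^ (a + r) / A ^ r := by rw [pow_add]; field_simp
  calc A ^ a * ((a + 1).factorial : ℝ) ^ τ * ((a : ℝ) + 1) ^ ((m : ℝ) + τ * r - B)
      ≤ A ^ a * ((a + 1).factorial : ℝ) ^ τ * ((((a + r : ℕ) : ℝ) + 1) ^ m *
      ((((a + r : ℕ) : ℝ) + 1) ^ r) ^ τ * ((2 ^ B) ^ r * (((a + r : ℕ) : ℝ) + 1) ^ (-B))) := by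
        gcongr
    _ = A ^ a * (((a + 1).factorial : ℝ) ^ τ * ((((a + r : ℕ) : ℝ) + 1) ^ r) ^ τ) *
        ((((a + r : ℕ) : ℝ) + 1) ^ m * ((2 ^ B) ^ r * (((a + r : ℕ) : ℝ) + 1) ^ (-B))) := by ring
    _ ≤ A ^ a * ((Real.exp 1 ^ τ) ^ r * ((a + r + 1).factorial : ℝ) ^ τ) *
        ((((a + r : ℕ) : ℝ) + 1) ^ m * ((2 ^ B) ^ r * (((a + r : ℕ) : ℝ) + 1) ^ (-B))) := by gcongr
    _ = _ := by
        rw [eA, div_pow, mul_pow]; ring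

theorem Maj.smul {σ R : ℝ} {N : ℕ} {b : ℝ} {f : ℂ⟦X⟧} (h : Maj σ R N b f) (z : ℂ) :
    Maj σ R N (‖z‖ * b) (z • f) := fun l => by
  rw [PowerSeries.coeff_smul, norm_smul, mul_assoc]
  exact mul_le_mul_of_nonneg_left (h l) (norm_nonneg _)

namespace Equation

variable (E : Equation)

/-! ### The index `s₀` -/

/-- The loss `j + max {α, μ + σ₀ (α - μ)}` of the operator `x^μ (t∂_t)^j ∂_x^α`. -/
noncomputable def loss (p : ℕ × ℕ) (μ : ℕ) : ℝ :=
  (p.1 : ℝ) + max (p.2 : ℝ) ((μ : ℝ) + E.sigma0 * ((p.2 : ℝ) - (μ : ℝ)))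

/-- An upper bound for all losses. -/
noncomputable def maxLoss : ℝ := ∑ p : E.M, ((p.1.1 : ℝ) + E.sigma0 * (p.1.2 : ℝ))

theorem max_le_sigma0_mul (α μ : ℕ) :
    max (α : ℝ) ((μ : ℝ) + E.sigma0 * ((α : ℝ) - (μ : ℝ))) ≤ E.sigma0 * α := by
  have hσ := E.one_le_sigma0
  have h1 : (0 : ℝ) ≤ α := by positivity
  have h2 : (0 : ℝ) ≤ μ := by positivity
  exact max_le (by nlinarith) (by nlinarith)

theorem maxLoss_nonneg : 0 ≤ E.maxLoss := by
  have hσ := E.one_le_sigma0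
  exact Finset.sum_nonneg fun _ _ => by positivity

theorem le_maxLoss (p : E.M) : (p.1.1 : ℝ) + E.sigma0 * (p.1.2 : ℝ) ≤ E.maxLoss := by
  have hσ := E.one_le_sigma0
  exact Finset.single_le_sum (f := fun p : E.M => (p.1.1 : ℝ) + E.sigma0 * (p.1.2 : ℝ))
    (fun _ _ => by positivity) (Finset.mem_univ p)

theorem loss_le_maxLoss (p : E.M) (μ : ℕ) : E.loss p.1 μ ≤ E.maxLoss :=
  le_trans (by rw [loss]; exact add_le_add_right (E.max_le_sigma0_mul _ _) _) (E.le_maxLoss p)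

/-- Without this bound the real `sSup` could take its default value 0 and s₀ would control nothing.
-/
theorem bddAbove_s0 : BddAbove (insert 0 {r : ℝ | ∃ μ : ℕ, ∃ q ∈ E.J μ,
    r = (E.mIdx q.2 μ - (E.m : ℝ)) / ((q.1 : ℝ) + ((∑ p, q.2 p : ℕ) : ℝ) - 1)}) := by
  refine ⟨E.maxLoss, ?_⟩
  rintro r (rfl | ⟨μ, q, hq, rfl⟩)
  · exact E.maxLoss_nonneg
  · have h2 : (2 : ℝ) ≤ (q.1 : ℝ) + ((∑ p, q.2 p : ℕ) : ℝ) := by exact_mod_cast hq.1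
    have h3 : E.mIdx q.2 μ ≤ E.maxLoss := by
      refine Real.sSup_le ?_ E.maxLoss_nonneg
      rintro _ ⟨p, _, rfl⟩
      exact E.loss_le_maxLoss p μ
    have h4 := E.maxLoss_nonneg
    rw [div_le_iff₀ (by linarith)]
    have : (0 : ℝ) ≤ E.m := by positivity
    nlinarith

theorem one_le_s0 : 1 ≤ E.s0 :=
  le_add_of_nonneg_right (le_csSup E.bddAbove_s0 (Set.mem_insert _ _))

theorem loss_le {i : ℕ} {ν : E.M → ℕ} {μ : ℕ} (h2 : 2 ≤ i + ∑ p, ν p)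
    (hg : PowerSeries.coeff μ (E.g i ν) ≠ 0) {p : E.M} (hp : 0 < ν p) :
    E.loss p.1 μ ≤ E.m + (E.s0 - 1) * ((i + ∑ p, ν p - 1 : ℕ) : ℝ) := by
  have hn : 1 ≤ ∑ p, ν p :=
    le_trans hp (Finset.single_le_sum (f := ν) (fun _ _ => Nat.zero_le _) (Finset.mem_univ p))
  have hJ : (i, ν) ∈ E.J μ := by
    refine ⟨h2, hn, ?_⟩
    rw [PowerSeries.constantCoeff_iterate_derivative]
    exact mul_ne_zero (by exact_mod_cast μ.factorial_ne_zero) hg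
  have h1 : E.loss p.1 μ ≤ E.mIdx ν μ :=
    le_csSup ⟨E.maxLoss, by rintro _ ⟨p, _, rfl⟩; exact E.loss_le_maxLoss p μ⟩ ⟨p, hp, rfl⟩
  have h3 : (E.mIdx ν μ - (E.m : ℝ)) / ((i : ℝ) + ((∑ p, ν p : ℕ) : ℝ) - 1) ≤ E.s0 - 1 := by
    rw [s0, add_sub_cancel_left]
    exact le_csSup E.bddAbove_s0 (Set.mem_insert_of_mem _ ⟨μ, (i, ν), hJ, rfl⟩)
  have h4 : (2 : ℝ) ≤ (i : ℝ) + ((∑ p, ν p : ℕ) : ℝ) := by exact_mod_cast h2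
  rw [div_le_iff₀ (by linarith)] at h3
  rw [Nat.cast_sub (by omega), Nat.cast_add, Nat.cast_one]
  linarith

theorem le_maxAlpha (p : E.M) : p.1.2 ≤ E.maxAlpha := Finset.le_sup (f := Prod.snd) p.2

/-! ### Majorants for the nonlinear terms -/

/-- The slope of the index of the weights in `x`. -/
def idxSlope : ℕ := 2 * (1 + E.maxAlpha)

/-- The exponent of the correction factor of the weights in `t`. -/
noncomputable def corr : ℝ := E.maxLoss + 2

theorem two_le_corr : 2 ≤ E.corr := le_add_of_nonneg_left E.maxLoss_nonneg

/-- The loss of constants in the estimate of a derivative. -/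
noncomputable def derivConst (R : ℝ) : ℝ :=
  R ^ E.maxAlpha * ((E.idxSlope : ℝ) + 1 + E.maxAlpha) ^ E.maxLoss

theorem one_le_derivConst {R : ℝ} (hR : 1 ≤ R) : 1 ≤ E.derivConst R := by
  refine one_le_mul_of_one_le_of_one_le (one_le_pow₀ hR) (Real.one_le_rpow ?_ E.maxLoss_nonneg)
  have : (0 : ℝ) ≤ E.idxSlope := by positivity
  have : (0 : ℝ) ≤ E.maxAlpha := by positivity
  linarith

/-- The index is linear in κ, so the cost of x^μ ∂_x^α is a power of κ+1. Together with (κ+1)^j it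
is (κ+1)^loss, and the decay (κ+1)^(-corr) stored in the hypothesis on u brings it down to (κ+1)^e.
-/
theorem good_derivTerm {R A τ D : ℝ} (hR : 1 ≤ R) (hA : 0 ≤ A) (hD : 0 ≤ D) {K : ℕ}
    {u : ℂ⟦X⟧⟦X⟧} (hu : ∀ κ < K, Maj E.sigma0 R (E.idxSlope * κ + 1) (D * omg A τ (-E.corr) κ)
      (PowerSeries.coeff (κ + 1) u)) (p : E.M) (μ : ℕ) {e : ℝ} (he : E.loss p.1 μ ≤ e + E.corr) :
    Good E.sigma0 R A τ E.idxSlope K (1 + E.maxAlpha) (D * E.derivConst R) μ e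
      (shift (tDt^[p.1.1] (Dx^[p.1.2] u))) := by
  intro κ hκ
  have hσ := E.one_le_sigma0
  have hR0 : 0 < R := by linarith
  set ε : ℝ := max (p.1.2 : ℝ) ((μ : ℝ) + E.sigma0 * ((p.1.2 : ℝ) - (μ : ℝ))) with hε
  have hε0 : 0 ≤ ε := le_max_of_le_left (by positivity)
  have hεm : ε ≤ E.maxLoss := by
    have h1 := E.loss_le_maxLoss p μ
    rw [loss] at h1
    have h2 : (0 : ℝ) ≤ p.1.1 := by positivity
    linarith
  have hω := omg_nonneg hA τ (-E.corr) κ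
  have hωe := omg_nonneg hA τ e κ
  have h1 := ((hu κ hκ).X_pow_mul_deriv hσ hR0 (by omega) (by positivity) μ p.1.2).smul
    (((κ + 1 : ℕ) : ℂ) ^ p.1.1)
  rw [shift, PowerSeries.coeff_mk, coeff_tDt_iter, coeff_Dx_iter, mul_smul_comm]
  have hα : (p.1.2 : ℝ) ≤ E.maxAlpha := by exact_mod_cast E.le_maxAlpha p
  refine (h1.mono_index hσ hR0 (show E.idxSlope * κ + 1 + p.1.2 ≤
    E.idxSlope * κ + (1 + E.maxAlpha) by have := E.le_maxAlpha p; omega)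
    (by positivity)).mono_const hR0 ?_
  rw [norm_pow, Complex.norm_natCast, ← hε]
  have hκ0 : (0 : ℝ) ≤ κ := by positivity
  have hκ1 : (0 : ℝ) < (κ : ℝ) + 1 := by positivity
  set Q : ℝ := (E.idxSlope : ℝ) + 1 + E.maxAlpha with hQ
  have hQ1 : 1 ≤ Q := by
    have : (0 : ℝ) ≤ E.idxSlope := by positivity
    have : (0 : ℝ) ≤ E.maxAlpha := by positivity
    rw [hQ]
    linarith
  have h2 : (((E.idxSlope * κ + 1 : ℕ) : ℝ) + p.1.2) ^ ε ≤ Q ^ E.maxLoss * ((κ : ℝ) + 1) ^ ε := by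
    calc _ ≤ (Q * ((κ : ℝ) + 1)) ^ ε := by
          refine Real.rpow_le_rpow (by positivity) ?_ hε0
          rw [hQ]
          push_cast
          have : (0 : ℝ) ≤ E.idxSlope := by positivity
          have : (0 : ℝ) ≤ E.maxAlpha := by positivity
          nlinarith
      _ = Q ^ ε * ((κ : ℝ) + 1) ^ ε := Real.mul_rpow (by linarith) hκ1.le
      _ ≤ _ := by gcongr
  have h3 : ((κ + 1 : ℕ) : ℝ) ^ p.1.1 * ((κ : ℝ) + 1) ^ ε * omg A τ (-E.corr) κ ≤ omg A τ e κ := by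
    have h4 : ((κ : ℝ) + 1) ^ ((p.1.1 : ℝ) + ε + -E.corr) ≤ ((κ : ℝ) + 1) ^ e := by
      refine Real.rpow_le_rpow_of_exponent_le (by linarith) ?_
      rw [loss] at he
      linarith
    rw [Real.rpow_add hκ1, Real.rpow_add hκ1, Real.rpow_natCast] at h4
    rw [omg, omg]
    push_cast
    calc _ = A ^ κ * ((κ + 1).factorial : ℝ) ^ τ *
          (((κ : ℝ) + 1) ^ p.1.1 * ((κ : ℝ) + 1) ^ ε * ((κ : ℝ) + 1) ^ (-E.corr)) := by ring
      _ ≤ _ := by gcongr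
  have h5 : R ^ p.1.2 ≤ R ^ E.maxAlpha := pow_le_pow_right₀ hR (E.le_maxAlpha p)
  calc ((κ + 1 : ℕ) : ℝ) ^ p.1.1 * (D * omg A τ (-E.corr) κ * R ^ p.1.2 *
        (((E.idxSlope * κ + 1 : ℕ) : ℝ) + p.1.2) ^ ε * (R ^ μ)⁻¹)
      ≤ ((κ + 1 : ℕ) : ℝ) ^ p.1.1 * (D * omg A τ (-E.corr) κ * R ^ E.maxAlpha *
        (Q ^ E.maxLoss * ((κ : ℝ) + 1) ^ ε) * (R ^ μ)⁻¹) := by gcongr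
    _ = D * (R ^ E.maxAlpha * Q ^ E.maxLoss) * (R ^ μ)⁻¹ *
        (((κ + 1 : ℕ) : ℝ) ^ p.1.1 * ((κ : ℝ) + 1) ^ ε * omg A τ (-E.corr) κ) := by ring
    _ ≤ _ := by rw [derivConst]; gcongr

/-- The two exponents needed for the product rule come from different sources: with x^μ, the
definition of s₀ bounds the loss by m+(s₀-1)r; without it, `corr` exceeds every loss by 2, which
leaves -2. -/
theorem norm_coeff_shiftProd_le {R A D : ℝ} (hR : 1 ≤ R) (hA : 0 ≤ A) (hD : 1 ≤ D) {κ : ℕ}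
    {u : ℂ⟦X⟧⟦X⟧} (hu : ∀ κ' < κ, Maj E.sigma0 R (E.idxSlope * κ' + 1)
      (D * omg A (E.s0 - 1) (-E.corr) κ') (PowerSeries.coeff (κ' + 1) u)) {i : ℕ} {ν : E.M → ℕ}
    {μ r : ℕ} (h2 : 2 ≤ i + ∑ p, ν p) (hr : i + ∑ p, ν p = r + 1) (hrκ : r ≤ κ)
    (hg : PowerSeries.coeff μ (E.g i ν) ≠ 0) :
    Maj E.sigma0 R (E.idxSlope * κ + 1) ((convConst E.corr * (D * E.derivConst R)) ^ (2 * r) *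
      (R ^ μ)⁻¹ * omg A (E.s0 - 1) (E.m + (E.s0 - 1) * r - E.corr) (κ - r))
      (PowerSeries.X ^ μ * PowerSeries.coeff (κ - r) (E.shiftProd u ν)) := by
  have hσ := E.one_le_sigma0
  have hR0 : 0 < R := by linarith
  have hτ : 0 ≤ E.s0 - 1 := by linarith [E.one_le_s0]
  have hB := E.two_le_corr
  have hβ := E.one_le_derivConst hR
  have hC := one_le_convConst (by linarith : 0 ≤ E.corr)
  have hCD : 1 ≤ convConst E.corr * (D * E.derivConst R) :=
    one_le_mul_of_one_le_of_one_le hC (one_le_mul_of_one_le_of_one_le hD hβ)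
  have hω := omg_nonneg hA (E.s0 - 1) (E.m + (E.s0 - 1) * r - E.corr) (κ - r)
  rcases Nat.eq_zero_or_pos (∑ p, ν p) with hn | hn
  · have hν : ∀ p, ν p = 0 := fun p => by
      have := Finset.single_le_sum (f := ν) (fun _ _ => Nat.zero_le _) (Finset.mem_univ p)
      omega
    have h1 : E.shiftProd u ν = 1 := Finset.prod_eq_one fun p _ => by rw [hν, pow_zero]
    rw [h1, PowerSeries.coeff_one]
    split_ifs with h0
    · intro l
      rw [mul_one, PowerSeries.coeff_X_pow]
      rw [h0, omg]
      have hw := one_le_wt hσ (show 1 ≤ E.idxSlope * κ + 1 by omega) l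
      split_ifs with hl
      · subst hl
        have h3 : (1 : ℝ) ≤ (convConst E.corr * (D * E.derivConst R)) ^ (2 * r) := one_le_pow₀ hCD
        have h4 : (convConst E.corr * (D * E.derivConst R)) ^ (2 * r) * (R ^ l)⁻¹ * (A ^ 0 *
            ((0 + 1).factorial : ℝ) ^ (E.s0 - 1) *
            (((0 : ℕ) : ℝ) + 1) ^ ((E.m : ℝ) + (E.s0 - 1) * r - E.corr)) *
            (R ^ l * wt E.sigma0 (E.idxSlope * κ + 1) l) =
            (convConst E.corr * (D * E.derivConst R)) ^ (2 * r) *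
              wt E.sigma0 (E.idxSlope * κ + 1) l := by
          simp
          field_simp
        rw [h4, norm_one]
        exact one_le_mul_of_one_le_of_one_le h3 hw
      · rw [norm_zero]
        have : 0 ≤ convConst E.corr * (D * E.derivConst R) := by linarith
        positivity
    · rw [mul_zero]
      refine Maj.zero hR0 _ ?_
      have : 0 ≤ convConst E.corr * (D * E.derivConst R) := by linarith
      positivity
  · have hκ : κ - r < κ := by omega
    have hmr : 0 ≤ (E.m : ℝ) + (E.s0 - 1) * r := by positivity
    have h1 := Good.prod_pow hσ hR0 hA hτ (by linarith : 0 ≤ E.corr) (L := E.idxSlope) (K := κ)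
      Finset.univ (fun p : E.M => shift (tDt^[p.1.1] (Dx^[p.1.2] u))) ν (N := 1 + E.maxAlpha)
      (b := D * E.derivConst R) (e := E.m + (E.s0 - 1) * r - E.corr) (μ := μ) (by linarith)
      hB (by positivity) (fun p _ hp => ⟨E.good_derivTerm hR hA (by linarith) hu p μ (by
        have := E.loss_le h2 hg hp
        rw [hr, Nat.add_sub_cancel] at this
        linarith), E.good_derivTerm hR hA (by linarith) hu p 0 (by
        have := E.loss_le_maxLoss p 0
        rw [corr]
        linarith)⟩) hn (κ - r) hκ
    refine (h1.mono_index hσ hR0 ?_ (by positivity)).mono_const hR0 ?_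
    -- The drop by r in the order frees 2r(1+maxAlpha) in the index, enough for the |ν| ≤ r+1 ≤ 2r
    -- factors.
    · obtain ⟨a, rfl⟩ := Nat.exists_eq_add_of_le' hrκ
      rw [Nat.add_sub_cancel, idxSlope]
      have : (∑ p, ν p) * (1 + E.maxAlpha) ≤ 2 * r * (1 + E.maxAlpha) :=
        Nat.mul_le_mul_right _ (by omega)
      nlinarith
    · gcongr
      omega

end Equation
-- Sufficiency: closing the majorant induction.
namespace Equation

variable (E : Equation)

/-- Convergence of `G₂` in a polydisc of radius at most one. -/
theorem exists_summable_g : ∃ ρ : ℝ, 0 < ρ ∧ ρ ≤ 1 ∧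
    Summable fun q : (ℕ × (E.M → ℕ)) × ℕ =>
      ‖PowerSeries.coeff q.2 (E.g q.1.1 q.1.2)‖ * ρ ^ (q.1.1 + (∑ p, q.1.2 p) + q.2) := by
  obtain ⟨r, hr, hs⟩ := E.g_conv
  refine ⟨min r 1, lt_min hr one_pos, min_le_right _ _, ?_⟩
  have hs' := (Equiv.prodAssoc ℕ (E.M → ℕ) ℕ).summable_iff.2 hs
  have hm : 0 ≤ min r 1 := (lt_min hr one_pos).le
  refine Summable.of_nonneg_of_le (fun q => by positivity) (fun q => ?_) hs'
  exact mul_le_mul_of_nonneg_left (pow_le_pow_left₀ hm (min_le_left _ _) _) (norm_nonneg _)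

/-- The Taylor coefficients of g_{i,ν} are treated one by one, because the admissible loss depends
on the power x^μ. Each keeps its weight in the convergent series for G₂ together with a factor
H/(Aρ²) that A can make small. -/
theorem maj_term {R A D ρ H : ℝ} (hR : 1 ≤ R) (hA : 0 < A) (hD : 1 ≤ D) (hρ : 0 < ρ) (hρ1 : ρ ≤ 1)
    (hRρ : 1 ≤ R * ρ) (hH : (convConst E.corr * (D * E.derivConst R)) ^ 2 *
      (2 ^ E.corr * Real.exp 1 ^ (E.s0 - 1)) ≤ H) (hHA : H ≤ A * ρ ^ 2) {κ : ℕ}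
    {u : ℂ⟦X⟧⟦X⟧} (hu0 : PowerSeries.coeff 0 u = 0)
    (hu : ∀ κ' < κ, Maj E.sigma0 R (E.idxSlope * κ' + 1)
      (D * omg A (E.s0 - 1) (-E.corr) κ') (PowerSeries.coeff (κ' + 1) u)) (i : ℕ) (ν : E.M → ℕ)
    (l : ℕ) :
    ‖PowerSeries.coeff l (PowerSeries.coeff (κ + 1) (E.term u i ν))‖ ≤
      (∑ μ ∈ Finset.range (l + 1), ‖PowerSeries.coeff μ (E.g i ν)‖ *
        ρ ^ (i + (∑ p, ν p) + μ)) * (H / (A * ρ ^ 2) *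
          (((κ : ℝ) + 1) ^ E.m * omg A (E.s0 - 1) (-E.corr) κ) *
            (R ^ l * wt E.sigma0 (E.idxSlope * κ + 1) l)) := by
  have hτ : 0 ≤ E.s0 - 1 := by linarith [E.one_le_s0]
  have hB := E.two_le_corr
  have hω := omg_nonneg hA.le (E.s0 - 1) (-E.corr) κ
  have hH0 : 0 ≤ H := le_trans (by positivity) hH
  have hRHS : 0 ≤ H / (A * ρ ^ 2) * (((κ : ℝ) + 1) ^ E.m * omg A (E.s0 - 1) (-E.corr) κ) *
      (R ^ l * wt E.sigma0 (E.idxSlope * κ + 1) l) := by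
    have := wt_nonneg E.sigma0 (E.idxSlope * κ + 1) l
    positivity
  have hzero : (0 : ℝ) ≤ (∑ μ ∈ Finset.range (l + 1), ‖PowerSeries.coeff μ (E.g i ν)‖ *
        ρ ^ (i + (∑ p, ν p) + μ)) * (H / (A * ρ ^ 2) *
          (((κ : ℝ) + 1) ^ E.m * omg A (E.s0 - 1) (-E.corr) κ) *
            (R ^ l * wt E.sigma0 (E.idxSlope * κ + 1) l)) :=
    mul_nonneg (Finset.sum_nonneg fun _ _ => by positivity) hRHS
  rw [E.coeff_term hu0]
  split_ifs with hk
  swap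
  · rwa [map_zero, norm_zero]
  by_cases h2 : i + ∑ p, ν p < 2
  · rw [E.g_low i ν h2, zero_mul, map_zero, norm_zero]
    simp
  push Not at h2
  obtain ⟨r, hr⟩ : ∃ r, i + ∑ p, ν p = r + 1 := ⟨i + ∑ p, ν p - 1, by omega⟩
  have hr1 : 1 ≤ r := by omega
  have hrκ : r ≤ κ := by omega
  rw [hr, Nat.add_sub_add_right, PowerSeries.coeff_mul,
    Finset.Nat.sum_antidiagonal_eq_sum_range_succ_mk, Finset.sum_mul]
  refine (norm_sum_le _ _).trans (Finset.sum_le_sum fun μ hμ => ?_)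
  have hμl : μ ≤ l := by have := Finset.mem_range.1 hμ; omega
  dsimp only
  rw [norm_mul]
  by_cases hg : PowerSeries.coeff μ (E.g i ν) = 0
  · rw [hg]; simp
  rw [mul_assoc]
  refine mul_le_mul_of_nonneg_left ?_ (norm_nonneg _)
  have h1 := E.norm_coeff_shiftProd_le hR hA.le hD hu h2 hr hrκ hg l
  rw [PowerSeries.coeff_X_pow_mul', if_pos hμl] at h1
  refine h1.trans ?_
  rw [← mul_assoc (ρ ^ (r + 1 + μ))]
  refine mul_le_mul_of_nonneg_right ?_ (mul_nonneg (by positivity) (wt_nonneg _ _ _))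
  have h3 := omg_sub_le hA hτ (by linarith : 0 ≤ E.corr) E.m hrκ
  set T := convConst E.corr * (D * E.derivConst R) with hT
  set Y := ((κ : ℝ) + 1) ^ E.m * omg A (E.s0 - 1) (-E.corr) κ with hY
  have hY0 : 0 ≤ Y := by positivity
  have hRμ : (R ^ μ)⁻¹ ≤ ρ ^ μ := by
    rw [inv_le_iff_one_le_mul₀' (by positivity), ← mul_pow]
    exact one_le_pow₀ hRρ
  -- One of the r ≥ 1 factors H/(Aρ²) is kept and the others are at most 1; ρ^(2r) ≤ ρ^(r+1)
  -- restores the weight of the monomial.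
  have hHr : (T ^ 2 * (2 ^ E.corr * Real.exp 1 ^ (E.s0 - 1)) / A) ^ r ≤
      H / (A * ρ ^ 2) * ρ ^ (r + 1) := by
    calc (T ^ 2 * (2 ^ E.corr * Real.exp 1 ^ (E.s0 - 1)) / A) ^ r ≤ (H / A) ^ r := by gcongr
      _ = (H / (A * ρ ^ 2)) ^ r * ρ ^ (2 * r) := by
          rw [pow_mul, ← mul_pow]; congr 1; field_simp
      _ ≤ H / (A * ρ ^ 2) * ρ ^ (r + 1) := by
          refine mul_le_mul ?_ (pow_le_pow_of_le_one hρ.le hρ1 (by omega)) (by positivity)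
            (by positivity)
          exact pow_le_of_le_one (by positivity) (by rw [div_le_one (by positivity)]; exact hHA)
            (by omega)
  calc T ^ (2 * r) * (R ^ μ)⁻¹ * omg A (E.s0 - 1) (E.m + (E.s0 - 1) * r - E.corr) (κ - r)
      ≤ T ^ (2 * r) * ρ ^ μ * ((2 ^ E.corr * Real.exp 1 ^ (E.s0 - 1) / A) ^ r * Y) := by
        have hT0 : 0 ≤ T ^ (2 * r) := by rw [pow_mul]; positivity
        have := omg_nonneg hA.le (E.s0 - 1) (E.m + (E.s0 - 1) * r - E.corr) (κ - r)
        gcongr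
    _ = (T ^ 2 * (2 ^ E.corr * Real.exp 1 ^ (E.s0 - 1)) / A) ^ r * (ρ ^ μ * Y) := by
        rw [mul_div_assoc, mul_pow, pow_mul]; ring
    _ ≤ H / (A * ρ ^ 2) * ρ ^ (r + 1) * (ρ ^ μ * Y) := by gcongr
    _ = _ := by rw [pow_add ρ (r + 1) μ]; ring

variable {E}

/-- The constants are fixed in the order R (linear part, a and G₂), D (from a), A. The bound H
depends on R and D only, so a large A makes the whole nonlinear part at most D/4. The source a(x)t
contributes another D/4, and inverting the linear part doubles D/2 back to D. -/
theorem SignCond.exists_maj (hE : E.SignCond) {u : ℂ⟦X⟧⟦X⟧} (hu : E.IsFormalSolution u) :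
    ∃ R A D : ℝ, 1 ≤ R ∧ 1 ≤ A ∧ 1 ≤ D ∧ ∀ κ, Maj E.sigma0 R (E.idxSlope * κ + 1)
      (D * omg A (E.s0 - 1) (-E.corr) κ) (PowerSeries.coeff (κ + 1) u) := by
  have hσ := E.one_le_sigma0
  obtain ⟨hu0, hrec⟩ := (E.isFormalSolution_iff u).1 hu
  obtain ⟨R₁, hR₁, hlin⟩ := hE.exists_maj_of_recursion
  obtain ⟨A₀, R₂, hA₀, hR₂, ha⟩ := E.a_conv.exists_maj hσ
  obtain ⟨ρ, hρ, hρ1, hs⟩ := E.exists_summable_g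
  set S := ∑' q : (ℕ × (E.M → ℕ)) × ℕ,
      ‖PowerSeries.coeff q.2 (E.g q.1.1 q.1.2)‖ * ρ ^ (q.1.1 + (∑ p, q.1.2 p) + q.2) with hS
  have hS0 : 0 ≤ S := tsum_nonneg fun _ => by positivity
  set R := max (max R₁ R₂) ρ⁻¹ with hR
  have hRR₁ : R₁ ≤ R := (le_max_left _ _).trans (le_max_left _ _)
  have hRR₂ : R₂ ≤ R := (le_max_right _ _).trans (le_max_left _ _)
  have hR1 : 1 ≤ R := hR₁.trans hRR₁
  have hR0 : 0 < R := by linarith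
  have hRρ : 1 ≤ R * ρ := by
    rw [← inv_le_iff_one_le_mul₀ hρ]; exact le_max_right _ _
  set D := max 1 (4 * A₀) with hD
  have hD1 : 1 ≤ D := le_max_left _ _
  have hDA : 4 * A₀ ≤ D := le_max_right _ _
  set H := (convConst E.corr * (D * E.derivConst R)) ^ 2 *
      (2 ^ E.corr * Real.exp 1 ^ (E.s0 - 1)) with hH
  have hH0 : 0 ≤ H := by positivity
  set A := max 1 (H * (1 + 4 * S) / ρ ^ 2) with hA
  have hA1 : 1 ≤ A := le_max_left _ _
  have hA0 : 0 < A := by linarith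
  have hHS : H * (1 + 4 * S) ≤ A * ρ ^ 2 := by
    rw [← div_le_iff₀ (by positivity)]; exact le_max_right _ _
  have hHA : H ≤ A * ρ ^ 2 := le_trans (le_mul_of_one_le_right hH0 (by linarith)) hHS
  refine ⟨R, A, D, hR1, hA1, hD1, fun κ => ?_⟩
  induction κ using Nat.strong_induction_on with
  | _ κ ih =>
    set F := D * omg A (E.s0 - 1) (-E.corr) κ / 2 with hF
    have hω := omg_nonneg hA0.le (E.s0 - 1) (-E.corr) κ
    have hF0 : 0 ≤ F := by positivity
    have hFF : D * omg A (E.s0 - 1) (-E.corr) κ = 2 * F := by rw [hF]; ring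
    rw [hFF]
    refine hlin R hRR₁ (κ + 1) (E.idxSlope * κ + 1) (by omega) (by omega) F hF0 _
      (PowerSeries.coeff (κ + 1) (E.rhs u)) (hrec (κ + 1) (by omega)) ?_
    intro l
    have hW := wt_nonneg E.sigma0 (E.idxSlope * κ + 1) l
    set V := R ^ l * wt E.sigma0 (E.idxSlope * κ + 1) l with hV
    have hV0 : 0 ≤ V := by positivity
    set Z := ((κ : ℝ) + 1) ^ E.m * omg A (E.s0 - 1) (-E.corr) κ with hZ
    have hZ0 : 0 ≤ Z := by positivity
    have hlina : ‖PowerSeries.coeff l (PowerSeries.coeff (κ + 1)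
        (PowerSeries.C E.a * PowerSeries.X))‖ ≤ D / 4 * Z * V := by
      rw [PowerSeries.coeff_succ_mul_X, PowerSeries.coeff_C]
      split_ifs with h0
      · subst h0
        have h1 := ha R hRR₂ l
        have h2 : Z = 1 := by rw [hZ, omg]; simp
        rw [h2, mul_one]
        rw [mul_zero, zero_add] at hV
        rw [← hV] at h1
        exact h1.trans (by gcongr; linarith)
      · rw [map_zero, norm_zero]; positivity
    have hnl : ‖PowerSeries.coeff l (PowerSeries.coeff (κ + 1) (E.nonlin u))‖ ≤
        D / 4 * Z * V := by
      rw [nonlin, PowerSeries.coeff_mk,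
        finsum_eq_sum _ (E.support_term_finite u hu0 (κ + 1)), map_sum]
      refine (norm_sum_le _ _).trans ?_
      refine (Finset.sum_le_sum fun q _ => E.maj_term hR1 hA0 hD1 hρ hρ1 hRρ hH.ge hHA hu0
        ih q.1 q.2 l).trans ?_
      rw [← Finset.sum_mul, ← Finset.sum_product']
      have h1 := hs.sum_le_tsum ((E.support_term_finite u hu0 (κ + 1)).toFinset ×ˢ
        Finset.range (l + 1)) fun _ _ => by positivity
      rw [← hS] at h1
      calc _ ≤ S * (H / (A * ρ ^ 2) * Z * V) := by gcongr
        _ = (S * (H / (A * ρ ^ 2))) * (Z * V) := by ring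
        _ ≤ D / 4 * (Z * V) := by
          gcongr
          have h2 : S * (H / (A * ρ ^ 2)) ≤ 1 / 4 := by
            rw [mul_div_assoc', div_le_div_iff₀ (by positivity) (by norm_num)]
            nlinarith
          linarith
        _ = _ := by ring
    rw [rhs, map_add, map_add]
    refine (norm_add_le _ _).trans ((add_le_add hlina hnl).trans (le_of_eq ?_))
    rw [hF, hZ]
    push_cast
    ring

/-- From (N)_l ≤ 2^(N+l) l! with N linear in κ, the weight in x is a geometric factor times
l!^(σ₀-1). The geometric factors are absorbed in the radius. -/
theorem isGevrey_of_maj {R A D s σ : ℝ} (hR : 1 ≤ R) (hA : 1 ≤ A) (hD : 1 ≤ D) (hs : E.s0 ≤ s)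
    (hσ : E.sigma0 ≤ σ) {u : ℂ⟦X⟧⟦X⟧} (hu0 : PowerSeries.coeff 0 u = 0)
    (h : ∀ κ, Maj E.sigma0 R (E.idxSlope * κ + 1)
      (D * omg A (E.s0 - 1) (-E.corr) κ) (PowerSeries.coeff (κ + 1) u)) : IsGevrey s σ u := by
  have hσ1 := E.one_le_sigma0
  have hs1 := E.one_le_s0
  obtain ⟨c, hc⟩ : ∃ c : ℕ, E.sigma0 ≤ c := exists_nat_ge _
  set Γ : ℝ := A * R * 2 ^ (c * (E.idxSlope + 1)) with hΓ
  have hΓ1 : 1 ≤ Γ := one_le_mul_of_one_le_of_one_le (one_le_mul_of_one_le_of_one_le hA hR)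
    (one_le_pow₀ one_le_two)
  have hasc : ∀ N l : ℕ, (1 ≤ N) → ((N.ascFactorial l : ℝ)) ≤ 2 ^ (N + l) * l.factorial := by
    intro N l hN
    obtain ⟨n, rfl⟩ := Nat.exists_eq_add_of_le' hN
    have h1 : (n + 1).ascFactorial l ≤ 2 ^ (n + 1 + l) * l.factorial := by
      rw [Nat.ascFactorial_eq_factorial_mul_choose, mul_comm]
      refine Nat.mul_le_mul_right _ ?_
      exact (Nat.choose_le_two_pow _ _).trans (Nat.pow_le_pow_right (by norm_num) (by omega))
    exact_mod_cast h1
  have hbound : ∀ k l : ℕ, ‖PowerSeries.coeff l (PowerSeries.coeff k u)‖ /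
      ((k.factorial : ℝ) ^ (s - 1) * (l.factorial : ℝ) ^ (σ - 1)) ≤ D * Γ ^ (k + l) := by
    intro k l
    have hkf : (1 : ℝ) ≤ k.factorial := by exact_mod_cast k.factorial_pos
    have hlf : (1 : ℝ) ≤ l.factorial := by exact_mod_cast l.factorial_pos
    rw [div_le_iff₀ (by positivity)]
    cases k with
    | zero => rw [hu0, map_zero, norm_zero]; positivity
    | succ κ =>
      refine (h κ l).trans ?_
      have h1 : omg A (E.s0 - 1) (-E.corr) κ ≤
          A ^ (κ + 1) * ((κ + 1).factorial : ℝ) ^ (s - 1) := by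
        rw [omg]
        have h2 : ((κ : ℝ) + 1) ^ (-E.corr) ≤ 1 :=
          Real.rpow_le_one_of_one_le_of_nonpos (by
            have : (0 : ℝ) ≤ κ := by positivity
            linarith) (by linarith [E.two_le_corr])
        calc _ ≤ A ^ κ * ((κ + 1).factorial : ℝ) ^ (E.s0 - 1) * 1 := by gcongr
          _ ≤ _ := by
            rw [mul_one]
            gcongr
            omega
      have h2 : wt E.sigma0 (E.idxSlope * κ + 1) l ≤
          (2 ^ (c * (E.idxSlope + 1))) ^ (κ + 1 + l) * (l.factorial : ℝ) ^ (σ - 1) := by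
        rw [wt, div_le_iff₀ (by positivity)]
        calc (((E.idxSlope * κ + 1).ascFactorial l : ℕ) : ℝ) ^ E.sigma0
            ≤ (2 ^ (E.idxSlope * κ + 1 + l) * l.factorial) ^ E.sigma0 :=
              Real.rpow_le_rpow (by positivity) (hasc _ _ (by omega)) (by linarith)
          _ = (2 ^ (E.idxSlope * κ + 1 + l)) ^ E.sigma0 * (l.factorial : ℝ) ^ E.sigma0 :=
              Real.mul_rpow (by positivity) (by positivity)
          _ ≤ (2 ^ (c * (E.idxSlope + 1))) ^ (κ + 1 + l) * (l.factorial : ℝ) ^ σ := by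
              refine mul_le_mul ?_ (Real.rpow_le_rpow_of_exponent_le hlf hσ) (by positivity)
                (by positivity)
              calc ((2 : ℝ) ^ (E.idxSlope * κ + 1 + l)) ^ E.sigma0
                  ≤ ((2 : ℝ) ^ (E.idxSlope * κ + 1 + l)) ^ (c : ℝ) :=
                    Real.rpow_le_rpow_of_exponent_le (one_le_pow₀ one_le_two) hc
                _ = 2 ^ ((E.idxSlope * κ + 1 + l) * c) := by rw [Real.rpow_natCast, pow_mul]
                _ ≤ 2 ^ (c * (E.idxSlope + 1) * (κ + 1 + l)) := by
                    refine pow_le_pow_right₀ one_le_two ?_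
                    rw [mul_comm, mul_assoc]
                    refine Nat.mul_le_mul_left _ ?_
                    nlinarith [Nat.zero_le (E.idxSlope * l)]
                _ = _ := by rw [pow_mul]
          _ = _ := by
              have : (l.factorial : ℝ) ^ σ = (l.factorial : ℝ) ^ (σ - 1) * l.factorial := by
                rw [Real.rpow_sub_one (by positivity)]; field_simp
              rw [this]; ring
      have h3 : R ^ l ≤ R ^ (κ + 1 + l) := pow_le_pow_right₀ hR (by omega)
      have h4 : A ^ (κ + 1) ≤ A ^ (κ + 1 + l) := pow_le_pow_right₀ hA (by omega)
      have hw := wt_nonneg E.sigma0 (E.idxSlope * κ + 1) l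
      have hω := omg_nonneg (by linarith : 0 ≤ A) (E.s0 - 1) (-E.corr) κ
      calc D * omg A (E.s0 - 1) (-E.corr) κ * (R ^ l * wt E.sigma0 (E.idxSlope * κ + 1) l)
          ≤ D * (A ^ (κ + 1 + l) * ((κ + 1).factorial : ℝ) ^ (s - 1)) * (R ^ (κ + 1 + l) *
            ((2 ^ (c * (E.idxSlope + 1))) ^ (κ + 1 + l) * (l.factorial : ℝ) ^ (σ - 1))) := by
            refine mul_le_mul (mul_le_mul_of_nonneg_left (h1.trans ?_) (by linarith))
              (mul_le_mul h3 h2 hw (by positivity)) (by positivity) (by positivity)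
            gcongr
        _ = _ := by rw [hΓ, mul_pow, mul_pow]; ring
  clear_value Γ
  refine ⟨(2 * Γ)⁻¹, by positivity, ?_⟩
  have hgeo : Summable fun q : ℕ × ℕ => D * ((1 / 2 : ℝ) ^ q.1 * (1 / 2 : ℝ) ^ q.2) :=
    ((summable_geometric_two.mul_of_nonneg summable_geometric_two (fun _ => by positivity)
      fun _ => by positivity)).mul_left D
  refine Summable.of_nonneg_of_le (fun q => by positivity) (fun q => ?_) hgeo
  refine (mul_le_mul_of_nonneg_right (hbound q.1 q.2) (by positivity)).trans (le_of_eq ?_)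
  rw [← pow_add, inv_pow, mul_pow, one_div, inv_pow]
  field_simp

theorem SignCond.isGevrey (hE : E.SignCond) {u : ℂ⟦X⟧⟦X⟧} (hu : E.IsFormalSolution u) {s σ : ℝ}
    (hs : E.s0 ≤ s) (hσ : E.sigma0 ≤ σ) : IsGevrey s σ u := by
  obtain ⟨R, A, D, hR, hA, hD, h⟩ := hE.exists_maj hu
  exact isGevrey_of_maj hR hA hD hs hσ hu.1 h

end Equation
namespace Equation

/-! ### Lower bounds from the recursion -/

/-- The absolute value of the coefficient of `t^k x^l`. -/
noncomputable def size (u : ℂ⟦X⟧⟦X⟧) (k l : ℕ) : ℝ :=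
  ‖PowerSeries.coeff l (PowerSeries.coeff k u)‖

theorem size_nonneg (u : ℂ⟦X⟧⟦X⟧) (k l : ℕ) : 0 ≤ size u k l := norm_nonneg _

theorem norm_le_of_nonneg_of_le {z w : ℂ} (hz : 0 ≤ z) (h : z ≤ w) : ‖z‖ ≤ ‖w‖ := by
  rwa [← Complex.real_le_real, norm_eq_of_nonneg hz, norm_eq_of_nonneg (hz.trans h)]

theorem coeff_pos_of_iterate_derivative {f : ℂ⟦X⟧} {μ : ℕ}
    (h : 0 < PowerSeries.constantCoeff ((PowerSeries.derivative ℂ)^[μ] f)) :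
    PowerSeries.coeff μ f ≠ 0 := by
  rw [PowerSeries.constantCoeff_iterate_derivative] at h
  intro h0
  rw [h0, mul_zero] at h
  exact lt_irrefl _ h

variable {E : Equation}

namespace SignCond

variable (hE : E.SignCond) {u : ℂ⟦X⟧⟦X⟧} (hu : E.IsFormalSolution u)
include hE hu

/-- All terms of the recursion are nonnegative, so any part of its right-hand side yields a lower
bound for the solution. -/
theorem norm_le_asymb_mul {k l : ℕ} (hk : 1 ≤ k) {z : ℂ} (hz : 0 ≤ z)
    (h : z ≤ ∑ l' ∈ Finset.range l, E.tail k l l' * PowerSeries.coeff l' (PowerSeries.coeff k u) +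
      PowerSeries.coeff l (PowerSeries.coeff k (E.rhs u))) : ‖z‖ ≤ E.asymb k l * size u k l := by
  rw [← ((E.isFormalSolution_iff u).1 hu).2 k hk l] at h
  refine (norm_le_of_nonneg_of_le hz h).trans (le_of_eq ?_)
  rw [norm_mul, hE.symb_eq, Complex.norm_real, Real.norm_of_nonneg (E.asymb_pos hk l).le, size]

theorem rhs_le {k l : ℕ} {z : ℂ}
    (h : z ≤ PowerSeries.coeff l (PowerSeries.coeff k (E.rhs u))) :
    z ≤ ∑ l' ∈ Finset.range l, E.tail k l l' * PowerSeries.coeff l' (PowerSeries.coeff k u) +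
      PowerSeries.coeff l (PowerSeries.coeff k (E.rhs u)) :=
  h.trans (le_add_of_nonneg_left (Finset.sum_nonneg fun _ hl' =>
    mul_nonneg (hE.tail_nonneg (Finset.mem_range.1 hl')) (hE.nonneg_of_isFormalSolution hu _ _)))

theorem nonlin_nonneg : Nonneg₂ (E.nonlin u) := fun k l => by
  rw [nonlin, PowerSeries.coeff_mk, finsum_eq_sum _ (E.support_term_finite u hu.1 k), map_sum]
  exact Finset.sum_nonneg fun q _ =>
    hE.term_nonneg (hE.nonneg_of_isFormalSolution hu) _ _ _ _

/-- Raising the power of `x` by means of the variable part of a coefficient `c_{j,α}`. -/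
theorem linear_step {p : ℕ × ℕ} (hp : p ∈ E.Lam1) (k l : ℕ) (hk : 1 ≤ k) :
    ‖PowerSeries.coeff (E.ordC p) (E.c p)‖ * ((k : ℝ) ^ p.1 * (l.descFactorial p.2 : ℝ)) *
      size u k l ≤ E.asymb k (l + E.ordC p) * size u k (l + E.ordC p) := by
  have hord := E.one_le_ordC hp
  have hnn := hE.nonneg_of_isFormalSolution hu
  have hc := hE.coeff_c_nonneg hp.1 (by omega : E.ordC p ≠ 0)
  set z : ℂ := PowerSeries.coeff (E.ordC p) (E.c p) *
    ((k : ℂ) ^ p.1 * (l.descFactorial p.2 : ℂ)) * PowerSeries.coeff l (PowerSeries.coeff k u)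
  have hz : 0 ≤ z := mul_nonneg (mul_nonneg hc (mul_nonneg (pow_nonneg (Nat.cast_nonneg _) _)
    (Nat.cast_nonneg _))) (hnn k l)
  have h1 := hE.norm_le_asymb_mul hu (l := l + E.ordC p) hk hz ?_
  · refine le_trans (le_of_eq ?_) h1
    rw [norm_mul, norm_mul, norm_mul, norm_pow, Complex.norm_natCast, Complex.norm_natCast, size]
  · refine le_add_of_le_of_nonneg ?_ (hE.rhs_nonneg hu.1 hnn _ _)
    have h2 : z ≤ E.tail k (l + E.ordC p) l * PowerSeries.coeff l (PowerSeries.coeff k u) := by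
      refine mul_le_mul_of_nonneg_right ?_ (hnn k l)
      rw [tail, Nat.add_sub_cancel_left]
      exact Finset.single_le_sum (f := fun q : ℕ × ℕ => PowerSeries.coeff (E.ordC p) (E.c q) *
        ((k : ℂ) ^ q.1 * (l.descFactorial q.2 : ℂ))) (fun q hq => mul_nonneg
          (hE.coeff_c_nonneg hq (by omega)) (mul_nonneg (pow_nonneg (Nat.cast_nonneg _) _)
            (Nat.cast_nonneg _))) hp.1
    refine h2.trans ?_
    exact Finset.single_le_sum (f := fun l' => E.tail k (l + E.ordC p) l' *
      PowerSeries.coeff l' (PowerSeries.coeff k u)) (fun l' hl' =>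
        mul_nonneg (hE.tail_nonneg (Finset.mem_range.1 hl')) (hnn _ _))
      (Finset.mem_range.2 (by omega))

theorem term_le_nonlin (i : ℕ) (ν : E.M → ℕ) (k l : ℕ) :
    PowerSeries.coeff l (PowerSeries.coeff k (E.term u i ν)) ≤
      PowerSeries.coeff l (PowerSeries.coeff k (E.nonlin u)) := by
  have hnn := hE.nonneg_of_isFormalSolution hu
  by_cases h0 : PowerSeries.coeff k (E.term u i ν) = 0
  · rw [h0, map_zero]
    exact hE.nonlin_nonneg hu k l
  · rw [nonlin, PowerSeries.coeff_mk, finsum_eq_sum _ (E.support_term_finite u hu.1 k), map_sum]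
    exact Finset.single_le_sum (f := fun q : ℕ × (E.M → ℕ) =>
      PowerSeries.coeff l (PowerSeries.coeff k (E.term u q.1 q.2)))
      (fun q _ => hE.term_nonneg hnn _ _ _ _) (a := (i, ν)) (by
        rw [Set.Finite.mem_toFinset]; exact h0)

theorem size_one_pos {l : ℕ} (ha : PowerSeries.coeff l E.a ≠ 0) : 0 < size u 1 l := by
  have h1 := hE.norm_le_asymb_mul hu (l := l) le_rfl (hE.a_nonneg l) (hE.rhs_le hu (by
    rw [rhs, map_add, map_add, ← zero_add 1, PowerSeries.coeff_succ_mul_X,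
      PowerSeries.coeff_zero_C]
    exact le_add_of_nonneg_right (hE.nonlin_nonneg hu _ _)))
  have h2 := lt_of_lt_of_le (norm_pos_iff.2 ha) h1
  exact pos_of_mul_pos_right h2 (E.asymb_pos le_rfl l).le

/-- Raising the power of `t` by means of a nonlinear term. -/
theorem exists_nonlinear_step
    (ha : ∀ μ ≤ E.maxAlpha, PowerSeries.coeff μ E.a ≠ 0) {i : ℕ} {ν : E.M → ℕ}
    {p : E.M} {μ : ℕ} (hg : PowerSeries.coeff μ (E.g i (ν + Pi.single p 1)) ≠ 0) :
    ∃ γ : ℝ, 0 < γ ∧ ∀ k l : ℕ, γ *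
      ((k : ℝ) ^ p.1.1 * ((l + p.1.2).descFactorial p.1.2 : ℝ)) * size u k (l + p.1.2) ≤
      E.asymb (k + (i + ∑ q, ν q)) (l + μ) * size u (k + (i + ∑ q, ν q)) (l + μ) := by
  classical
  have hnn := hE.nonneg_of_isFormalSolution hu
  set w : E.M → ℂ⟦X⟧⟦X⟧ := fun q => tDt^[q.1.1] (Dx^[q.1.2] u) with hw
  have hwn : ∀ q, Nonneg₂ (w q) := fun q => hnn.derivTerm _ _
  -- All factors but one are frozen at their coefficient of t x^0, nonzero because u_{1,α} > 0 for α
  -- ≤ maxAlpha. Each frozen factor contributes one power of t.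
  set π : ℂ := ∏ q, (PowerSeries.coeff 0 (PowerSeries.coeff 1 (w q))) ^ ν q with hπ
  have hπn : 0 ≤ π := Finset.prod_nonneg fun q _ => pow_nonneg (hwn q 1 0) _
  have hπ0 : π ≠ 0 := by
    refine Finset.prod_ne_zero_iff.2 fun q _ => pow_ne_zero _ ?_
    rw [hw, coeff_deriv_term, Nat.cast_one, one_pow, one_mul, zero_add]
    refine mul_ne_zero ?_ ?_
    · exact_mod_cast (Nat.descFactorial_pos.2 le_rfl).ne'
    · exact norm_pos_iff.1 (hE.size_one_pos hu (ha _ (E.le_maxAlpha q)))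
  have hgn := hE.g_nonneg' i (ν + Pi.single p 1)
  set g := E.g i (ν + Pi.single p 1) with hgdef
  have hr : 1 ≤ i + ∑ q, ν q := by
    by_contra hlt
    refine hg ?_
    rw [hgdef, E.g_low, map_zero]
    have : ∑ q, (ν + Pi.single p 1 : E.M → ℕ) q = ∑ q, ν q + 1 := by
      simp [Finset.sum_add_distrib]
    omega
  refine ⟨‖PowerSeries.coeff μ g * π‖, norm_pos_iff.2 (mul_ne_zero hg hπ0), fun k l => ?_⟩
  set z : ℂ := PowerSeries.coeff μ g * (PowerSeries.coeff l (PowerSeries.coeff k (w p)) * π) with hz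
  have hz0 : 0 ≤ z := mul_nonneg (hgn μ) (mul_nonneg (hwn p k l) hπn)
  have h1 := hE.norm_le_asymb_mul hu (k := k + (i + ∑ q, ν q)) (l := l + μ) (by omega) hz0
    (hE.rhs_le hu ?_)
  · refine le_trans (le_of_eq ?_) h1
    rw [hz, hw, coeff_deriv_term, norm_mul, norm_mul, norm_mul, norm_mul, norm_mul, norm_pow,
      Complex.norm_natCast, Complex.norm_natCast, size]
    ring
  · rw [rhs, map_add, map_add]
    refine le_add_of_nonneg_of_le ?_ ?_
    · have := (Nonneg₂.C hE.a_nonneg).mul (Nonneg₂.X_pow 1) (k + (i + ∑ q, ν q)) (l + μ)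
      rwa [pow_one] at this
    · refine le_trans ?_ (hE.term_le_nonlin hu i (ν + Pi.single p 1) _ _)
      have hprod : ∏ q, w q ^ (ν + Pi.single p 1 : E.M → ℕ) q = w p * ∏ q, w q ^ ν q := by
        simp_rw [Pi.add_apply, pow_add]
        rw [Finset.prod_mul_distrib, mul_comm]
        congr 1
        rw [Finset.prod_eq_single p]
        · simp
        · intro q _ hq
          simp [hq]
        · simp
      have hterm : E.term u i (ν + Pi.single p 1) =
          PowerSeries.C g * PowerSeries.X ^ i * (w p * ∏ q, w q ^ ν q) := by
        rw [term, ← hprod]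
      have hCg : PowerSeries.coeff μ (PowerSeries.coeff i
          (PowerSeries.C g * PowerSeries.X ^ i : ℂ⟦X⟧⟦X⟧)) = PowerSeries.coeff μ g := by
        rw [PowerSeries.coeff_C_mul_X_pow, if_pos rfl]
      have hP : Nonneg₂ (∏ q, w q ^ ν q) := Nonneg₂.prod _ _ fun q _ => (hwn q).pow _
      have h2 := (hwn p).le_coeff_mul hP k (∑ q, ν q) l 0
      have h3 := ((Nonneg₂.C hgn).mul (Nonneg₂.X_pow i)).le_coeff_mul ((hwn p).mul hP) i
        (k + ∑ q, ν q) μ (l + 0)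
      rw [hCg] at h3
      rw [hterm, show k + (i + ∑ q, ν q) = i + (k + ∑ q, ν q) by ring,
        show l + μ = μ + (l + 0) by ring]
      refine le_trans ?_ h3
      refine mul_le_mul_of_nonneg_left (le_trans ?_ h2) (hgn μ)
      refine mul_le_mul_of_nonneg_left ?_ (hwn p k l)
      exact Nonneg₂.le_coeff_prod Finset.univ w hwn ν

end SignCond
end Equation
open Filter

/-! ### Growth along chains -/

theorem exp_mul_le_of_step {q a b x y : ℝ} (ha : 0 < a) (hq : Real.exp q * a ≤ b)
    (h : b * x ≤ a * y) (hx : 0 ≤ x) : Real.exp q * x ≤ y := by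
  refine le_of_mul_le_mul_left ?_ ha
  calc a * (Real.exp q * x) = Real.exp q * a * x := by ring
    _ ≤ b * x := by gcongr
    _ ≤ _ := h

theorem exp_chain {w : ℕ → ℝ} {q : ℝ} {n : ℕ} (h : ∀ t < n, Real.exp q * w t ≤ w (t + 1)) :
    Real.exp (n * q) * w 0 ≤ w n := by
  induction n with
  | zero => simp
  | succ n ih =>
    calc Real.exp ((n + 1 : ℕ) * q) * w 0 = Real.exp q * (Real.exp (n * q) * w 0) := by
          rw [← mul_assoc, ← Real.exp_add]; push_cast; ring_nf
      _ ≤ Real.exp q * w n := by gcongr; exact ih fun t ht => h t (by omega)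
      _ ≤ _ := h n (by omega)

theorem exp_mul_trans {q₁ q₂ x y z : ℝ} (h₁ : Real.exp q₁ * x ≤ y) (h₂ : Real.exp q₂ * y ≤ z) :
    Real.exp (q₁ + q₂) * x ≤ z := by
  rw [add_comm, Real.exp_add, mul_assoc]
  exact (mul_le_mul_of_nonneg_left h₁ (Real.exp_pos _).le).trans h₂

/-- `v` takes values of size `exp (ρ l log l)` at points `(k, l)` with `k = o(l)`. -/
def Reach (v : ℕ → ℕ → ℝ) (ρ : ℝ) : Prop :=
  ∀ ε : ℝ, 0 < ε → ∀ᶠ T : ℕ in atTop, ∃ k l : ℕ, 1 ≤ k ∧ (k : ℝ) ≤ ε * T ∧ (T : ℝ) ≤ l ∧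
    (l : ℝ) ≤ (1 + ε) * T ∧ Real.exp ((ρ - ε) * (T * Real.log T)) ≤ v k l

theorem eventually_le_mul_log (c : ℝ) {ε : ℝ} (hε : 0 < ε) :
    ∀ᶠ T : ℕ in atTop, c ≤ ε * Real.log T := by
  have h := (Real.tendsto_log_atTop.comp tendsto_natCast_atTop_atTop).eventually_ge_atTop (c / ε)
  filter_upwards [h] with T hT
  rw [Function.comp_apply, div_le_iff₀ hε] at hT
  linarith

theorem eventually_le_mul (c : ℝ) {ε : ℝ} (hε : 0 < ε) : ∀ᶠ T : ℕ in atTop, c ≤ ε * T := by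
  have h := (tendsto_natCast_atTop_atTop (R := ℝ)).eventually_ge_atTop (c / ε)
  filter_upwards [h] with T hT
  rw [div_le_iff₀ hε] at hT
  linarith

theorem eventually_le_rpow (c : ℝ) {ε : ℝ} (hε : 0 < ε) :
    ∀ᶠ T : ℕ in atTop, c ≤ (T : ℝ) ^ ε :=
  ((tendsto_rpow_atTop hε).comp tendsto_natCast_atTop_atTop).eventually_ge_atTop c

theorem eventually_rpow_le {θ ζ : ℝ} (hθ : θ < 1) (hζ : 0 < ζ) :
    ∀ᶠ T : ℕ in atTop, (T : ℝ) ^ θ ≤ ζ * T := by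
  filter_upwards [eventually_le_rpow ζ⁻¹ (sub_pos.2 hθ), eventually_ge_atTop 1] with T hT hT1
  have hT0 : (0 : ℝ) < T := by exact_mod_cast hT1
  rw [Real.rpow_sub hT0, Real.rpow_one, le_div_iff₀ (by positivity),
    inv_mul_le_iff₀ hζ] at hT
  exact hT

theorem Reach.of_forall_lt {v : ℕ → ℕ → ℝ} {ρ : ℝ}
    (h : ∀ ρ' < ρ, 0 < ρ' → Reach v ρ') (hρ : 0 < ρ) :
    Reach v ρ := by
  intro ε hε
  set δ := min (ε / 2) (ρ / 2) with hδ
  have hδ0 : 0 < δ := lt_min (by linarith) (by linarith)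
  have hδε : δ ≤ ε / 2 := min_le_left _ _
  have hδρ : δ ≤ ρ / 2 := min_le_right _ _
  filter_upwards [h (ρ - δ) (by linarith) (by linarith) (ε / 2) (by linarith)]
    with T ⟨k, l, hk, hkT, hTl, hlT, hv⟩
  have hT0 : (0 : ℝ) ≤ T := by positivity
  have hlog : 0 ≤ (T : ℝ) * Real.log T := mul_nonneg hT0 (Real.log_natCast_nonneg T)
  refine ⟨k, l, hk, hkT.trans (by nlinarith), hTl, hlT.trans (by nlinarith), le_trans ?_ hv⟩
  exact Real.exp_le_exp.2 (mul_le_mul_of_nonneg_right (by linarith) hlog)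

namespace Equation

variable {E : Equation}

/-- If the gain of a step is only known to be at least 1, the step loses at most the size of the
symbol, about P^m. This is affordable for a small proportion of the steps of a chain. -/
theorem crude_step {c P b x y C : ℝ} {k l : ℕ} (hc : 0 < c) (hk : 1 ≤ k) (hP : (k : ℝ) + l ≤ P)
    (hb : 1 ≤ b) (hC : Real.log (E.symbConst / c) ≤ C) (h : c * b * x ≤ E.asymb k l * y)
    (hx : 0 ≤ x) : Real.exp (-(E.m * Real.log P + C)) * x ≤ y := by
  have hk' : (1 : ℝ) ≤ k := by exact_mod_cast hk
  have hl' : (0 : ℝ) ≤ l := by positivity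
  have hP0 : 0 < P := by linarith
  have hS := E.one_le_symbConst
  refine exp_mul_le_of_step (E.asymb_pos hk l) ?_ h hx
  have h1 : E.asymb k l ≤ E.symbConst * P ^ E.m := (E.asymb_le_pow hk).trans (by gcongr)
  have h2 : Real.exp (E.m * Real.log P) = P ^ E.m := by
    rw [Real.exp_nat_mul, Real.exp_log hP0]
  have h3 : E.symbConst / c ≤ Real.exp C := by
    rw [← Real.log_le_iff_le_exp (by positivity)]; exact hC
  rw [Real.exp_neg, Real.exp_add, h2, inv_mul_le_iff₀ (by positivity)]
  rw [div_le_iff₀ hc] at h3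
  calc E.asymb k l ≤ E.symbConst * P ^ E.m := h1
    _ ≤ Real.exp C * c * P ^ E.m := by gcongr
    _ ≤ Real.exp C * c * P ^ E.m * b := le_mul_of_one_le_right (by positivity) hb
    _ = _ := by ring

section Abstract

variable {v : ℕ → ℕ → ℝ} (hv : ∀ k l, 0 ≤ v k l) {p : ℕ × ℕ} {h : ℕ} {c : ℝ} (hc : 0 < c)
  (hh : 1 ≤ h) (hp : p.2 ≤ E.m)
  (hX : ∀ k l : ℕ, 1 ≤ k → c * ((k : ℝ) ^ p.1 * (l.descFactorial p.2 : ℝ)) * v k l ≤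
    E.asymb k (l + h) * v k (l + h))
include hv hc hX hp

theorem crude_linear {k l : ℕ} (hk : 1 ≤ k) (hl : E.m ≤ l) {P C : ℝ} (hP : (k : ℝ) + (l + h) ≤ P)
    (hC : Real.log (E.symbConst / c) ≤ C) :
    Real.exp (-(E.m * Real.log P + C)) * v k l ≤ v k (l + h) := by
  refine crude_step hc hk (by push_cast; linarith) ?_ hC (hX k l hk) (hv k l)
  refine one_le_mul_of_one_le_of_one_le (one_le_pow₀ (by exact_mod_cast hk)) ?_
  exact_mod_cast Nat.descFactorial_pos.2 (hp.trans hl)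

include hh

/-- Values at a sequence of points with bounded gaps. -/
theorem exists_base (hinit : 0 < v 1 E.m) {j₀ α₀ μ₀ r₀ : ℕ} {γ : ℝ} (hγ : 0 < γ) (hr₀ : 1 ≤ r₀)
    (hG : ∀ k l : ℕ, γ * ((k : ℝ) ^ j₀ * ((l + α₀).descFactorial α₀ : ℝ)) * v k (l + α₀) ≤
      E.asymb (k + r₀) (l + μ₀) * v (k + r₀) (l + μ₀)) :
    ∃ (C : ℝ) (r₀ δ : ℕ), 0 ≤ C ∧ 1 ≤ r₀ ∧ ∀ n : ℕ,
      Real.exp (-(C * (((n : ℝ) + 1) * (Real.log ((n : ℝ) + 1) + 1)))) ≤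
        v (1 + n * r₀) (E.m + n * δ) := by
  obtain ⟨h', rfl⟩ := Nat.exists_eq_add_of_le' hh
  -- A block consists of α₀ linear steps of length h'+1, which raise l sufficiently, and one
  -- nonlinear step, which replaces α₀ by μ₀; the net increase of l is δ and that of k is r₀.
  set δ := α₀ * h' + μ₀ with hδ
  set C₁ := |Real.log (E.symbConst / c)| + |Real.log (E.symbConst / γ)| with hC₁
  have hC₁c : Real.log (E.symbConst / c) ≤ C₁ :=
    (le_abs_self _).trans (le_add_of_nonneg_right (abs_nonneg _))
  have hC₁γ : Real.log (E.symbConst / γ) ≤ C₁ :=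
    (le_abs_self _).trans (le_add_of_nonneg_left (abs_nonneg _))
  have hC₁0 : 0 ≤ C₁ := by positivity
  set Kc : ℕ := 1 + E.m + r₀ + δ + (α₀ + 1) * (h' + 1) with hKc
  have hKc1 : (1 : ℝ) ≤ Kc := by exact_mod_cast (by omega : 1 ≤ Kc)
  have hlogK : 0 ≤ Real.log Kc := Real.log_nonneg hKc1
  refine ⟨(α₀ + 1) * (E.m * Real.log Kc + E.m + C₁) + |Real.log (v 1 E.m)|, r₀, δ, by positivity,
    hr₀, fun n => ?_⟩
  set P : ℝ := Kc * ((n : ℝ) + 1) with hP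
  set q : ℝ := -(E.m * Real.log P + C₁) with hq
  have hn1 : (1 : ℝ) ≤ (n : ℝ) + 1 := by
    have : (0 : ℝ) ≤ n := by positivity
    linarith
  have hblock : ∀ t < n, Real.exp ((α₀ + 1 : ℕ) * q) * v (1 + t * r₀) (E.m + t * δ) ≤
      v (1 + (t + 1) * r₀) (E.m + (t + 1) * δ) := by
    intro t ht
    have hPn : ∀ N : ℕ, N ≤ Kc * (n + 1) → (N : ℝ) ≤ P := by
      intro N hN
      rw [hP]
      exact_mod_cast hN
    have htr : (t + 1) * r₀ ≤ n * r₀ := Nat.mul_le_mul_right _ ht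
    have htδ : (t + 1) * δ ≤ n * δ := Nat.mul_le_mul_right _ ht
    have hexp1 : (t + 1) * r₀ = t * r₀ + r₀ := by ring
    have hexp2 : (t + 1) * δ = t * δ + δ := by ring
    have hKn : 1 + n * r₀ + (E.m + n * δ) + (α₀ + 1) * (h' + 1) ≤ Kc * (n + 1) := by
      rw [hKc]
      nlinarith [Nat.zero_le (n * (1 + E.m + (α₀ + 1) * (h' + 1)))]
    have hchain := exp_chain (w := fun i => v (1 + t * r₀) (E.m + t * δ + i * (h' + 1))) (q := q)
      (n := α₀) fun i hi => by
        have h1 : (i + 1) * (h' + 1) ≤ (α₀ + 1) * (h' + 1) := Nat.mul_le_mul_right _ (by omega)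
        have h2 : (i + 1) * (h' + 1) = i * (h' + 1) + (h' + 1) := by ring
        have h3 := crude_linear (C := C₁) (P := P) hv hc hp hX (k := 1 + t * r₀)
          (l := E.m + t * δ + i * (h' + 1)) (by omega) (by omega)
          (by
            have := hPn (1 + t * r₀ + (E.m + t * δ + i * (h' + 1) + (h' + 1))) (by omega)
            push_cast at this ⊢
            linarith) hC₁c
        simp only [h2, ← add_assoc]
        exact h3
    simp only [zero_mul, add_zero] at hchain
    have hlast := hG (1 + t * r₀) (E.m + t * δ + α₀ * h')
    have e1 : E.m + t * δ + α₀ * h' + α₀ = E.m + t * δ + α₀ * (h' + 1) := by ring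
    have e2 : 1 + t * r₀ + r₀ = 1 + (t + 1) * r₀ := by ring
    have e3 : E.m + t * δ + α₀ * h' + μ₀ = E.m + (t + 1) * δ := by rw [hδ]; ring
    rw [e1, e2, e3] at hlast
    have h4 := crude_step (C := C₁) (P := P) hγ (by omega) (by
      have := hPn (1 + (t + 1) * r₀ + (E.m + (t + 1) * δ)) (by omega)
      push_cast at this ⊢
      linarith) (one_le_mul_of_one_le_of_one_le (one_le_pow₀ (by
        exact_mod_cast (by omega : 1 ≤ 1 + t * r₀))) (by
        exact_mod_cast Nat.descFactorial_pos.2 (by nlinarith))) hC₁γ hlast (hv _ _)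
    have h5 := exp_mul_trans hchain h4
    rwa [show (α₀ : ℝ) * q + -(E.m * Real.log P + C₁) = (α₀ + 1 : ℕ) * q by
      rw [hq]; push_cast; ring] at h5
  have htot := exp_chain (w := fun t => v (1 + t * r₀) (E.m + t * δ)) hblock
  simp only [zero_mul, add_zero] at htot
  refine le_trans ?_ htot
  have hv1 : Real.exp (-|Real.log (v 1 E.m)|) ≤ v 1 E.m := by
    conv_rhs => rw [← Real.exp_log hinit]
    exact Real.exp_le_exp.2 (neg_abs_le _)
  refine le_trans ?_ (mul_le_mul_of_nonneg_left hv1 (Real.exp_pos _).le)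
  rw [← Real.exp_add, Real.exp_le_exp, hq, hP,
    Real.log_mul (by linarith) (by linarith)]
  have hlog0 : 0 ≤ Real.log ((n : ℝ) + 1) := Real.log_nonneg hn1
  set ℓ := Real.log ((n : ℝ) + 1) with hℓ
  set V := |Real.log (v 1 E.m)|
  have hV : 0 ≤ V := abs_nonneg _
  have h1 : (n : ℝ) * (E.m * (Real.log Kc + ℓ) + C₁) ≤
      ((n : ℝ) + 1) * ((E.m * Real.log Kc + E.m + C₁) * (ℓ + 1)) := by
    refine mul_le_mul (by linarith) ?_ (by positivity) (by positivity)
    have : 0 ≤ E.m * Real.log Kc * ℓ := by positivity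
    have : 0 ≤ C₁ * ℓ := by positivity
    have : (0 : ℝ) ≤ E.m := by positivity
    nlinarith
  have h2 : V ≤ V * (((n : ℝ) + 1) * (ℓ + 1)) :=
    le_mul_of_one_le_right hV (one_le_mul_of_one_le_of_one_le hn1 (by linarith))
  have h3 : (0 : ℝ) ≤ (α₀ : ℝ) + 1 := by positivity
  push_cast
  nlinarith [mul_le_mul_of_nonneg_left h1 h3]

end Abstract
end Equation
-- Growth in x along a supporting line of the Newton polygon, and Gevrey bounds.
namespace Equation

variable {E : Equation}

-- For k ≈ T^θ and l ≈ T the symbol is at most of order T^(θj+α-y), by `hslope`, whereas the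
-- coefficient of the step has order T^(θj+α). So each step of length h gains T^y, and T/h steps
-- give exp((y/h) T log T). Because θ < 1, a starting point with k ≈ T^θ costs only exp(-o(T log
-- T)).
set_option maxHeartbeats 2000000 in
theorem reach_of_slope {v : ℕ → ℕ → ℝ} (hv : ∀ k l, 0 ≤ v k l) {p : ℕ × ℕ} {h : ℕ} {c : ℝ}
    (hc : 0 < c) (hh : 1 ≤ h) (hp : p.2 ≤ E.m)
    (hX : ∀ k l : ℕ, 1 ≤ k → c * ((k : ℝ) ^ p.1 * (l.descFactorial p.2 : ℝ)) * v k l ≤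
      E.asymb k (l + h) * v k (l + h))
    {C : ℝ} {r₀ δ : ℕ} (hC : 0 ≤ C) (hr₀ : 1 ≤ r₀)
    (hbase : ∀ n : ℕ, Real.exp (-(C * (((n : ℝ) + 1) * (Real.log ((n : ℝ) + 1) + 1)))) ≤
        v (1 + n * r₀) (E.m + n * δ))
    {y θ : ℝ} (hy : 0 < y) (hθ0 : 0 ≤ θ) (hθ1 : θ < 1)
    (hslope : ∀ q ∈ E.Lam0, θ * q.1 + q.2 ≤ θ * p.1 + p.2 - y) : Reach v (y / h) := by
  intro ε hε
  have hm0 : (0 : ℝ) ≤ E.m := by positivity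
  have hh1 : (1 : ℝ) ≤ h := by exact_mod_cast hh
  -- The losses are η at the base point, 2η(m+1) in the crude steps and η(1+3y) in the fine ones.
  -- The bound 1/4 keeps the crude part, which ends at l ≤ 3ηT, below T, and η ≤ y keeps the fine
  -- gain nonnegative.
  set η := min (min (1 / 4) y) (ε / (4 + 2 * E.m + 3 * y)) with hη
  have hη0 : 0 < η := lt_min (lt_min (by norm_num) hy) (by positivity)
  have hη4 : η ≤ 1 / 4 := (min_le_left _ _).trans (min_le_left _ _)
  have hηy : η ≤ y := (min_le_left _ _).trans (min_le_right _ _)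
  have hηε : η * (4 + 2 * E.m + 3 * y) ≤ ε := by
    rw [← le_div_iff₀ (by positivity)]; exact min_le_right _ _
  have hηε' : η ≤ ε := le_trans (le_mul_of_one_le_right hη0.le (by linarith)) hηε
  set cc : ℕ := 1 + E.m + 2 * r₀ + 2 * δ + h with hcc
  have hcc1 : (1 : ℝ) ≤ cc := by exact_mod_cast (by omega : 1 ≤ cc)
  -- Since T^θ ≤ ζT, the summand `cc` makes the base coordinates at most ηT, and 6C makes the base
  -- value at least exp(-η T log T).
  set ζ := η / (cc + 6 * C) with hζ
  have hζ0 : 0 < ζ := by positivity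
  have hζ1 : ζ * (cc + 6 * C) = η := by rw [hζ]; field_simp
  have hζc : cc * ζ ≤ η := by nlinarith [mul_nonneg hζ0.le hC]
  have hζC : 6 * C * ζ ≤ η := by nlinarith
  set C₁ := |Real.log (E.symbConst / c)| with hC₁
  have hC₁0 : 0 ≤ C₁ := abs_nonneg _
  -- All constants of a fine step, to be absorbed by the factor T^η given up from T^y.
  set W := E.symbConst * (cc : ℝ) ^ E.m * ((p.2 : ℝ) + 1) ^ p.2 / (c * η ^ p.2) with hW
  filter_upwards [eventually_rpow_le hθ1 hζ0, eventually_le_mul_log (C₁ + 1) one_pos,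
    eventually_le_mul (h + 1 + p.2 : ℝ) hη0, eventually_le_rpow W hη0, eventually_ge_atTop 1]
    with T hTθ hTlog hTh hTW hT1
  rw [one_mul] at hTlog
  have hT1' : (1 : ℝ) ≤ T := by exact_mod_cast hT1
  have hT0 : (0 : ℝ) < T := by linarith
  set X : ℝ := (T : ℝ) ^ θ with hXdef
  have hX1 : 1 ≤ X := Real.one_le_rpow hT1' hθ0
  set ℓ := Real.log T with hℓ
  have hℓ1 : 1 ≤ ℓ := by linarith
  have hp2 : (0 : ℝ) ≤ p.2 := by positivity
  have hTh' : (h : ℝ) ≤ η * T := by linarith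
  -- the base point
  set n := ⌈X⌉₊ with hn
  have hnX : X ≤ n := Nat.le_ceil _
  have hnX' : (n : ℝ) ≤ 2 * X := by
    have := (Nat.ceil_lt_add_one (by linarith : 0 ≤ X)).le
    linarith
  set k := 1 + n * r₀ with hk
  set l₀ := E.m + n * δ with hl₀
  have hr₀' : (1 : ℝ) ≤ r₀ := by exact_mod_cast hr₀
  have hkX : X ≤ k := by
    have h1 : (n : ℝ) ≤ n * r₀ := le_mul_of_one_le_right (by positivity) hr₀'
    have h2 : (k : ℝ) = 1 + n * r₀ := by rw [hk]; push_cast; ring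
    linarith
  have hδ0 : (0 : ℝ) ≤ δ := by positivity
  have hccv : (cc : ℝ) = 1 + E.m + 2 * r₀ + 2 * δ + h := by rw [hcc]; push_cast; ring
  have hkX' : (k : ℝ) ≤ cc * X := by
    have h1 : (n : ℝ) * r₀ ≤ 2 * X * r₀ := mul_le_mul_of_nonneg_right hnX' (by linarith)
    have h2 : (k : ℝ) = 1 + n * r₀ := by rw [hk]; push_cast; ring
    have h3 : (0 : ℝ) ≤ (E.m + 2 * δ + h) * X := by positivity
    rw [h2, hccv]
    linarith
  have hlX : (l₀ : ℝ) ≤ cc * X := by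
    have h1 : (n : ℝ) * δ ≤ 2 * X * δ := mul_le_mul_of_nonneg_right hnX' hδ0
    have h2 : (l₀ : ℝ) = E.m + n * δ := by rw [hl₀]; push_cast; ring
    have h3 : (0 : ℝ) ≤ (1 + 2 * r₀ + h) * X := by positivity
    have h4 : (E.m : ℝ) ≤ E.m * X := le_mul_of_one_le_right hm0 hX1
    rw [h2, hccv]
    linarith
  have hccX : cc * X ≤ η * T := by
    calc cc * X ≤ cc * (ζ * T) := by gcongr
      _ = cc * ζ * T := by ring
      _ ≤ _ := by gcongr
  have hkT : (k : ℝ) ≤ η * T := hkX'.trans hccX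
  have hlT : (l₀ : ℝ) ≤ η * T := hlX.trans hccX
  have hη1 : 1 ≤ η * T := by linarith
  have hηT4 : η * T ≤ T / 4 := by
    have := mul_le_mul_of_nonneg_right hη4 hT0.le
    linarith
  have hb : Real.exp (-(η * (T * ℓ))) ≤ v k l₀ := by
    refine le_trans (Real.exp_le_exp.2 (neg_le_neg ?_)) (hbase n)
    have h1 : (n : ℝ) + 1 ≤ 3 * (ζ * T) := by linarith
    have h2 : (n : ℝ) + 1 ≤ T := by
      have : X ≤ cc * X := le_mul_of_one_le_left (by linarith) hcc1
      linarith
    have h3 : Real.log ((n : ℝ) + 1) ≤ ℓ := Real.log_le_log (by positivity) h2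
    have h4 : 0 ≤ Real.log ((n : ℝ) + 1) :=
      Real.log_nonneg (by linarith [(by positivity : (0 : ℝ) ≤ n)])
    calc C * (((n : ℝ) + 1) * (Real.log ((n : ℝ) + 1) + 1)) ≤ C * (3 * (ζ * T) * (ℓ + ℓ)) := by
          gcongr
      _ = 6 * C * ζ * (T * ℓ) := by ring
      _ ≤ _ := by gcongr
  -- crude steps
  set n₁ := ⌈η * T / h⌉₊ with hn₁
  have hh0 : (0 : ℝ) < h := by linarith
  have hn₁l : η * T ≤ n₁ * h := by
    rw [← div_le_iff₀ hh0]; exact Nat.le_ceil _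
  have hn₁u : (n₁ : ℝ) * h ≤ η * T + h := by
    have := (Nat.ceil_lt_add_one (by positivity : 0 ≤ η * T / h)).le
    rw [← hn₁] at this
    calc (n₁ : ℝ) * h ≤ (η * T / h + 1) * h := by gcongr
      _ = _ := by field_simp
  have hn₁T : (n₁ : ℝ) ≤ 2 * (η * T) := by
    have : (n₁ : ℝ) ≤ n₁ * h := le_mul_of_one_le_right (by positivity) hh1
    linarith
  set l₁ := l₀ + n₁ * h with hl₁
  have hl₁c : (l₁ : ℝ) = l₀ + n₁ * h := by rw [hl₁]; push_cast; ring
  have hl₁l : η * T ≤ l₁ := by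
    have : (0 : ℝ) ≤ l₀ := by positivity
    linarith
  have hl₁u : (l₁ : ℝ) ≤ 3 * (η * T) := by linarith
  have hcrude : Real.exp (-(2 * η * (E.m + 1) * (T * ℓ))) * v k l₀ ≤ v k l₁ := by
    have h1 := exp_chain (w := fun t => v k (l₀ + t * h)) (q := -(E.m * ℓ + C₁)) (n := n₁)
      fun t ht => by
        have h2 : (t + 1) * h ≤ n₁ * h := Nat.mul_le_mul_right _ ht
        have h3 : (t + 1) * h = t * h + h := by ring
        have h4 := crude_linear (E := E) (P := T) (C := C₁) hv hc hp hX (k := k)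
          (l := l₀ + t * h) (by omega) (by omega) (by
            have h5 : ((l₀ + t * h + h : ℕ) : ℝ) ≤ l₁ := by
              exact_mod_cast (by omega : l₀ + t * h + h ≤ l₁)
            push_cast at h5 ⊢
            linarith) (le_abs_self _)
        rw [h3, ← add_assoc]
        exact h4
    simp only [zero_mul, add_zero] at h1
    refine le_trans (mul_le_mul_of_nonneg_right (Real.exp_le_exp.2 ?_) (hv _ _)) h1
    have h2 : (n₁ : ℝ) * (E.m * ℓ + C₁) ≤ 2 * (η * T) * ((E.m + 1) * ℓ) := by
      refine mul_le_mul hn₁T (by linarith) (by positivity) (by positivity)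
    linarith
  -- fine steps
  set n₂ := ⌈(T - l₁ : ℝ) / h⌉₊ with hn₂
  have hTl₁ : 0 ≤ (T : ℝ) - l₁ := by linarith
  have hn₂l : (T : ℝ) - l₁ ≤ n₂ * h := by
    rw [← div_le_iff₀ hh0]; exact Nat.le_ceil _
  have hn₂u : (n₂ : ℝ) * h ≤ T - l₁ + h := by
    have := (Nat.ceil_lt_add_one (by positivity : 0 ≤ ((T : ℝ) - l₁) / h)).le
    rw [← hn₂] at this
    calc (n₂ : ℝ) * h ≤ ((T - l₁) / h + 1) * h := by gcongr
      _ = _ := by field_simp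
  set l₂ := l₁ + n₂ * h with hl₂
  have hl₂c : (l₂ : ℝ) = l₁ + n₂ * h := by rw [hl₂]; push_cast; ring
  have hfine : Real.exp (n₂ * ((y - η) * ℓ)) * v k l₁ ≤ v k l₂ := by
    have h1 := exp_chain (w := fun t => v k (l₁ + t * h)) (q := (y - η) * ℓ) (n := n₂)
      fun t ht => by
        have h2 : (t + 1) * h ≤ n₂ * h := Nat.mul_le_mul_right _ ht
        have h3 : (t + 1) * h = t * h + h := by ring
        rw [h3, ← add_assoc]
        set l := l₁ + t * h with hl
        have hlη : η * T ≤ l := by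
          have : (l₁ : ℝ) ≤ l := by exact_mod_cast (by omega : l₁ ≤ l)
          linarith
        have hlT : ((l + h : ℕ) : ℝ) ≤ cc * T := by
          have h5 : ((l + h : ℕ) : ℝ) ≤ l₂ := by exact_mod_cast (by omega : l + h ≤ l₂)
          have h6 : (l₂ : ℝ) ≤ T + h := by linarith
          have h7 : (1 + h : ℝ) ≤ cc := by rw [hccv]; linarith
          have h8 := mul_le_mul_of_nonneg_right h7 hT0.le
          have h9 : (h : ℝ) ≤ h * T := le_mul_of_one_le_right hh0.le hT1'
          linarith
        refine exp_mul_le_of_step (E.asymb_pos (by omega) (l + h)) ?_ (hX k l (by omega)) (hv _ _)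
        have hA := E.asymb_le_rpow hcc1 hT1' hslope hkX' hlT
        have e1 : Real.exp ((y - η) * ℓ) = (T : ℝ) ^ (y - η) := by
          rw [mul_comm, Real.exp_mul, Real.exp_log hT0]
        have hpl : p.2 ≤ l := by
          have : (p.2 : ℝ) ≤ l := by linarith
          exact_mod_cast this
        have h8 : (η * T) ^ p.2 ≤ ((p.2 : ℝ) + 1) ^ p.2 * (l.descFactorial p.2 : ℝ) :=
          (pow_le_pow_left₀ (by positivity) hlη _).trans (pow_le_mul_descFactorial hpl)
        have h9 : X ^ p.1 ≤ (k : ℝ) ^ p.1 := by gcongr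
        have hD : (0 : ℝ) < ((p.2 : ℝ) + 1) ^ p.2 := by positivity
        rw [hW, div_le_iff₀ (by positivity)] at hTW
        have eT : (T : ℝ) ^ (y - η) * (T : ℝ) ^ (θ * p.1 + p.2 - y) * (T : ℝ) ^ η =
            X ^ p.1 * (T : ℝ) ^ p.2 := by
          rw [← Real.rpow_add hT0, ← Real.rpow_add hT0, hXdef, ← Real.rpow_natCast,
            ← Real.rpow_mul hT0.le, ← Real.rpow_natCast (T : ℝ), ← Real.rpow_add hT0]
          ring_nf
        refine le_of_mul_le_mul_left ?_ hD
        rw [e1]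
        calc ((p.2 : ℝ) + 1) ^ p.2 * ((T : ℝ) ^ (y - η) * E.asymb k (l + h))
            ≤ ((p.2 : ℝ) + 1) ^ p.2 * ((T : ℝ) ^ (y - η) *
              (E.symbConst * ((cc : ℝ) ^ E.m * (T : ℝ) ^ (θ * p.1 + p.2 - y)))) := by gcongr
          _ = (T : ℝ) ^ (y - η) * (T : ℝ) ^ (θ * p.1 + p.2 - y) *
              (E.symbConst * (cc : ℝ) ^ E.m * ((p.2 : ℝ) + 1) ^ p.2) := by ring
          _ ≤ (T : ℝ) ^ (y - η) * (T : ℝ) ^ (θ * p.1 + p.2 - y) *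
              ((T : ℝ) ^ η * (c * η ^ p.2)) := by gcongr
          _ = X ^ p.1 * (T : ℝ) ^ p.2 * (c * η ^ p.2) := by rw [← eT]; ring
          _ = c * (X ^ p.1 * (η * T) ^ p.2) := by rw [mul_pow]; ring
          _ ≤ c * ((k : ℝ) ^ p.1 * (((p.2 : ℝ) + 1) ^ p.2 * (l.descFactorial p.2 : ℝ))) := by
              gcongr
          _ = _ := by ring
    simp only [zero_mul, add_zero] at h1
    exact h1
  refine ⟨k, l₂, by omega, hkT.trans (by gcongr), by linarith, ?_, ?_⟩
  · have : η * T ≤ ε * T := by gcongr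
    linarith
  · have htot := exp_mul_trans hcrude hfine
    refine le_trans ?_ ((mul_le_mul_of_nonneg_left hb (Real.exp_pos _).le).trans htot)
    rw [← Real.exp_add, Real.exp_le_exp]
    have hTℓ : 0 ≤ T * ℓ := by positivity
    have h1 : (1 - 3 * η) * (T / h) * ((y - η) * ℓ) ≤ n₂ * ((y - η) * ℓ) := by
      refine mul_le_mul_of_nonneg_right ?_ (mul_nonneg (by linarith) (by linarith))
      rw [mul_div_assoc', div_le_iff₀ hh0]
      linarith
    have h2 : y / h - η * (1 + 3 * y) ≤ (1 - 3 * η) * (y - η) / h := by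
      have h3 : y - η * (1 + 3 * y) ≤ (1 - 3 * η) * (y - η) := by
        have := mul_nonneg hη0.le hη0.le
        linarith
      have h4 : η * (1 + 3 * y) / h ≤ η * (1 + 3 * y) := div_le_self (by positivity) hh1
      calc y / h - η * (1 + 3 * y) ≤ y / h - η * (1 + 3 * y) / h := by linarith
        _ = (y - η * (1 + 3 * y)) / h := by ring
        _ ≤ _ := by gcongr
    have h5 : (1 - 3 * η) * (T / h) * ((y - η) * ℓ) = (1 - 3 * η) * (y - η) / h * (T * ℓ) := by
      ring
    have h6 : (y / h - ε) * (T * ℓ) ≤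
        (-η - 2 * η * (E.m + 1) + (y / h - η * (1 + 3 * y))) * (T * ℓ) :=
      mul_le_mul_of_nonneg_right (by linarith) hTℓ
    have h7 := mul_le_mul_of_nonneg_right h2 hTℓ
    linarith

/-! ### Upper bounds in Gevrey classes -/

theorem factorial_rpow_le {n : ℕ} {e : ℝ} (he : 0 ≤ e) :
    (n.factorial : ℝ) ^ e ≤ Real.exp (e * (n * Real.log n)) := by
  have h1 : (n.factorial : ℝ) ≤ Real.exp (n * Real.log n) := by
    rcases Nat.eq_zero_or_pos n with rfl | hn
    · simp
    · rw [Real.exp_nat_mul, Real.exp_log (by exact_mod_cast hn)]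
      exact_mod_cast Nat.factorial_le_pow n
  rw [mul_comm, Real.exp_mul]
  exact Real.rpow_le_rpow (by positivity) h1 he

theorem exists_size_le {u : ℂ⟦X⟧⟦X⟧} {s σ : ℝ} (hs : 1 ≤ s) (hσ : 1 ≤ σ) (h : IsGevrey s σ u) :
    ∃ C : ℝ, 0 ≤ C ∧ ∀ k l : ℕ, size u k l ≤ Real.exp (C * ((k : ℝ) + l + 1) +
      (s - 1) * (k * Real.log k) + (σ - 1) * (l * Real.log l)) := by
  obtain ⟨r, hr, hsum⟩ := h
  set f : ℕ × ℕ → ℝ := fun q => ‖PowerSeries.coeff q.2 (PowerSeries.coeff q.1 u)‖ /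
      ((q.1.factorial : ℝ) ^ (s - 1) * (q.2.factorial : ℝ) ^ (σ - 1)) * r ^ (q.1 + q.2) with hf
  have hf0 : ∀ q, 0 ≤ f q := fun q => by positivity
  set S := ∑' q, f q + 1 with hS
  have hS0 : 0 < S := by have : 0 ≤ ∑' q, f q := tsum_nonneg hf0; linarith
  refine ⟨|Real.log S| + |Real.log r|, by positivity, fun k l => ?_⟩
  have h1 : f (k, l) ≤ S := (hsum.le_tsum (k, l) fun q _ => hf0 q).trans (by linarith)
  have hkf : (0 : ℝ) < (k.factorial : ℝ) ^ (s - 1) := by positivity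
  have hlf : (0 : ℝ) < (l.factorial : ℝ) ^ (σ - 1) := by positivity
  have h2 : size u k l ≤ S * (r ^ (k + l))⁻¹ *
      ((k.factorial : ℝ) ^ (s - 1) * (l.factorial : ℝ) ^ (σ - 1)) := by
    rw [hf] at h1
    simp only at h1
    rw [div_mul_eq_mul_div, div_le_iff₀ (by positivity), ← le_div_iff₀ (by positivity)] at h1
    refine h1.trans (le_of_eq ?_)
    field_simp
  refine h2.trans ?_
  rw [add_assoc, Real.exp_add]
  have h3 : S * (r ^ (k + l))⁻¹ ≤ Real.exp ((|Real.log S| + |Real.log r|) * ((k : ℝ) + l + 1)) := by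
    have e1 : S * (r ^ (k + l))⁻¹ = Real.exp (Real.log S - (k + l : ℕ) * Real.log r) := by
      rw [Real.exp_sub, Real.exp_log hS0, Real.exp_nat_mul, Real.exp_log hr, div_eq_mul_inv]
    rw [e1, Real.exp_le_exp]
    have h4 := le_abs_self (Real.log S)
    have h5 := neg_abs_le (Real.log r)
    have h6 : (0 : ℝ) ≤ (k : ℝ) + l := by positivity
    have h7 := abs_nonneg (Real.log S)
    have h8 := abs_nonneg (Real.log r)
    push_cast
    nlinarith
  refine mul_le_mul h3 ?_ (by positivity) (by positivity)
  rw [Real.exp_add]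
  exact mul_le_mul (factorial_rpow_le (by linarith)) (factorial_rpow_le (by linarith))
    (by positivity) (by positivity)

theorem le_of_forall_small {x y K : ℝ} (hK : 0 ≤ K) (h : ∀ ε : ℝ, 0 < ε → ε ≤ 1 → x ≤ y + ε * K) :
    x ≤ y := by
  refine le_of_forall_pos_le_add fun δ hδ => ?_
  set ε := min 1 (δ / (K + 1)) with hε
  have hε0 : 0 < ε := lt_min one_pos (by positivity)
  have h1 := h ε hε0 (min_le_left _ _)
  have h2 : ε * (K + 1) ≤ δ := by rw [← le_div_iff₀ (by positivity)]; exact min_le_right _ _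
  nlinarith

/-- As k = o(l), the term (s-1) k log k is negligible against T log T, while l log l is asymptotic
to T log T; only σ-1 is left to compete with ρ. -/
theorem _root_.TotChar.Reach.le_sub_one {v : ℕ → ℕ → ℝ} {ρ C s σ : ℝ} (h : Reach v ρ) (hC : 0 ≤ C)
    (hs : 1 ≤ s) (hσ : 1 ≤ σ) (hv : ∀ k l : ℕ, v k l ≤ Real.exp (C * ((k : ℝ) + l + 1) +
      (s - 1) * (k * Real.log k) + (σ - 1) * (l * Real.log l))) : ρ ≤ σ - 1 := by
  refine le_of_forall_small (K := 2 + (s - 1) + 3 * (σ - 1)) (by linarith) fun ε hε hε1 => ?_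
  have hev := (h ε hε).and ((eventually_le_mul_log (4 * C + Real.log 2) hε).and
    ((eventually_le_mul_log 1 one_pos).and (eventually_ge_atTop 1)))
  obtain ⟨T, ⟨k, l, hk, hkT, hTl, hlT, hvkl⟩, hTC, hT1, hTge⟩ := hev.exists
  have hTge' : (1 : ℝ) ≤ T := by exact_mod_cast hTge
  rw [one_mul] at hT1
  set ℓ := Real.log T with hℓ
  have hk1 : (1 : ℝ) ≤ k := by exact_mod_cast hk
  have hkT' : (k : ℝ) ≤ T := by nlinarith
  have h2T : (1 + ε) * T ≤ 2 * T := by nlinarith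
  have hlog2 : 0 ≤ Real.log 2 := Real.log_nonneg (by norm_num)
  have hkk : k * Real.log k ≤ ε * (T * ℓ) := by
    have h1 : Real.log k ≤ ℓ := Real.log_le_log (by linarith) hkT'
    calc k * Real.log k ≤ (ε * T) * ℓ :=
          mul_le_mul hkT h1 (Real.log_nonneg hk1) (by positivity)
      _ = _ := by ring
  have hll : l * Real.log l ≤ (1 + 3 * ε) * (T * ℓ) := by
    have h1 : Real.log l ≤ (1 + ε) * ℓ := by
      calc Real.log l ≤ Real.log (2 * T) := Real.log_le_log (by linarith) (by linarith)
        _ = Real.log 2 + ℓ := Real.log_mul (by norm_num) (by linarith)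
        _ ≤ _ := by linarith
    calc l * Real.log l ≤ ((1 + ε) * T) * ((1 + ε) * ℓ) :=
          mul_le_mul hlT h1 (Real.log_nonneg (by linarith)) (by positivity)
      _ = (1 + 2 * ε + ε * ε) * (T * ℓ) := by ring
      _ ≤ _ := by
        refine mul_le_mul_of_nonneg_right (by nlinarith) (by positivity)
  have hCC : C * ((k : ℝ) + l + 1) ≤ ε * (T * ℓ) := by
    calc C * ((k : ℝ) + l + 1) ≤ C * (4 * T) :=
          mul_le_mul_of_nonneg_left (by linarith) hC
      _ = 4 * C * T := by ring
      _ ≤ ε * ℓ * T := mul_le_mul_of_nonneg_right (by linarith) (by linarith)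
      _ = _ := by ring
  have hE := Real.exp_le_exp.1 (hvkl.trans (hv k l))
  have hX : 0 < T * ℓ := by positivity
  have h1 := mul_le_mul_of_nonneg_left hkk (by linarith : 0 ≤ s - 1)
  have h2 := mul_le_mul_of_nonneg_left hll (by linarith : 0 ≤ σ - 1)
  have h3 : (ρ - ε) * (T * ℓ) ≤ (ε + (s - 1) * ε + (σ - 1) * (1 + 3 * ε)) * (T * ℓ) := by
    linarith
  have h4 := le_of_mul_le_mul_right h3 hX
  linarith

end Equation
-- Growth in t along chains of nonlinear steps.
namespace Equation

variable {E : Equation} {v : ℕ → ℕ → ℝ}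

/-- Once k and l are comparable to n, a step gains n^(j+μ+b) and loses the symbol n^m, that is n^A
in total. The first εn steps, during which k may still be small, are estimated crudely. Starting
above (b+ε)n keeps l ≥ εn to the end, also when b = 0. -/
theorem eventually_nonlinear_chain (hv : ∀ k l, 0 ≤ v k l) {j μ b r : ℕ} {γ : ℝ} (hγ : 0 < γ)
    (hG : ∀ k l : ℕ,
      γ * ((k : ℝ) ^ j * ((l + (μ + b)).descFactorial (μ + b) : ℝ)) * v k (l + (μ + b)) ≤
        E.asymb (k + r) (l + μ) * v (k + r) (l + μ))
    (hr : 1 ≤ r) {ε : ℝ} (hε : 0 < ε) (hε1 : ε ≤ 1) {A : ℝ} (hA : A = j + (μ + b) - E.m) :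
    ∀ᶠ n : ℕ in atTop, ∀ k₀ l₀ : ℕ, 1 ≤ k₀ → (k₀ : ℝ) ≤ ε * n → (b + ε) * n ≤ l₀ →
      (l₀ : ℝ) ≤ (b + 3 * ε) * n →
      Real.exp ((A - ε * (2 * |A| + 1 + 2 * (E.m + 1))) * (n * Real.log n)) * v k₀ l₀ ≤
        v (k₀ + n * r) (l₀ - n * b) := by
  set α := μ + b with hα
  set c : ℝ := r + b + 4 with hc
  have hc1 : 1 ≤ c := by
    have : (0 : ℝ) ≤ r + b := by positivity
    linarith
  set C₁ := |Real.log (E.symbConst / γ)| with hC₁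
  have hC₁0 : 0 ≤ C₁ := abs_nonneg _
  set W := E.symbConst * c ^ E.m * ((α : ℝ) + 1) ^ α / (γ * (ε ^ j * ε ^ α)) with hW
  filter_upwards [eventually_le_mul_log (E.m * Real.log c + C₁) one_pos,
    eventually_le_mul_log 1 one_pos, eventually_le_mul (1 + α : ℝ) hε, eventually_le_rpow W hε,
    eventually_ge_atTop 1] with n hlogc hlog1 hnα hnW hn1 k₀ l₀ hk₀ hk₀n hl₀ hl₀'
  rw [one_mul] at hlogc hlog1
  set ℓ := Real.log n with hℓ
  have hn0 : (0 : ℝ) < n := by exact_mod_cast hn1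
  have hα0 : (0 : ℝ) ≤ α := by positivity
  have hεn : ε * n ≤ n := mul_le_of_le_one_left hn0.le hε1
  have hbn : n * b ≤ l₀ := by
    have : (n : ℝ) * b ≤ l₀ := by linarith
    exact_mod_cast this
  have hbt : ∀ t ≤ n, t * b ≤ l₀ ∧ ε * n ≤ ((l₀ - t * b : ℕ) : ℝ) := fun t ht => by
    have h1 : t * b ≤ n * b := Nat.mul_le_mul_right _ ht
    refine ⟨h1.trans hbn, ?_⟩
    rw [Nat.cast_sub (h1.trans hbn)]
    have h2 : ((t * b : ℕ) : ℝ) ≤ ((n * b : ℕ) : ℝ) := by exact_mod_cast h1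
    push_cast at h2 ⊢
    linarith
  have hstep : ∀ t < n, α ≤ l₀ - t * b ∧
      γ * (((k₀ + t * r : ℕ) : ℝ) ^ j * ((l₀ - t * b).descFactorial α : ℝ)) *
        v (k₀ + t * r) (l₀ - t * b) ≤ E.asymb (k₀ + (t + 1) * r) (l₀ - (t + 1) * b) *
        v (k₀ + (t + 1) * r) (l₀ - (t + 1) * b) := fun t ht => by
    have h1 : α ≤ l₀ - t * b := by
      have : (α : ℝ) ≤ ((l₀ - t * b : ℕ) : ℝ) := by linarith [(hbt t ht.le).2]
      exact_mod_cast this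
    refine ⟨h1, ?_⟩
    have h2 := hG (k₀ + t * r) (l₀ - t * b - α)
    have e1 : l₀ - t * b - α + α = l₀ - t * b := by omega
    have e2 : (t + 1) * b = t * b + b := by ring
    have e3 : l₀ - t * b - α + μ = l₀ - (t + 1) * b := by omega
    have e4 : k₀ + t * r + r = k₀ + (t + 1) * r := by ring
    rwa [e1, e3, e4] at h2
  have hsize : ∀ t < n,
      ((k₀ + (t + 1) * r : ℕ) : ℝ) + ((l₀ - (t + 1) * b : ℕ) : ℝ) ≤ c * n := fun t ht => by
    have h1 : (((t + 1) * r : ℕ) : ℝ) ≤ ((n * r : ℕ) : ℝ) := by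
      exact_mod_cast Nat.mul_le_mul_right _ ht
    have h2 : ((l₀ - (t + 1) * b : ℕ) : ℝ) ≤ l₀ := by exact_mod_cast Nat.sub_le _ _
    rw [hc]
    push_cast at h1 h2 ⊢
    linarith
  have hone : ∀ t < n, 1 ≤ ((k₀ + t * r : ℕ) : ℝ) ^ j * ((l₀ - t * b).descFactorial α : ℝ) :=
    fun t ht => one_le_mul_of_one_le_of_one_le
      (one_le_pow₀ (by exact_mod_cast (by omega : 1 ≤ k₀ + t * r)))
      (by exact_mod_cast Nat.descFactorial_pos.2 (hstep t ht).1)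
  set n₁ := ⌈ε * n⌉₊ with hn₁
  have hn₁n : n₁ ≤ n := Nat.ceil_le.2 hεn
  have hn₁l : ε * n ≤ n₁ := Nat.le_ceil _
  have hn₁u : (n₁ : ℝ) ≤ 2 * (ε * n) := by
    have := (Nat.ceil_lt_add_one (by positivity : 0 ≤ ε * n)).le
    linarith
  have hcrude := exp_chain (w := fun t => v (k₀ + t * r) (l₀ - t * b)) (q := -((E.m + 1) * ℓ))
    (n := n₁) fun t ht => by
      have ht' : t < n := by omega
      have h1 := crude_step (E := E) (C := C₁) hγ (by omega) (hsize t ht') (hone t ht')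
        (le_abs_self _) (hstep t ht').2 (hv _ _)
      refine le_trans (mul_le_mul_of_nonneg_right (Real.exp_le_exp.2 ?_) (hv _ _)) h1
      rw [Real.log_mul (by linarith) hn0.ne']
      linarith
  have hfine := exp_chain
    (w := fun t => v (k₀ + (n₁ + t) * r) (l₀ - (n₁ + t) * b)) (q := (A - ε) * ℓ)
    (n := n - n₁) fun t ht => by
      have ht' : n₁ + t < n := by omega
      rw [← add_assoc]
      refine exp_mul_le_of_step (E.asymb_pos (by omega) _) ?_ (hstep _ ht').2 (hv _ _)
      have hk : ε * n ≤ ((k₀ + (n₁ + t) * r : ℕ) : ℝ) := by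
        have h1 : n₁ ≤ k₀ + (n₁ + t) * r := by nlinarith
        have h2 : (n₁ : ℝ) ≤ ((k₀ + (n₁ + t) * r : ℕ) : ℝ) := by exact_mod_cast h1
        linarith
      have hl := (hbt _ ht'.le).2
      have hD : (0 : ℝ) < ((α : ℝ) + 1) ^ α := by positivity
      have h3 : (ε * n) ^ α ≤
          ((α : ℝ) + 1) ^ α * ((l₀ - (n₁ + t) * b).descFactorial α : ℝ) :=
        (pow_le_pow_left₀ (by positivity) hl _).trans (pow_le_mul_descFactorial (hstep _ ht').1)
      have h4 : E.asymb (k₀ + (n₁ + t + 1) * r) (l₀ - (n₁ + t + 1) * b) ≤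
          E.symbConst * (c * n) ^ E.m :=
        (E.asymb_le_pow (by omega)).trans (mul_le_mul_of_nonneg_left
          (pow_le_pow_left₀ (by positivity) (hsize _ ht') _)
          (by linarith [E.one_le_symbConst]))
      have e1 : Real.exp ((A - ε) * ℓ) = (n : ℝ) ^ (A - ε) := by
        rw [mul_comm, Real.exp_mul, Real.exp_log hn0]
      have eT : (n : ℝ) ^ (A - ε) * (n : ℝ) ^ E.m * (n : ℝ) ^ ε = (n : ℝ) ^ j * (n : ℝ) ^ α := by
        rw [← Real.rpow_natCast, ← Real.rpow_natCast, ← Real.rpow_natCast, ← Real.rpow_add hn0,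
          ← Real.rpow_add hn0, ← Real.rpow_add hn0, hA]
        congr 1
        rw [hα]
        push_cast
        ring
      rw [hW, div_le_iff₀ (by positivity)] at hnW
      refine le_of_mul_le_mul_left ?_ hD
      rw [e1]
      calc ((α : ℝ) + 1) ^ α * ((n : ℝ) ^ (A - ε) *
            E.asymb (k₀ + (n₁ + t + 1) * r) (l₀ - (n₁ + t + 1) * b))
          ≤ ((α : ℝ) + 1) ^ α * ((n : ℝ) ^ (A - ε) * (E.symbConst * (c * n) ^ E.m)) := by gcongr
        _ = (n : ℝ) ^ (A - ε) * (n : ℝ) ^ E.m *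
            (E.symbConst * c ^ E.m * ((α : ℝ) + 1) ^ α) := by rw [mul_pow]; ring
        _ ≤ (n : ℝ) ^ (A - ε) * (n : ℝ) ^ E.m * ((n : ℝ) ^ ε * (γ * (ε ^ j * ε ^ α))) := by gcongr
        _ = (n : ℝ) ^ j * (n : ℝ) ^ α * (γ * (ε ^ j * ε ^ α)) := by rw [← eT]; ring
        _ = γ * ((ε * n) ^ j * (ε * n) ^ α) := by rw [mul_pow, mul_pow]; ring
        _ ≤ γ * (((k₀ + (n₁ + t) * r : ℕ) : ℝ) ^ j * (((α : ℝ) + 1) ^ α *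
            ((l₀ - (n₁ + t) * b).descFactorial α : ℝ))) := by gcongr
        _ = _ := by ring
  simp only [zero_mul, add_zero, Nat.sub_zero] at hcrude hfine
  rw [show n₁ + (n - n₁) = n by omega] at hfine
  have htot := exp_mul_trans hcrude hfine
  refine le_trans (mul_le_mul_of_nonneg_right (Real.exp_le_exp.2 ?_) (hv _ _)) htot
  rw [Nat.cast_sub hn₁n]
  have hℓ0 : 0 ≤ ℓ := by linarith
  have h1 : (n₁ : ℝ) * (E.m + 1) ≤ 2 * (ε * n) * (E.m + 1) := by gcongr
  have h2 : (n₁ : ℝ) * A ≤ 2 * (ε * n) * |A| :=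
    (mul_le_mul_of_nonneg_left (le_abs_self A) (by positivity)).trans (by gcongr)
  have h3 : 0 ≤ (n₁ : ℝ) * ε := by positivity
  have h4 : (A - ε * (2 * |A| + 1 + 2 * (E.m + 1))) * n ≤
      n₁ * -(E.m + 1) + (n - n₁) * (A - ε) := by linarith
  calc _ = (A - ε * (2 * |A| + 1 + 2 * (E.m + 1))) * n * ℓ := by ring
    _ ≤ _ := mul_le_mul_of_nonneg_right h4 hℓ0
    _ = _ := by ring

/-- A starting value of size exp(ρ b n log n) at l ≈ bn is multiplied by exp(A n log n) along n
steps. The end point has k ≈ rn and l = O(εn), where the Gevrey bound is essentially exp((s-1) r n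
log n). -/
theorem _root_.TotChar.Reach.le_of_nonlinear (hv : ∀ k l, 0 ≤ v k l) {ρ : ℝ}
    (hR : Reach v ρ) (hρ : 0 ≤ ρ)
    {j μ b r : ℕ} {γ : ℝ} (hγ : 0 < γ)
    (hG : ∀ k l : ℕ,
      γ * ((k : ℝ) ^ j * ((l + (μ + b)).descFactorial (μ + b) : ℝ)) * v k (l + (μ + b)) ≤
        E.asymb (k + r) (l + μ) * v (k + r) (l + μ))
    (hr : 1 ≤ r) {C s σ : ℝ} (hC : 0 ≤ C) (hs : 1 ≤ s) (hσ : 1 ≤ σ)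
    (hub : ∀ k l : ℕ, v k l ≤ Real.exp (C * ((k : ℝ) + l + 1) +
      (s - 1) * (k * Real.log k) + (σ - 1) * (l * Real.log l))) :
    (j + (μ + b) - E.m : ℝ) + ρ * b ≤ (s - 1) * r := by
  obtain ⟨A, hA⟩ : ∃ A : ℝ, A = j + (μ + b) - E.m := ⟨_, rfl⟩
  rw [← hA]
  have hs' : 0 ≤ s - 1 := by linarith
  have hσ' : 0 ≤ σ - 1 := by linarith
  refine le_of_forall_small
    (K := 2 * |A| + 4 + ρ * b + 2 * (E.m + 1) + (s - 1) * (r + 2) + 6 * (σ - 1))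
    (by positivity) fun ε hε hε1 => ?_
  have hb0 : (0 : ℝ) ≤ b := by positivity
  have hr0 : (0 : ℝ) ≤ r := by positivity
  -- As T ≤ (b+2)n, this turns the errors of `Reach`, measured in T, into errors of size εn.
  set ε₂ := ε / (b + 2) with hε₂
  have hε₂0 : 0 < ε₂ := by positivity
  have hε₂b : ε₂ * (b + 2) = ε := by rw [hε₂]; field_simp
  have htend : Tendsto (fun n : ℕ => ⌈(b + ε) * (n : ℝ)⌉₊) atTop atTop :=
    tendsto_nat_ceil_atTop.comp
      (tendsto_natCast_atTop_atTop.const_mul_atTop (by positivity : 0 < (b : ℝ) + ε))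
  have hev := (htend.eventually (hR ε₂ hε₂0)).and
    ((eventually_nonlinear_chain hv hγ hG hr hε hε1 hA).and
    ((eventually_le_mul_log (-Real.log ε) hε).and
    ((eventually_le_mul_log (Real.log (b + 2)) one_pos).and
    ((eventually_le_mul_log (C * (r + 5)) hε).and
    ((eventually_le_mul_log (Real.log (r + 1)) hε).and
    ((eventually_le_mul_log (Real.log 3) one_pos).and
    ((eventually_le_mul 1 hε).and (eventually_ge_atTop 1))))))))
  obtain ⟨n, ⟨k, l, hk, hkT, hTl, hlT, hvkl⟩, hchain, hlogε, hlogb, hlogC, hlogr, hlog3, hεn,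
    hn1⟩ := hev.exists
  rw [one_mul] at hlogb hlog3
  set T := ⌈(b + ε) * (n : ℝ)⌉₊ with hT
  set ℓ := Real.log n with hℓ
  have hn0 : (0 : ℝ) < n := by exact_mod_cast hn1
  have hεn' : ε * n ≤ n := mul_le_of_le_one_left hn0.le hε1
  have hℓ0 : 0 ≤ ℓ := Real.log_natCast_nonneg n
  have hTl' : (b + ε) * n ≤ T := Nat.le_ceil _
  have hTu : (T : ℝ) ≤ (b + 2 * ε) * n := by
    have := (Nat.ceil_lt_add_one (by positivity : 0 ≤ (b + ε) * (n : ℝ))).le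
    rw [← hT] at this
    linarith
  have hTu2 : (T : ℝ) ≤ (b + 2) * n := hTu.trans (by gcongr; linarith)
  have hε₂T : ε₂ * T ≤ ε * n := by
    calc ε₂ * T ≤ ε₂ * ((b + 2) * n) := by gcongr
      _ = ε₂ * (b + 2) * n := by ring
      _ = _ := by rw [hε₂b]
  have hbn : (0 : ℝ) ≤ b * n := by positivity
  have hεT : ε * n ≤ T := by linarith
  have hT0 : (0 : ℝ) < T := by linarith
  have hlu : (l : ℝ) ≤ (b + 3 * ε) * n := by linarith
  have hnb : n * b ≤ l := by
    have : (n : ℝ) * b ≤ l := by linarith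
    exact_mod_cast this
  have hfin := hchain k l hk (hkT.trans hε₂T) (hTl'.trans hTl) hlu
  have hX : 0 ≤ n * ℓ := by positivity
  -- the starting value
  have hlogT : (1 - ε) * ℓ ≤ Real.log T := by
    have := Real.log_le_log (by positivity) hεT
    rw [Real.log_mul hε.ne' hn0.ne'] at this
    linarith
  have hlogT' : Real.log T ≤ 2 * ℓ := by
    have := Real.log_le_log hT0 hTu2
    rw [Real.log_mul (by positivity) hn0.ne'] at this
    linarith
  have hlogT0 : 0 ≤ Real.log T := le_trans (mul_nonneg (by linarith) hℓ0) hlogT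
  have hstart : (ρ * b * (1 - ε) - 2 * ε) * (n * ℓ) ≤ (ρ - ε₂) * (T * Real.log T) := by
    have h1 : b * n * ((1 - ε) * ℓ) ≤ T * Real.log T :=
      mul_le_mul (by linarith) hlogT (mul_nonneg (by linarith) hℓ0) hT0.le
    have h2 : ε₂ * T * Real.log T ≤ ε * n * (2 * ℓ) :=
      mul_le_mul hε₂T hlogT' hlogT0 (by positivity)
    have h3 := mul_le_mul_of_nonneg_left h1 hρ
    linarith
  -- the final value
  have hkn : ((k + n * r : ℕ) : ℝ) ≤ (r + ε) * n := by
    push_cast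
    linarith
  have hln : ((l - n * b : ℕ) : ℝ) ≤ 3 * (ε * n) := by
    rw [Nat.cast_sub hnb]
    push_cast
    linarith
  have hln1 : (1 : ℝ) ≤ ((l - n * b : ℕ) : ℝ) := by
    rw [Nat.cast_sub hnb]
    push_cast
    linarith
  have hkn1 : (1 : ℝ) ≤ ((k + n * r : ℕ) : ℝ) := by exact_mod_cast (by omega : 1 ≤ k + n * r)
  have hend := hub (k + n * r) (l - n * b)
  set k' := k + n * r
  set l' := l - n * b
  have hCC : C * ((k' : ℝ) + l' + 1) ≤ ε * (n * ℓ) := by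
    calc C * ((k' : ℝ) + l' + 1) ≤ C * ((r + 5) * n) :=
          mul_le_mul_of_nonneg_left (by linarith) hC
      _ = C * (r + 5) * n := by ring
      _ ≤ ε * ℓ * n := mul_le_mul_of_nonneg_right hlogC hn0.le
      _ = _ := by ring
  have hkk : k' * Real.log k' ≤ (r + ε * (r + 2)) * (n * ℓ) := by
    have h1 : Real.log k' ≤ (1 + ε) * ℓ := by
      have h2 : (k' : ℝ) ≤ (r + 1) * n := by linarith
      have := Real.log_le_log (by linarith) h2
      rw [Real.log_mul (by positivity) hn0.ne'] at this
      linarith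
    calc k' * Real.log k' ≤ (r + ε) * n * ((1 + ε) * ℓ) :=
          mul_le_mul hkn h1 (Real.log_nonneg hkn1) (by positivity)
      _ = (r + ε * (r + 1 + ε)) * (n * ℓ) := by ring
      _ ≤ _ := mul_le_mul_of_nonneg_right (by
        have := mul_le_mul_of_nonneg_left hε1 hε.le
        linarith) hX
  have hll : l' * Real.log l' ≤ 6 * ε * (n * ℓ) := by
    have h1 : Real.log l' ≤ 2 * ℓ := by
      have h2 : (l' : ℝ) ≤ 3 * n := by linarith
      have := Real.log_le_log (by linarith) h2
      rw [Real.log_mul (by norm_num) hn0.ne'] at this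
      linarith
    calc l' * Real.log l' ≤ 3 * (ε * n) * (2 * ℓ) :=
          mul_le_mul hln h1 (Real.log_nonneg hln1) (by positivity)
      _ = _ := by ring
  have hexp := (mul_le_mul_of_nonneg_left hvkl (Real.exp_pos _).le).trans (hfin.trans hend)
  rw [← Real.exp_add, Real.exp_le_exp] at hexp
  have h1 := mul_le_mul_of_nonneg_left hkk hs'
  have h2 := mul_le_mul_of_nonneg_left hll hσ'
  have hX0 : 0 < n * ℓ := by
    have : 0 < Real.log 3 := Real.log_pos (by norm_num)
    exact mul_pos hn0 (by linarith)
  refine le_of_mul_le_mul_right ?_ hX0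
  linarith

end Equation
-- Necessity of the two index conditions.
namespace Equation

variable {E : Equation}

theorem one_le_of_coeff_add_single_ne_zero {i μ : ℕ} {ν : E.M → ℕ} {p : E.M}
    (hg : PowerSeries.coeff μ (E.g i (ν + Pi.single p 1)) ≠ 0) : 1 ≤ i + ∑ q, ν q := by
  classical
  by_contra hlt
  refine hg ?_
  rw [E.g_low, map_zero]
  have : ∑ q, (ν + Pi.single p 1 : E.M → ℕ) q = ∑ q, ν q + 1 := by
    simp only [Pi.add_apply, Finset.sum_add_distrib, Finset.sum_pi_single', Finset.mem_univ,
      if_true]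
  omega

namespace SignCond

variable (hE : E.SignCond) {u : ℂ⟦X⟧⟦X⟧} (hu : E.IsFormalSolution u)
  (ham : PowerSeries.coeff E.m E.a ≠ 0) (ha : ∀ μ ≤ E.maxAlpha, PowerSeries.coeff μ E.a ≠ 0)
  (hdep : ∃ (i : ℕ) (ν : E.M → ℕ), 1 ≤ ∑ p, ν p ∧ E.g i ν ≠ 0)
include hE hu ham ha hdep

/-- One monomial depending on z provides the base points with large k. Strict separation from the
polygon is only available for y < d, so the exponent d/p itself is obtained as a limit. -/
theorem reach_dist {p : ℕ × ℕ} (hp : p ∈ E.Lam1) (hd : 0 < E.dist p) :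
    Reach (size u) (E.dist p / E.ordC p) := by
  classical
  obtain ⟨i, ν, hν, hg⟩ := hdep
  obtain ⟨p₀, -, hp₀⟩ := Finset.exists_ne_zero_of_sum_ne_zero (by omega : ∑ p, ν p ≠ 0)
  obtain ⟨μ₀, hμ₀⟩ : ∃ μ, PowerSeries.coeff μ (E.g i ν) ≠ 0 := by
    by_contra! h
    exact hg (PowerSeries.ext fun n => by rw [h n, map_zero])
  obtain ⟨ν', rfl⟩ : ∃ ν', ν = ν' + Pi.single p₀ 1 := by
    refine ⟨ν - Pi.single p₀ 1, (tsub_add_cancel_of_le fun q => ?_).symm⟩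
    by_cases hq : q = p₀
    · subst hq
      rw [Pi.single_eq_same]
      exact Nat.one_le_iff_ne_zero.2 hp₀
    · rw [Pi.single_eq_of_ne hq]
      exact Nat.zero_le _
  obtain ⟨γ, hγ, hG⟩ := hE.exists_nonlinear_step hu ha hμ₀
  have hord := E.one_le_ordC hp
  have hord' : (0 : ℝ) < E.ordC p := by exact_mod_cast hord
  have hpm : p.2 ≤ E.m := by
    have := (mem_indexI.1 hp.1).2
    omega
  have hc : 0 < ‖PowerSeries.coeff (E.ordC p) (E.c p)‖ := norm_pos_iff.2 (E.coeff_ordC_ne_zero hp)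
  obtain ⟨C, r₀, δ, hC, hr₀, hbase⟩ := exists_base (size_nonneg u) hc hord hpm
    (hE.linear_step hu hp) (hE.size_one_pos hu ham) hγ
    (one_le_of_coeff_add_single_ne_zero hμ₀) hG
  refine Reach.of_forall_lt (fun ρ hρ hρ0 => ?_) (by positivity)
  have hy0 : 0 < ρ * E.ordC p := by positivity
  obtain ⟨θ, hθ0, hθ1, hθ⟩ := E.exists_slope hp.1 hy0 ((lt_div_iff₀ hord').1 hρ)
  have := reach_of_slope (size_nonneg u) hc hord hpm (hE.linear_step hu hp) hC hr₀ hbase hy0 hθ0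
    hθ1 hθ
  rwa [mul_div_cancel_right₀ _ hord'.ne'] at this

theorem reach_sigma0 (h1 : 1 < E.sigma0) : Reach (size u) (E.sigma0 - 1) := by
  have hmem : E.sigma0 ∈ insert 1
      ((fun p => ((E.ordC p : ℝ) + E.dist p) / (E.ordC p : ℝ)) '' E.Lam1) :=
    Set.Nonempty.csSup_mem (Set.insert_nonempty _ _) ((E.finite_Lam1.image _).insert 1)
  obtain h | ⟨p, hp, h⟩ := hmem
  · exact absurd h h1.ne'
  have hord' : (0 : ℝ) < E.ordC p := by exact_mod_cast E.one_le_ordC hp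
  have e : E.sigma0 - 1 = E.dist p / E.ordC p := by
    rw [← h]
    field_simp
    ring
  rw [e]
  refine hE.reach_dist hu ham ha hdep hp ?_
  have : 0 < E.dist p / E.ordC p := by rw [← e]; linarith
  exact (div_pos_iff_of_pos_right hord').1 this

/-- Put b = α-μ, ρ = σ₀-1 and r = L: then j+μ+b-m+ρb = j+μ+σ₀(α-μ)-m, so the chain estimate is the
inequality defining s₁. -/
theorem s1_le (h1 : 1 < E.sigma0) {s σ : ℝ} (hs : 1 ≤ s) (hσ : 1 ≤ σ) (h : IsGevrey s σ u) :
    E.s1 ≤ s := by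
  obtain ⟨C, hC, hub⟩ := exists_size_le hs hσ h
  rw [s1, ← le_sub_iff_add_le']
  refine csSup_le (Set.insert_nonempty _ _) ?_
  rintro _ (rfl | ⟨μ, -, p, hμ, rfl⟩)
  · linarith
  split_ifs with hL
  · linarith
  obtain ⟨n, hn⟩ := ENat.ne_top_iff_exists.1 hL
  -- A finite valuation is attained: were no monomial of degree n present, the infimum would be at
  -- least n+1. The numerical factors ν+1 and μ! do not affect vanishing.
  obtain ⟨i, ν, hiν, hne⟩ : ∃ i, ∃ ν : E.M → ℕ, i + ∑ q, ν q = n ∧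
      PowerSeries.coeff μ (E.g i (ν + Pi.single p 1)) ≠ 0 := by
    by_contra! hcon
    have h2 : ((n + 1 : ℕ) : ℕ∞) ≤ E.L μ p := by
      refine le_iInf fun i => le_iInf fun ν => le_iInf fun hne => Nat.cast_le.2 ?_
      have hle : E.L μ p ≤ ((i + ∑ q, ν q : ℕ) : ℕ∞) :=
        iInf_le_of_le i (iInf_le_of_le ν (iInf_le _ hne))
      rw [← hn, Nat.cast_le] at hle
      have hne' : i + ∑ q, ν q ≠ n := fun heq => hne (by
        simp only [PowerSeries.constantCoeff_iterate_derivative, hcon i ν heq, mul_zero])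
      omega
    rw [← hn, Nat.cast_le] at h2
    omega
  have hn1 : 1 ≤ n := hiν ▸ one_le_of_coeff_add_single_ne_zero hne
  obtain ⟨γ, hγ, hG⟩ := hE.exists_nonlinear_step hu ha hne
  rw [hiν] at hG
  obtain ⟨b, hb⟩ := Nat.exists_eq_add_of_le hμ
  rw [hb] at hG
  have := Reach.le_of_nonlinear (size_nonneg u) (hE.reach_sigma0 hu ham ha hdep h1) (by linarith)
    hγ hG hn1 hC hs hσ hub
  rw [← hn, ENat.toNat_natCast, div_le_iff₀ (by exact_mod_cast hn1), hb]
  push_cast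
  linarith

end SignCond
end Equation
end TotChar

theorem theorem6p3 (E : TotChar.Equation)
    (h_s : E.s0 = E.s1)
    -- degenerate cases in which the equivalence fails are excluded
    (h_one : E.sigma0 = 1 → E.s0 = 1)
    (h_dep : 1 < E.sigma0 → ∃ (i : ℕ) (ν : E.M → ℕ), 1 ≤ ∑ p, ν p ∧ E.g i ν ≠ 0)
    -- positivity of `a`
    (h_am : 0 < PowerSeries.constantCoeff ((PowerSeries.derivative ℂ)^[E.m] E.a))
    (h_aμ : ∀ μ ≤ E.maxAlpha,
      0 < PowerSeries.constantCoeff ((PowerSeries.derivative ℂ)^[μ] E.a))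
    (h_a : TotChar.SeriesNonneg E.a)
    -- `c_{j,α}(0) ≤ 0`
    (h_c0 : ∀ p ∈ TotChar.indexI E.m, PowerSeries.constantCoeff (E.c p) ≤ 0)
    -- `c_{j,α}(x) - c_{j,α}(0) ≫ 0`
    (h_c : ∀ p ∈ TotChar.indexI E.m,
      TotChar.SeriesNonneg (E.c p - PowerSeries.C (PowerSeries.constantCoeff (E.c p))))
    -- `g_{i,ν}(x) ≫ 0`
    (h_g : ∀ (i : ℕ) (ν : E.M → ℕ), 2 ≤ i + ∑ p, ν p → TotChar.SeriesNonneg (E.g i ν)) :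
    (∃! u : ℂ⟦X⟧⟦X⟧, E.IsFormalSolution u) ∧
      ∀ u : ℂ⟦X⟧⟦X⟧, E.IsFormalSolution u →
        ∀ s σ : ℝ, 1 ≤ s → 1 ≤ σ →
          (TotChar.IsGevrey s σ u ↔ E.s0 ≤ s ∧ E.sigma0 ≤ σ) := by
  have hE : E.SignCond := ⟨h_a, h_c0, h_c, h_g⟩
  have ham := TotChar.Equation.coeff_pos_of_iterate_derivative h_am
  have ha : ∀ μ ≤ E.maxAlpha, PowerSeries.coeff μ E.a ≠ 0 := fun μ hμ =>
    TotChar.Equation.coeff_pos_of_iterate_derivative (h_aμ μ hμ)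
  refine ⟨hE.existsUnique, fun u hu s σ hs hσ => ⟨fun h => ?_, fun h => hE.isGevrey hu h.1 h.2⟩⟩
  -- For σ₀ = 1 both indices equal 1 and nothing is to be shown; the growth argument needs σ₀ > 1,
  -- so that some point of Λ₁ lies off the Newton polygon.
  rcases E.one_le_sigma0.eq_or_lt with h1 | h1
  · rw [← h1, h_one h1.symm]
    exact ⟨hs, hσ⟩
  · refine ⟨h_s ▸ hE.s1_le hu ham ha (h_dep h1) h1 hs hσ h, ?_⟩
    obtain ⟨C, hC, hub⟩ := TotChar.Equation.exists_size_le hs hσ h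
    have := (hE.reach_sigma0 hu ham ha (h_dep h1) h1).le_sub_one hC hs hσ hub
    linarith
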